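/- Let $(I,\cdot)$ be a finite bar-consistent anisotropic super Cartan datum with at least one odd index: $I$ is a finite set with a parity $p:I\to\{0,1\}$, not identically $0$, and a symmetric $\mathbb Z$-valued bilinear form on $\mathbb Z[I]$ with $d_i=\frac{i\cdot i}{2}\in\mathbb Z_{>0}$, $a_{ij}=\frac{2\, i\cdot j}{i\cdot i}\in\mathbb Z_{\le 0}$ for $i\neq j$, $a_{ij}\in 2\mathbb Z$ if $p(i)=1$, and $d_i\equiv p(i) \bmod 2$. Let $(Y,X,\langle\cdot,\cdot\rangle)$ be a $Y$-regular root datum for it: $Y,X$ are finitely generated free abelian groups with a perfect pairing $Y\times X\to\mathbb Z$, and there are embeddings $i\mapsto i$ of $I$ in $Y$ with linearly independent image and $i\mapsto i'$ of $I$ in $X$, with $\langle i,j'\rangle=a_{ij}$. Let $R=\mathbb Q(v)[\pi]/(\pi^2-1)$, $v_i=v^{d_i}$, $\pi_i=\pi^{d_i}$, $[n]_{v_i,\pi_i}=\frac{(\pi_iv_i)^n-v_i^{-n}}{\pi_iv_i-v_i^{-1}}$, with factorials and binomial coefficients formed accordingly. Let $\mathbf U$ be the quantum covering group, i.e. the unital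 $R$-algebra with generators $E_i,F_i$ $(i\in I)$, $K_\mu,J_\mu$ $(\mu\in Y)$ and relations (with $\tilde K_{\pm i}=K_{\pm d_i i}$, $\tilde J_i=J_{d_i i}$): $J_\mu J_\nu=J_{\mu+\nu}$, $K_\mu K_\nu=K_{\mu+\nu}$, $K_0=J_0=J_\nu^2=1$, $J_\mu K_\nu=K_\nu J_\mu$; $J_\mu E_i=\pi^{\langle\mu,i'\rangle}E_iJ_\mu$, $J_\mu F_i=\pi^{-\langle\mu,i'\rangle}F_iJ_\mu$, $K_\mu E_i=v^{\langle\mu,i'\rangle}E_iK_\mu$, $K_\mu F_i=v^{-\langle\mu,i'\rangle}F_iK_\mu$; $E_iF_j-\pi^{p(i)p(j)}F_jE_i=\delta_{ij}\frac{\tilde J_i\tilde K_i-\tilde K_{-i}}{\pi_iv_i-v_i^{-1}}$; and, for $i\ne j$ and $b=1-a_{ij}$, $\sum_{k=0}^{b}(-1)^k\pi^{\binom k2p(i)+kp(i)p(j)}\begin{bmatrix}b\\k\end{bmatrix}_{v_i,\pi_i}x_i^{b-k}x_jx_i^k=0$ for $x=E$ and for $x=F$. It is $\mathbb Z[I]$-graded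 with $|E_i|=i$, $|F_i|=-i$, $|K_\mu|=|J_\mu|=0$; degrees act on $X$ through $i\mapsto i'$. Let $\dot{\mathbf U}$ be the modified form: the non-unital $R$-algebra spanned by symbols $x1_\lambda$ and $1_\lambda x$ ($x\in\mathbf U$, $\lambda\in X$, linear in $x$), with $x1_\lambda\, y1_\eta=\delta_{\lambda,\eta+|y|}(xy)1_\eta$ and $x1_\lambda=1_{\lambda+|x|}x$ for homogeneous $x,y$, $K_\nu1_\lambda=v^{\langle\nu,\lambda\rangle}1_\lambda$, $J_\nu1_\lambda=\pi^{\langle\nu,\lambda\rangle}1_\lambda$. It is a $\mathbf U$-bimodule by $x(y1_\lambda)z=(xyz)1_{\lambda-|z|}$ ($z$ homogeneous). Let $\tau_1,\bar\tau_1,\rho$ be the $R$-linear anti-automorphisms and $\omega$ the $R$-algebra automorphism of $\mathbf U$ given by - $\tau_1$: $E_i\mapsto v_i^{-1}\tilde K_{-i}F_i$, $F_i\mapsto v_i^{-1}\tilde K_iE_i$, $K_\mu\mapsto K_\mu$, $J_\mu\mapsto J_\mu$; - $\bar\tau_1$: $E_i\mapsto \pi_iv_i^{-1}F_i\tilde J_i\tilde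 K_i$, $F_i\mapsto\pi_iv_i^{-1}E_i\tilde J_i\tilde K_{-i}$, $K_\mu\mapsto K_\mu$, $J_\mu\mapsto J_\mu$; - $\rho$: $E_i\mapsto\pi_i\tilde J_iE_i$, $F_i\mapsto F_i$, $K_\mu\mapsto K_{-\mu}$, $J_\mu\mapsto J_\mu$; - $\omega$: $E_i\mapsto F_i$, $F_i\mapsto\pi_i\tilde J_iE_i$, $K_\mu\mapsto K_{-\mu}$, $J_\mu\mapsto J_\mu$; and extend $\omega,\rho$ to $\dot{\mathbf U}$ by $\omega(x1_\lambda)=\omega(x)1_{-\lambda}$, $\rho(x1_\lambda)=1_{-\lambda}\rho(x)$. Let $\mathbf f$ be the $R$-algebra with generators $\theta_i$ and the Serre relations above (for $x=\theta$), and $x\mapsto x^-$ the homomorphism $\mathbf f\to\mathbf U$, $\theta_i\mapsto F_i$. The bilinear form $(\cdot,\cdot)$ on $\mathbf f$ is induced from the form on the free algebra on the $\theta_i$ for which $(1,x)$ is the constant term of $x$ and $(\theta_iy,x)=(1-\pi_iv_i^2)^{-1}(y,{}_ir(x))$, where ${}_ir$ is linear, ${}_ir(\theta_j)=\delta_{ij}$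 and ${}_ir(xy)={}_ir(x)y+\pi^{p(x)p(i)}v^{-i\cdot|x|}x\,{}_ir(y)$ for homogeneous $x$. Then there is a unique $R$-bilinear form $(\cdot,\cdot):\dot{\mathbf U}\times\dot{\mathbf U}\to R$ such that (1) $(1_{\lambda_1}x1_{\lambda_2},1_{\lambda_1'}x'1_{\lambda_2'})=0$ unless $\lambda_1=\lambda_1'$ and $\lambda_2=\lambda_2'$; (2) $(ux,y)=(x,\tau_1(u)y)$ for all $u\in\mathbf U$, $x,y\in\dot{\mathbf U}$; (3) $(x^-1_\lambda,x'^-1_\lambda)=(x,x')$ for all $x,x'\in\mathbf f$, $\lambda\in X$; (4) $(x,y)=(y,x)$ for all $x,y\in\dot{\mathbf U}$. For all $x,y\in\dot{\mathbf U}$ and $u\in\mathbf U$ this form satisfies $$(xu,y)=(x,y\,\bar\tau_1(u)),\qquad (\rho(x),\rho(y))=(x,y),\qquad (\omega(x),\omega^{-1}(y))=(x,y).$$ -/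

import Mathlib

noncomputable section

namespace QCov

/-! ### The ground ring `ℚ(v)^π = ℚ(v)[π]/(π² - 1)` -/

/-- The ring `ℚ(v)^π = ℚ(v)[π]/(π² - 1)`. -/
def QvPi : Type := AdjoinRoot (Polynomial.X ^ 2 - 1 : Polynomial (RatFunc ℚ))

instance : CommRing QvPi :=
  inferInstanceAs (CommRing (AdjoinRoot (Polynomial.X ^ 2 - 1 : Polynomial (RatFunc ℚ))))

instance : Algebra (RatFunc ℚ) QvPi :=
  inferInstanceAs (Algebra (RatFunc ℚ)
    (AdjoinRoot (Polynomial.X ^ 2 - 1 : Polynomial (RatFunc ℚ))))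

/-- The element `π`, as an element of `ℚ(v)^π`. -/
def piElt : QvPi := AdjoinRoot.root (Polynomial.X ^ 2 - 1 : Polynomial (RatFunc ℚ))

theorem piElt_mul_self : piElt * piElt = 1 := by
  have h := AdjoinRoot.eval₂_root (Polynomial.X ^ 2 - 1 : Polynomial (RatFunc ℚ))
  simp only [Polynomial.eval₂_sub, Polynomial.eval₂_X_pow, Polynomial.eval₂_one] at h
  have h' : piElt ^ 2 - 1 = 0 := h
  rw [← sq]
  exact sub_eq_zero.mp h'

/-- `π` as a unit. -/
def piU : QvPiˣ := ⟨piElt, piElt, piElt_mul_self, piElt_mul_self⟩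

/-- `v` as a unit. -/
def vU : QvPiˣ :=
  Units.map (algebraMap (RatFunc ℚ) QvPi).toMonoidHom (Units.mk0 RatFunc.X RatFunc.X_ne_zero)

/-- The scalar `π^a v^b` of `ℚ(v)^π`. -/
def pv (a b : ℤ) : QvPi := ((piU ^ a * vU ^ b : QvPiˣ) : QvPi)

theorem pv_mul (a b c d : ℤ) : pv a b * pv c d = pv (a + c) (b + d) := by
  simp only [pv, ← Units.val_mul, zpow_add]
  congr 1
  rw [mul_mul_mul_comm]

theorem pv_zero : pv 0 0 = 1 := by simp [pv]

theorem piU_sq : piU ^ (2 : ℤ) = 1 := by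
  ext
  simpa [zpow_ofNat, sq, piU] using piElt_mul_self

theorem pv_congr {a b c d : ℤ} (h : Even (a - c)) (hb : b = d) : pv a b = pv c d := by
  obtain ⟨k, hk⟩ := h
  have : a = c + 2 * k := by omega
  rw [pv, pv, this, hb, zpow_add, zpow_mul, piU_sq, one_zpow, mul_one]

/-- `π^a v^m - v^n` is invertible in `ℚ(v)^π` for `m ≠ n`; so all the inverses below exist. -/
theorem isUnit_pv_sub (a : ℤ) {m n : ℤ} (h : m ≠ n) : IsUnit (pv a m - pv 0 n) := by
  have hX : (RatFunc.X : RatFunc ℚ) ^ (2 * m) - RatFunc.X ^ (2 * n) ≠ 0 := by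
    have key : ∀ k : ℕ, k ≠ 0 → (RatFunc.X : RatFunc ℚ) ^ k ≠ 1 := by
      intro k hk he
      have h1 : algebraMap (Polynomial ℚ) (RatFunc ℚ) (Polynomial.X ^ k) =
          algebraMap (Polynomial ℚ) (RatFunc ℚ) 1 := by
        simpa using he
      have h2 := RatFunc.algebraMap_injective ℚ h1
      have h3 := congrArg Polynomial.natDegree h2
      simp at h3
      exact hk h3
    have key' : ∀ k : ℤ, k ≠ 0 → (RatFunc.X : RatFunc ℚ) ^ k ≠ 1 := by
      intro k hk he
      rcases Int.natAbs_eq k with hh | hh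
      · rw [hh, zpow_natCast] at he
        exact key _ (by omega) he
      · rw [hh, zpow_neg, inv_eq_one, zpow_natCast] at he
        exact key _ (by omega) he
    intro h0
    refine key' (2 * m - 2 * n) (by omega) ?_
    rw [zpow_sub₀ RatFunc.X_ne_zero, sub_eq_zero.mp h0]
    exact div_self (zpow_ne_zero _ RatFunc.X_ne_zero)
  have hv : ∀ k : ℤ, pv 0 k = algebraMap (RatFunc ℚ) QvPi (RatFunc.X ^ k) := by
    intro k
    simp only [pv, zpow_zero, one_mul, vU, ← map_zpow]
    rw [Units.coe_map, Units.val_zpow_eq_zpow_val]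
    rfl
  have hprod : (pv a m - pv 0 n) * (pv a m + pv 0 n) =
      algebraMap (RatFunc ℚ) QvPi (RatFunc.X ^ (2 * m) - RatFunc.X ^ (2 * n)) := by
    rw [map_sub, ← hv, ← hv, sub_mul, mul_add, mul_add, pv_mul, pv_mul, pv_mul, pv_mul,
      pv_congr (a := a + a) (b := m + m) (c := 0) (d := 2 * m) (by simp) (by ring),
      pv_congr (a := a + 0) (b := m + n) (c := 0 + a) (d := n + m) (by simp) (by ring),
      pv_congr (a := 0 + 0) (b := n + n) (c := 0) (d := 2 * n) (by simp) (by ring)]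
    ring
  refine isUnit_of_mul_isUnit_left (y := pv a m + pv 0 n) ?_
  rw [hprod]
  exact (IsUnit.mk0 _ hX).map _

/-- The `(v,π)`-integer `[n]_{v_i,π_i} = ((π_i v_i)^n - v_i^{-n}) / (π_i v_i - v_i^{-1})`, where
`v_i = v^d` and `π_i = π^d`. -/
def qint (d n : ℕ) : QvPi :=
  (pv (d * n) (d * n) - pv 0 (-(d * n))) * Ring.inverse (pv d d - pv 0 (-d))

/-- The `(v,π)`-factorial `[n]^! = [1][2]⋯[n]` at `v_i = v^d`, `π_i = π^d`. -/
def qfact (d n : ℕ) : QvPi := ∏ l ∈ Finset.range n, qint d (l + 1)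

/-- The `(v,π)`-binomial coefficient `[n]^! / ([k]^! [n-k]^!)` for `0 ≤ k ≤ n`, at `v_i = v^d`,
`π_i = π^d`. -/
def qbinom (d n k : ℕ) : QvPi := qfact d n * Ring.inverse (qfact d k * qfact d (n - k))

/-! ### Cartan data and root data -/

/-- A bar-consistent anisotropic super Cartan datum on `I` with at least one odd index. The
symmetric bilinear form on `ℤ[I]` is given by its values on the basis `I`. Here
`d i = (i·i)/2`, `a i j = 2 (i·j)/(i·i)`, and `p` is the parity function. -/
structure CartanDatum (I : Type*) where
  form : I → I → ℤ
  form_symm : ∀ i j, form i j = form j i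
  d : I → ℕ
  d_pos : ∀ i, 0 < d i
  form_self : ∀ i, form i i = 2 * d i
  a : I → I → ℤ
  d_mul_a : ∀ i j, d i * a i j = form i j
  a_nonpos : ∀ i j, i ≠ j → a i j ≤ 0
  p : I → ℕ
  p_lt_two : ∀ i, p i < 2
  anisotropic : ∀ i j, p i = 1 → Even (a i j)
  bar_consistent : ∀ i, d i ≡ p i [MOD 2]
  exists_odd : ∃ i, p i = 1

variable {I : Type*}

theorem CartanDatum.even_form (C : CartanDatum I) (i j : I) : Even (C.form i j) := by
  rw [← C.d_mul_a]
  have h1 := C.p_lt_two i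
  have h2 := C.bar_consistent i
  rcases Nat.lt_or_ge (C.p i) 1 with h | h
  · have h0 : C.p i = 0 := by omega
    rw [h0] at h2
    refine Even.mul_right ?_ _
    have : Even (C.d i) := Nat.even_iff.mpr h2
    exact_mod_cast this
  · exact Even.mul_left (C.anisotropic i j (by omega)) _

/-- A `Y`-regular root datum of type `C`: a perfect pairing of `Y` and `X`, with embeddings
`i ↦ i` (`coroot`) of `I` in `Y`, with linearly independent image, and `i ↦ i'` (`root`) of `I`
in `X`, such that `⟨i, j'⟩ = 2 (i·j)/(i·i)`. -/
structure RootDatum (C : CartanDatum I) (Y X : Type*) [AddCommGroup Y] [AddCommGroup X] where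
  pairing : Y →ₗ[ℤ] X →ₗ[ℤ] ℤ
  perfect : pairing.IsPerfPair
  coroot : I → Y
  root : I → X
  root_injective : Function.Injective root
  coroot_indep : LinearIndependent ℤ coroot
  pairing_coroot_root : ∀ i j, pairing (coroot i) (root j) = C.a i j

variable {C : CartanDatum I} {Y X : Type*} [AddCommGroup Y] [AddCommGroup X]

/-- The element `d_i i` of `Y`, so that `K̃_i = K_{d_i i}` and `J̃_i = J_{d_i i}`. -/
def RootDatum.tcor (D : RootDatum C Y X) (i : I) : Y := (C.d i : ℤ) • D.coroot i

theorem RootDatum.pairing_tcor (D : RootDatum C Y X) (i j : I) :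
    D.pairing (D.tcor i) (D.root j) = C.form i j := by
  simp [RootDatum.tcor, D.pairing_coroot_root, C.d_mul_a]

/-! ### The quantum covering group `U` -/

/-- The left hand side of the quantum Serre relation for `x` in the place of the `i`-th and `y` in
the place of the `j`-th generator, with `b_{ij} = 1 - a_{ij}`. -/
def serre (C : CartanDatum I) {A : Type*} [Ring A] [Algebra QvPi A] (i j : I) (x y : A) : A :=
  ∑ k ∈ Finset.range ((1 - C.a i j).toNat + 1),
    ((-1) ^ k * pv (k.choose 2 * C.p i + k * C.p i * C.p j) 0 *
      qbinom (C.d i) (1 - C.a i j).toNat k) • (x ^ ((1 - C.a i j).toNat - k) * y * x ^ k)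

/-- Generators of `U`. -/
inductive Gen (I Y : Type*) : Type _
  | E (i : I) : Gen I Y
  | F (i : I) : Gen I Y
  | K (μ : Y) : Gen I Y
  | J (μ : Y) : Gen I Y

/-- The defining relations of `U`, for elements `e i`, `f i`, `k μ`, `j μ` of an algebra `A`. -/
structure Relations (D : RootDatum C Y X) {A : Type*} [Ring A] [Algebra QvPi A]
    (e f : I → A) (k j : Y → A) : Prop where
  J_mul : ∀ μ ν, j μ * j ν = j (μ + ν)
  K_mul : ∀ μ ν, k μ * k ν = k (μ + ν)
  K_zero : k 0 = 1
  J_zero : j 0 = 1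
  J_sq : ∀ ν, j ν * j ν = 1
  J_K : ∀ μ ν, j μ * k ν = k ν * j μ
  J_E : ∀ μ i, j μ * e i = pv (D.pairing μ (D.root i)) 0 • (e i * j μ)
  J_F : ∀ μ i, j μ * f i = pv (-D.pairing μ (D.root i)) 0 • (f i * j μ)
  K_E : ∀ μ i, k μ * e i = pv 0 (D.pairing μ (D.root i)) • (e i * k μ)
  K_F : ∀ μ i, k μ * f i = pv 0 (-D.pairing μ (D.root i)) • (f i * k μ)
  E_F : ∀ i, e i * f i - pv (C.p i * C.p i) 0 • (f i * e i) =
    Ring.inverse (pv (C.d i) (C.d i) - pv 0 (-C.d i)) •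
      (j (D.tcor i) * k (D.tcor i) - k (-D.tcor i))
  E_F_ne : ∀ i l, i ≠ l → e i * f l - pv (C.p i * C.p l) 0 • (f l * e i) = 0
  serre_E : ∀ i l, i ≠ l → serre C i l (e i) (e l) = 0
  serre_F : ∀ i l, i ≠ l → serre C i l (f i) (f l) = 0

section Presentation

variable (D : RootDatum C Y X)

local notation "FA" => FreeAlgebra QvPi (Gen I Y)
local notation "gE" => fun i => FreeAlgebra.ι QvPi (Gen.E (I := I) (Y := Y) i)
local notation "gF" => fun i => FreeAlgebra.ι QvPi (Gen.F (I := I) (Y := Y) i)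
local notation "gK" => fun μ => FreeAlgebra.ι QvPi (Gen.K (I := I) (Y := Y) μ)
local notation "gJ" => fun μ => FreeAlgebra.ι QvPi (Gen.J (I := I) (Y := Y) μ)

/-- The defining relations of `U`, as relations between elements of the free algebra. -/
inductive URel : FreeAlgebra QvPi (Gen I Y) → FreeAlgebra QvPi (Gen I Y) → Prop
  | J_mul (μ ν) : URel (gJ μ * gJ ν) (gJ (μ + ν))
  | K_mul (μ ν) : URel (gK μ * gK ν) (gK (μ + ν))
  | K_zero : URel (gK 0) 1
  | J_zero : URel (gJ 0) 1
  | J_sq (ν) : URel (gJ ν * gJ ν) 1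
  | J_K (μ ν) : URel (gJ μ * gK ν) (gK ν * gJ μ)
  | J_E (μ i) : URel (gJ μ * gE i) (pv (D.pairing μ (D.root i)) 0 • (gE i * gJ μ))
  | J_F (μ i) : URel (gJ μ * gF i) (pv (-D.pairing μ (D.root i)) 0 • (gF i * gJ μ))
  | K_E (μ i) : URel (gK μ * gE i) (pv 0 (D.pairing μ (D.root i)) • (gE i * gK μ))
  | K_F (μ i) : URel (gK μ * gF i) (pv 0 (-D.pairing μ (D.root i)) • (gF i * gK μ))
  | E_F (i) : URel (gE i * gF i - pv (C.p i * C.p i) 0 • (gF i * gE i))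
      (Ring.inverse (pv (C.d i) (C.d i) - pv 0 (-C.d i)) •
        (gJ (D.tcor i) * gK (D.tcor i) - gK (-D.tcor i)))
  | E_F_ne (i l) : i ≠ l → URel (gE i * gF l - pv (C.p i * C.p l) 0 • (gF l * gE i)) 0
  | serre_E (i l) : i ≠ l → URel (serre C i l (gE i) (gE l)) 0
  | serre_F (i l) : i ≠ l → URel (serre C i l (gF i) (gF l)) 0

/-- The quantum covering group `U` of the root datum: the unital `ℚ(v)^π`-algebra with generators
`E_i`, `F_i`, `K_μ`, `J_μ` and the relations above. -/
def U : Type _ := RingQuot (URel D)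

instance : Ring (U D) := inferInstanceAs (Ring (RingQuot (URel D)))
instance : Algebra QvPi (U D) := inferInstanceAs (Algebra QvPi (RingQuot (URel D)))

namespace U

/-- The projection of the free algebra onto `U`. -/
def proj : FreeAlgebra QvPi (Gen I Y) →ₐ[QvPi] U D := RingQuot.mkAlgHom QvPi (URel D)

def E (i : I) : U D := proj D (FreeAlgebra.ι QvPi (Gen.E i))
def F (i : I) : U D := proj D (FreeAlgebra.ι QvPi (Gen.F i))
def K (μ : Y) : U D := proj D (FreeAlgebra.ι QvPi (Gen.K μ))
def J (μ : Y) : U D := proj D (FreeAlgebra.ι QvPi (Gen.J μ))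

end U

end Presentation

theorem map_serre {A B : Type*} [Ring A] [Algebra QvPi A] [Ring B] [Algebra QvPi B]
    (g : A →ₐ[QvPi] B) (i l : I) (x y : A) :
    g (serre C i l x y) = serre C i l (g x) (g y) := by
  simp [serre, map_sum]

namespace U

variable (D : RootDatum C Y X)

theorem proj_rel {x y : FreeAlgebra QvPi (Gen I Y)} (h : URel D x y) : proj D x = proj D y :=
  RingQuot.mkAlgHom_rel QvPi h

theorem relations : Relations D (E D) (F D) (K D) (J D) where
  J_mul μ ν := by simpa [E, F, K, J] using proj_rel D (URel.J_mul μ ν)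
  K_mul μ ν := by simpa [E, F, K, J] using proj_rel D (URel.K_mul μ ν)
  K_zero := by simpa [E, F, K, J] using proj_rel D (URel.K_zero )
  J_zero := by simpa [E, F, K, J] using proj_rel D (URel.J_zero )
  J_sq ν := by simpa [E, F, K, J] using proj_rel D (URel.J_sq ν)
  J_K μ ν := by simpa [E, F, K, J] using proj_rel D (URel.J_K μ ν)
  J_E μ i := by simpa [E, F, K, J] using proj_rel D (URel.J_E μ i)
  J_F μ i := by simpa [E, F, K, J] using proj_rel D (URel.J_F μ i)
  K_E μ i := by simpa [E, F, K, J] using proj_rel D (URel.K_E μ i)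
  K_F μ i := by simpa [E, F, K, J] using proj_rel D (URel.K_F μ i)
  E_F i := by simpa [E, F, K, J] using proj_rel D (URel.E_F i)
  E_F_ne i l h := by simpa [E, F, K, J] using proj_rel D (URel.E_F_ne i l h)
  serre_E i l h := by
    have := proj_rel D (URel.serre_E i l h)
    rw [map_serre, map_zero] at this
    exact this
  serre_F i l h := by
    have := proj_rel D (URel.serre_F i l h)
    rw [map_serre, map_zero] at this
    exact this

variable {D}

/-- The values on the generators of a homomorphism out of `U`. -/
def genMap {A : Type*} (e f : I → A) (k j : Y → A) : Gen I Y → A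
  | .E i => e i
  | .F i => f i
  | .K μ => k μ
  | .J μ => j μ

variable {A : Type*} [Ring A] [Algebra QvPi A]

/-- The homomorphism from `U` given by elements that satisfy the defining relations. -/
def lift {e f : I → A} {k j : Y → A} (h : Relations D e f k j) : U D →ₐ[QvPi] A :=
  RingQuot.liftAlgHom QvPi ⟨FreeAlgebra.lift QvPi (genMap e f k j), by
    intro x y hxy
    cases hxy
    case J_mul μ ν => simpa [genMap] using h.J_mul μ ν
    case K_mul μ ν => simpa [genMap] using h.K_mul μ ν
    case K_zero => simpa [genMap] using h.K_zero
    case J_zero => simpa [genMap] using h.J_zero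
    case J_sq ν => simpa [genMap] using h.J_sq ν
    case J_K μ ν => simpa [genMap] using h.J_K μ ν
    case J_E μ i => simpa [genMap] using h.J_E μ i
    case J_F μ i => simpa [genMap] using h.J_F μ i
    case K_E μ i => simpa [genMap] using h.K_E μ i
    case K_F μ i => simpa [genMap] using h.K_F μ i
    case E_F i => simpa [genMap] using h.E_F i
    case E_F_ne i l hil => simpa [genMap] using h.E_F_ne i l hil
    case serre_E i l hil => simpa [map_serre, genMap] using h.serre_E i l hil
    case serre_F i l hil => simpa [map_serre, genMap] using h.serre_F i l hil⟩

variable {e f : I → A} {k j : Y → A} (h : Relations D e f k j)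

theorem lift_proj (x : FreeAlgebra QvPi (Gen I Y)) :
    lift h (proj D x) = FreeAlgebra.lift QvPi (genMap e f k j) x :=
  RingQuot.liftAlgHom_mkAlgHom_apply (S := QvPi) _ _ x

@[simp] theorem lift_E (i : I) : lift h (E D i) = e i := by
  rw [E, lift_proj, FreeAlgebra.lift_ι_apply, genMap]

@[simp] theorem lift_F (i : I) : lift h (F D i) = f i := by
  rw [F, lift_proj, FreeAlgebra.lift_ι_apply, genMap]

@[simp] theorem lift_K (μ : Y) : lift h (K D μ) = k μ := by
  rw [K, lift_proj, FreeAlgebra.lift_ι_apply, genMap]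

@[simp] theorem lift_J (μ : Y) : lift h (J D μ) = j μ := by
  rw [J, lift_proj, FreeAlgebra.lift_ι_apply, genMap]

/-- Homomorphisms out of `U` are determined by their values on the generators. -/
theorem hom_ext {g g' : U D →ₐ[QvPi] A} (hE : ∀ i, g (E D i) = g' (E D i))
    (hF : ∀ i, g (F D i) = g' (F D i)) (hK : ∀ μ, g (K D μ) = g' (K D μ))
    (hJ : ∀ μ, g (J D μ) = g' (J D μ)) : g = g' := by
  refine RingQuot.ringQuot_ext' (S := QvPi) g g' ?_
  refine FreeAlgebra.hom_ext ?_
  funext x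
  cases x with
  | E i => exact hE i
  | F i => exact hF i
  | K μ => exact hK μ
  | J μ => exact hJ μ

end U


/-! ### Twisting and reversing the Serre relations -/

section Serre

variable {A : Type*} [Ring A] [Algebra QvPi A]

theorem pow_mul_comm_smul {α : QvPi} {x g : A} (h : x * g = α • (g * x)) (m : ℕ) :
    x ^ m * g = α ^ m • (g * x ^ m) := by
  induction m with
  | zero => simp
  | succ m ih =>
    rw [pow_succ, mul_assoc, h, mul_smul_comm, ← mul_assoc, ih, smul_mul_assoc, smul_smul,
      mul_assoc, ← pow_succ, ← pow_succ']

theorem mul_pow_comm_smul {α : QvPi} {x g : A} (h : x * g = α • (g * x)) (k : ℕ) :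
    x * g ^ k = α ^ k • (g ^ k * x) := by
  induction k with
  | zero => simp
  | succ k ih =>
    rw [pow_succ, ← mul_assoc, ih, smul_mul_assoc, mul_assoc, h, mul_smul_comm, smul_smul,
      ← mul_assoc, ← pow_succ, ← pow_succ]

theorem mul_pow_smul {α : QvPi} {x g : A} (h : x * g = α • (g * x)) (n : ℕ) :
    (g * x) ^ n = α ^ (n.choose 2) • (g ^ n * x ^ n) := by
  induction n with
  | zero => simp
  | succ n ih =>
    rw [pow_succ, ih, smul_mul_assoc]
    have : g ^ n * x ^ n * (g * x) = α ^ n • (g ^ (n + 1) * x ^ (n + 1)) := by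
      rw [mul_assoc, ← mul_assoc (x ^ n), pow_mul_comm_smul h, smul_mul_assoc, mul_smul_comm,
        mul_assoc, ← mul_assoc, ← mul_assoc, ← pow_succ, mul_assoc, ← pow_succ]
    rw [this, smul_smul, ← pow_add]
    congr 2
    rw [Nat.choose_succ_succ' n 1]
    simp [add_comm]

theorem choose_two_add (m k : ℕ) :
    (m + k).choose 2 = m.choose 2 + k.choose 2 + m * k := by
  induction k with
  | zero => simp
  | succ k ih =>
    rw [← add_assoc, Nat.choose_succ_succ' (m + k) 1, Nat.choose_succ_succ' k 1, ih]
    simp only [Nat.choose_one_right, Nat.reduceAdd]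
    ring

theorem serre_twist (i l : I) {α β c c' : QvPi} {x y g h : A} (hxg : x * g = α • (g * x))
    (hxh : x * h = β • (h * x)) (hyg : y * g = β • (g * y)) (hgh : g * h = h * g)
    (h0 : serre C i l x y = 0) : serre C i l (c • (g * x)) (c' • (h * y)) = 0 := by
  set b := (1 - C.a i l).toNat with hb
  have key : serre C i l (c • (g * x)) (c' • (h * y)) =
      (c ^ b * c' * α ^ b.choose 2 * β ^ b) • ((g ^ b * h) * serre C i l x y) := by
    simp only [serre, Finset.mul_sum, Finset.smul_sum, ← hb]
    refine Finset.sum_congr rfl fun k hk => ?_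
    obtain ⟨m, hm⟩ : ∃ m, b = m + k := ⟨b - k, by have := Finset.mem_range.mp hk; omega⟩
    have hmk : b - k = m := by omega
    have hgh' : g ^ k * h = h * g ^ k := (Commute.pow_left (show Commute g h from hgh) k).eq
    have main : (g * x) ^ m * (h * y) * (g * x) ^ k =
        (α ^ b.choose 2 * β ^ b) • (g ^ b * h * (x ^ m * y * x ^ k)) := by
      rw [mul_pow_smul hxg, mul_pow_smul hxg, smul_mul_assoc, smul_mul_smul_comm]
      have e1 : g ^ m * x ^ m * (h * y) * (g ^ k * x ^ k) =
          (β ^ m * β ^ k * α ^ (m * k)) • (g ^ b * h * (x ^ m * y * x ^ k)) := by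
        have s1 : y * (g ^ k * x ^ k) = β ^ k • (g ^ k * (y * x ^ k)) := by
          rw [← mul_assoc, mul_pow_comm_smul hyg, smul_mul_assoc, mul_assoc]
        have s2 : ∀ z, x ^ m * (h * z) = β ^ m • (h * (x ^ m * z)) := fun z => by
          rw [← mul_assoc, pow_mul_comm_smul hxh, smul_mul_assoc, mul_assoc]
        have s3 : ∀ z, x ^ m * (g ^ k * z) = α ^ (m * k) • (g ^ k * (x ^ m * z)) := fun z => by
          rw [← mul_assoc, mul_pow_comm_smul (pow_mul_comm_smul hxg m), smul_mul_assoc, mul_assoc,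
            ← pow_mul]
        have s4 : ∀ z, h * (g ^ k * z) = g ^ k * (h * z) := fun z => by
          rw [← mul_assoc, ← hgh', mul_assoc]
        simp only [mul_assoc, smul_mul_assoc, s1, mul_smul_comm, s2, s3, smul_smul, s4]
        rw [hm, pow_add, mul_assoc]
      rw [e1, smul_smul]
      congr 1
      rw [hm, choose_two_add]
      ring
    rw [hmk, smul_pow, smul_pow, smul_mul_smul_comm, smul_mul_smul_comm, main, mul_smul_comm]
    simp only [smul_smul]
    congr 1
    rw [hm]
    ring
  rw [key, h0, mul_zero, smul_zero]

theorem serre_op (i l : I) {x y : A} (hil : i ≠ l) (h0 : serre C i l x y = 0) :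
    serre C i l (MulOpposite.op x) (MulOpposite.op y) = 0 := by
  set b := (1 - C.a i l).toNat with hb
  have hbodd : C.p i = 1 → Odd b := by
    intro hp
    have h1 := C.anisotropic i l hp
    have h2 := C.a_nonpos i l hil
    have h3 : ((b : ℕ) : ℤ) = 1 - C.a i l := by rw [hb]; exact Int.toNat_of_nonneg (by omega)
    obtain ⟨r, hr⟩ := h1
    exact ⟨(-r).toNat, by omega⟩
  have key : serre C i l (MulOpposite.op x) (MulOpposite.op y) =
      ((-1) ^ b * pv (b.choose 2 * C.p i + b * C.p i * C.p l) 0) •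
        MulOpposite.op (serre C i l x y) := by
    simp only [serre, ← hb, Finset.op_sum, MulOpposite.op_smul, Finset.smul_sum]
    rw [← Finset.sum_range_reflect]
    refine Finset.sum_congr rfl fun k hk => ?_
    obtain ⟨m, hm⟩ : ∃ m, b = m + k := ⟨b - k, by have := Finset.mem_range.mp hk; omega⟩
    have e1 : b + 1 - 1 - k = m := by omega
    have e2 : b - m = k := by omega
    have e3 : b - k = m := by omega
    rw [e1, e2, e3, ← MulOpposite.op_pow, ← MulOpposite.op_pow, ← MulOpposite.op_mul,
      ← MulOpposite.op_mul, ← mul_assoc, smul_smul]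
    congr 1
    have hq : qbinom (C.d i) b m = qbinom (C.d i) b k := by
      rw [qbinom, qbinom, e2, e3, mul_comm (qfact _ m)]
    have hs : ((-1 : QvPi)) ^ b * (-1) ^ k = (-1) ^ m := by
      rw [hm, pow_add, mul_assoc, ← pow_add, ← two_mul, pow_mul]
      simp
    have hp : pv (b.choose 2 * C.p i + b * C.p i * C.p l) 0 *
        pv (k.choose 2 * C.p i + k * C.p i * C.p l) 0 =
        pv (m.choose 2 * C.p i + m * C.p i * C.p l) 0 := by
      rw [pv_mul]
      refine pv_congr ?_ rfl
      rw [hm, choose_two_add]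
      have h2 := C.p_lt_two i
      rcases Nat.lt_or_ge (C.p i) 1 with h | h
      · have h0 : C.p i = 0 := by omega
        simp [h0]
      · have h1 : C.p i = 1 := by omega
        have hmk : Even (m * k) := by
          have := hbodd h1
          rw [hm, Nat.odd_add] at this
          rcases Nat.even_or_odd k with hk | hk
          · exact hk.mul_left _
          · have : ¬ Odd m := fun h => by
              have := this.mp h
              exact (Nat.not_even_iff_odd.mpr hk) this
            exact (Nat.not_odd_iff_even.mp this).mul_right _
        obtain ⟨r, hr⟩ := hmk
        refine ⟨k.choose 2 + r + k * C.p l, ?_⟩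
        have hr' : (m : ℤ) * k = r + r := by exact_mod_cast hr
        rw [h1]
        push_cast
        linear_combination hr'
    rw [hq, ← hs, ← hp]
    ring
  rw [key, h0, MulOpposite.op_zero, smul_zero]

end Serre

/-! ### The (anti)automorphisms of `U` -/

namespace U

variable (D : RootDatum C Y X)

theorem pv_one {a b : ℤ} (ha : Even a) (hb : b = 0) : pv a b = 1 := by
  rw [pv_congr (c := 0) (d := 0) (by simpa using ha) hb, pv_zero]

theorem E_K (μ : Y) (i : I) :
    E D i * K D μ = pv 0 (-D.pairing μ (D.root i)) • (K D μ * E D i) := by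
  rw [(relations D).K_E, smul_smul, pv_mul, zero_add, neg_add_cancel, pv_zero, one_smul]

theorem F_K (μ : Y) (i : I) :
    F D i * K D μ = pv 0 (D.pairing μ (D.root i)) • (K D μ * F D i) := by
  rw [(relations D).K_F, smul_smul, pv_mul, zero_add, add_neg_cancel, pv_zero, one_smul]

theorem E_J (μ : Y) (i : I) :
    E D i * J D μ = pv (D.pairing μ (D.root i)) 0 • (J D μ * E D i) := by
  rw [(relations D).J_E, smul_smul, pv_mul, pv_one (by simp) (by simp), one_smul]

theorem F_J (μ : Y) (i : I) :
    F D i * J D μ = pv (D.pairing μ (D.root i)) 0 • (J D μ * F D i) := by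
  rw [(relations D).J_F, smul_smul, pv_mul, pv_one (by simp) (by simp), one_smul]

theorem E_Jt (l i : I) : E D i * J D (D.tcor l) = J D (D.tcor l) * E D i := by
  rw [E_J, D.pairing_tcor, pv_one (C.even_form l i) rfl, one_smul]

theorem F_Jt (l i : I) : F D i * J D (D.tcor l) = J D (D.tcor l) * F D i := by
  rw [F_J, D.pairing_tcor, pv_one (C.even_form l i) rfl, one_smul]

theorem E_Kt (l i : I) :
    E D i * K D (D.tcor l) = pv 0 (-C.form l i) • (K D (D.tcor l) * E D i) := by
  rw [E_K, D.pairing_tcor]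

theorem F_Kt (l i : I) :
    F D i * K D (D.tcor l) = pv 0 (C.form l i) • (K D (D.tcor l) * F D i) := by
  rw [F_K, D.pairing_tcor]

theorem E_Ktn (l i : I) :
    E D i * K D (-D.tcor l) = pv 0 (C.form l i) • (K D (-D.tcor l) * E D i) := by
  rw [E_K, map_neg, LinearMap.neg_apply, D.pairing_tcor, neg_neg]

theorem F_Ktn (l i : I) :
    F D i * K D (-D.tcor l) = pv 0 (-C.form l i) • (K D (-D.tcor l) * F D i) := by
  rw [F_K, map_neg, LinearMap.neg_apply, D.pairing_tcor]

theorem K_J (μ ν : Y) : K D μ * J D ν = J D ν * K D μ := ((relations D).J_K ν μ).symm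

theorem K_comm (μ ν : Y) : K D μ * K D ν = K D ν * K D μ := by
  rw [(relations D).K_mul, (relations D).K_mul, add_comm]

theorem J_comm (μ ν : Y) : J D μ * J D ν = J D ν * J D μ := by
  rw [(relations D).J_mul, (relations D).J_mul, add_comm]

theorem J_sq' (μ : Y) (x : U D) : J D μ * (J D μ * x) = x := by
  rw [← mul_assoc, (relations D).J_sq, one_mul]

theorem J_neg (μ : Y) : J D (-μ) = J D μ := by
  have h : J D μ * J D (-μ) = 1 := by rw [(relations D).J_mul, add_neg_cancel, (relations D).J_zero]
  calc J D (-μ) = J D μ * (J D μ * J D (-μ)) := (J_sq' D _ _).symm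
    _ = J D μ := by rw [h, mul_one]

theorem _root_.QCov.CartanDatum.even_d_sub (C : CartanDatum I) (i : I) :
    Even ((C.d i : ℤ) - C.p i * C.p i) := by
  have h1 := C.p_lt_two i
  have h2 : C.d i % 2 = C.p i % 2 := C.bar_consistent i
  rcases Nat.lt_or_ge (C.p i) 1 with h | h
  · have h0 : C.p i = 0 := by omega
    rw [h0] at h2 ⊢
    rw [Int.even_iff]
    omega
  · have h0 : C.p i = 1 := by omega
    rw [h0] at h2 ⊢
    rw [Int.even_iff]
    omega

theorem pv_p_mul_self (i : I) (b : ℤ) : pv (C.p i * C.p i) b = pv (C.d i) b :=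
  (pv_congr (C.even_d_sub i) rfl).symm

theorem pv_add_self (a : ℤ) : pv (a + a) 0 = 1 := by
  rw [pv_congr (c := 0) (d := 0) (by simp) rfl, pv_zero]

theorem E_F' (i : I) : E D i * F D i - pv (C.d i) 0 • (F D i * E D i) =
    Ring.inverse (pv (C.d i) (C.d i) - pv 0 (-C.d i)) •
      (J D (D.tcor i) * K D (D.tcor i) - K D (-D.tcor i)) := by
  rw [← (relations D).E_F, pv_p_mul_self]

theorem E_F_ne' {i l : I} (h : i ≠ l) :
    E D i * F D l = pv (C.p i * C.p l) 0 • (F D l * E D i) :=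
  sub_eq_zero.mp ((relations D).E_F_ne i l h)

theorem omega_rel : Relations D (F D) (fun i => pv (C.d i) 0 • (J D (D.tcor i) * E D i))
    (fun μ => K D (-μ)) (J D) where
  J_mul := (relations D).J_mul
  K_mul μ ν := by rw [(relations D).K_mul, neg_add]
  K_zero := by rw [neg_zero, (relations D).K_zero]
  J_zero := (relations D).J_zero
  J_sq := (relations D).J_sq
  J_K μ ν := (relations D).J_K _ _
  J_E μ i := by
    rw [F_J, smul_smul, pv_mul, pv_one (by simp) (by simp), one_smul]
  J_F μ i := by
    simp only [mul_smul_comm, smul_mul_assoc, smul_smul, pv_mul, mul_assoc, E_J]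
    rw [← mul_assoc, ← mul_assoc, J_comm]
    congr 1
    exact pv_congr ⟨0, by ring⟩ (by ring)
  K_E μ i := by
    rw [F_K, smul_smul, pv_mul, map_neg]
    simp [pv_zero]
  K_F μ i := by
    simp only [mul_smul_comm, smul_mul_assoc, smul_smul, pv_mul, mul_assoc, E_K]
    rw [← mul_assoc, ← mul_assoc, K_J, map_neg]
    congr 1
    exact pv_congr ⟨0, by ring⟩ (by simp)
  E_F i := by
    have h := congrArg (fun z => J D (D.tcor i) * z) (E_F' D i)
    simp only [mul_sub, mul_smul_comm, J_sq'] at h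
    rw [neg_neg, pv_p_mul_self, ← neg_sub (K D (D.tcor i)), smul_neg, smul_sub, ← smul_sub, ← h,
      neg_sub, mul_smul_comm, smul_mul_assoc, smul_smul, pv_mul, add_zero, pv_add_self, one_smul,
      ← mul_assoc, F_Jt, mul_assoc, mul_assoc]
  E_F_ne i l hil := by
    rw [mul_smul_comm, smul_mul_assoc, mul_assoc, E_F_ne' D hil.symm, ← mul_assoc, F_Jt,
      mul_smul_comm, smul_smul, smul_smul, pv_mul, pv_mul, mul_assoc, sub_eq_zero]
    congr 1
    exact pv_congr ⟨-(C.p i * C.p l), by ring⟩ (by ring)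
  serre_E := (relations D).serre_F
  serre_F i l hil := by
    refine serre_twist (α := 1) (β := 1) i l ?_ ?_ ?_ (J_comm D _ _) ((relations D).serre_E i l hil)
    all_goals rw [one_smul, E_Jt]

theorem omegaInv_rel : Relations D (fun i => pv (C.d i) 0 • (J D (D.tcor i) * F D i)) (E D)
    (fun μ => K D (-μ)) (J D) where
  J_mul := (relations D).J_mul
  K_mul μ ν := by rw [(relations D).K_mul, neg_add]
  K_zero := by rw [neg_zero, (relations D).K_zero]
  J_zero := (relations D).J_zero
  J_sq := (relations D).J_sq
  J_K μ ν := (relations D).J_K _ _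
  J_E μ i := by
    simp only [mul_smul_comm, smul_mul_assoc, smul_smul, pv_mul, mul_assoc, F_J]
    rw [← mul_assoc, ← mul_assoc, J_comm]
    congr 1
    exact pv_congr ⟨-D.pairing μ (D.root i), by ring⟩ (by ring)
  J_F μ i := by
    rw [E_J, smul_smul, pv_mul, pv_one (by simp) (by simp), one_smul]
  K_E μ i := by
    simp only [mul_smul_comm, smul_mul_assoc, smul_smul, pv_mul, mul_assoc, F_K]
    rw [← mul_assoc, ← mul_assoc, K_J, map_neg]
    congr 1
    exact pv_congr ⟨0, by ring⟩ (by simp)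
  K_F μ i := by
    rw [E_K, smul_smul, pv_mul, map_neg]
    simp [pv_zero]
  E_F i := by
    have h := congrArg (fun z => J D (D.tcor i) * z) (E_F' D i)
    simp only [mul_sub, mul_smul_comm, J_sq'] at h
    rw [neg_neg, pv_p_mul_self, ← neg_sub (K D (D.tcor i)), smul_neg, smul_sub, ← smul_sub, ← h,
      neg_sub, mul_smul_comm, smul_mul_assoc, smul_smul, pv_mul, add_zero, pv_add_self, one_smul,
      ← mul_assoc, E_Jt, mul_assoc, mul_assoc]
  E_F_ne i l hil := by
    rw [mul_smul_comm, smul_mul_assoc, mul_assoc, ← mul_assoc (E D l), E_Jt, mul_assoc,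
      E_F_ne' D hil.symm,
      mul_smul_comm, smul_smul, smul_smul, pv_mul, pv_mul, sub_eq_zero]
    congr 1
    exact pv_congr ⟨-(C.p i * C.p l), by ring⟩ (by ring)
  serre_E i l hil := by
    refine serre_twist (α := 1) (β := 1) i l ?_ ?_ ?_ (J_comm D _ _) ((relations D).serre_F i l hil)
    all_goals rw [one_smul, F_Jt]
  serre_F := (relations D).serre_E

open MulOpposite in
theorem rho_rel : Relations D (fun i => op (pv (C.d i) 0 • (J D (D.tcor i) * E D i)))
    (fun i => op (F D i)) (fun μ => op (K D (-μ))) (fun μ => op (J D μ)) where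
  J_mul μ ν := by rw [← op_mul, (relations D).J_mul, add_comm]
  K_mul μ ν := by rw [← op_mul, (relations D).K_mul, neg_add_rev]
  K_zero := by rw [neg_zero, (relations D).K_zero, op_one]
  J_zero := by rw [(relations D).J_zero, op_one]
  J_sq ν := by rw [← op_mul, (relations D).J_sq, op_one]
  J_K μ ν := by rw [← op_mul, ← op_mul, K_J]
  J_E μ i := by
    apply unop_injective
    simp only [unop_mul, unop_smul, unop_op]
    simp only [mul_smul_comm, smul_mul_assoc, smul_smul, pv_mul, mul_assoc, E_J]
    rw [← mul_assoc, ← mul_assoc, J_comm]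
    congr 1
    exact pv_congr ⟨0, by ring⟩ (by ring)
  J_F μ i := by
    apply unop_injective
    simp only [unop_mul, unop_smul, unop_op]
    rw [F_J]
    congr 1
    exact pv_congr ⟨D.pairing μ (D.root i), by ring⟩ (by ring)
  K_E μ i := by
    apply unop_injective
    simp only [unop_mul, unop_smul, unop_op]
    simp only [mul_smul_comm, smul_mul_assoc, smul_smul, pv_mul, mul_assoc, E_K]
    rw [← mul_assoc, ← mul_assoc, K_J, map_neg]
    congr 1
    exact pv_congr ⟨0, by ring⟩ (by simp)
  K_F μ i := by
    apply unop_injective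
    simp only [unop_mul, unop_smul, unop_op]
    rw [F_K, map_neg, LinearMap.neg_apply]
  E_F i := by
    apply unop_injective
    simp only [unop_mul, unop_smul, unop_op, unop_sub]
    have h := congrArg (fun z => J D (D.tcor i) * z) (E_F' D i)
    simp only [mul_sub, mul_smul_comm, J_sq'] at h
    rw [neg_neg, K_J, pv_p_mul_self, ← neg_sub (K D (D.tcor i)), smul_neg, smul_sub, ← smul_sub,
      ← h, neg_sub, mul_smul_comm, smul_mul_assoc, smul_smul, pv_mul, add_zero, pv_add_self,
      one_smul, ← mul_assoc, F_Jt, mul_assoc, mul_assoc]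
  E_F_ne i l hil := by
    apply unop_injective
    simp only [unop_mul, unop_smul, unop_op, unop_sub, unop_zero]
    rw [mul_smul_comm, smul_mul_assoc, mul_assoc, ← mul_assoc (F D l), F_Jt, mul_assoc,
      E_F_ne' D hil,
      mul_smul_comm, smul_smul, smul_smul, pv_mul, pv_mul, sub_eq_zero]
    congr 1
    exact pv_congr ⟨-(C.p i * C.p l), by ring⟩ (by ring)
  serre_E i l hil := by
    refine serre_op i l hil ?_
    refine serre_twist (α := 1) (β := 1) i l ?_ ?_ ?_ (J_comm D _ _) ((relations D).serre_E i l hil)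
    all_goals rw [one_smul, E_Jt]
  serre_F i l hil := serre_op i l hil ((relations D).serre_F i l hil)

open MulOpposite in
theorem tau1_rel : Relations D (fun i => op (pv 0 (-C.d i) • (K D (-D.tcor i) * F D i)))
    (fun i => op (pv 0 (-C.d i) • (K D (D.tcor i) * E D i)))
    (fun μ => op (K D μ)) (fun μ => op (J D μ)) where
  J_mul μ ν := by rw [← op_mul, (relations D).J_mul, add_comm]
  K_mul μ ν := by rw [← op_mul, (relations D).K_mul, add_comm]
  K_zero := by rw [(relations D).K_zero, op_one]
  J_zero := by rw [(relations D).J_zero, op_one]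
  J_sq ν := by rw [← op_mul, (relations D).J_sq, op_one]
  J_K μ ν := by rw [← op_mul, ← op_mul, K_J]
  J_E μ i := by
    apply unop_injective
    simp only [unop_mul, unop_smul, unop_op]
    simp only [mul_smul_comm, smul_mul_assoc, smul_smul, pv_mul, mul_assoc, F_J]
    rw [← mul_assoc, ← mul_assoc, K_J]
    congr 1
    exact pv_congr ⟨0, by ring⟩ (by ring)
  J_F μ i := by
    apply unop_injective
    simp only [unop_mul, unop_smul, unop_op]
    simp only [mul_smul_comm, smul_mul_assoc, smul_smul, pv_mul, mul_assoc, E_J]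
    rw [← mul_assoc, ← mul_assoc, K_J]
    congr 1
    exact pv_congr ⟨D.pairing μ (D.root i), by ring⟩ (by ring)
  K_E μ i := by
    apply unop_injective
    simp only [unop_mul, unop_smul, unop_op]
    simp only [mul_smul_comm, smul_mul_assoc, smul_smul, pv_mul, mul_assoc, F_K]
    rw [← mul_assoc, ← mul_assoc, K_comm]
    congr 1
    exact pv_congr ⟨0, by ring⟩ (by ring)
  K_F μ i := by
    apply unop_injective
    simp only [unop_mul, unop_smul, unop_op]
    simp only [mul_smul_comm, smul_mul_assoc, smul_smul, pv_mul, mul_assoc, E_K]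
    rw [← mul_assoc, ← mul_assoc, K_comm]
    congr 1
    exact pv_congr ⟨0, by ring⟩ (by ring)
  E_F i := by
    apply unop_injective
    simp only [unop_mul, unop_smul, unop_op, unop_sub]
    rw [K_J, pv_p_mul_self, ← E_F' D i]
    simp only [mul_smul_comm, smul_mul_assoc, smul_smul, pv_mul, mul_assoc]
    rw [← mul_assoc (E D i), E_Ktn, ← mul_assoc (F D i) (K D _), F_Kt]
    simp only [mul_smul_comm, smul_mul_assoc, smul_smul, pv_mul, mul_assoc]
    rw [← mul_assoc (K D _), ← mul_assoc (K D _), (relations D).K_mul, (relations D).K_mul,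
      add_neg_cancel, neg_add_cancel, (relations D).K_zero, one_mul, one_mul,
      pv_one (by simp) (by rw [C.form_self]; ring), one_smul]
    congr 2
    exact pv_congr ⟨0, by ring⟩ (by rw [C.form_self]; ring)
  E_F_ne i l hil := by
    apply unop_injective
    simp only [unop_mul, unop_smul, unop_op, unop_sub, unop_zero]
    simp only [mul_smul_comm, smul_mul_assoc, smul_smul, pv_mul, mul_assoc]
    rw [← mul_assoc (E D l), E_Ktn, ← mul_assoc (F D i) (K D _), F_Kt]
    simp only [mul_smul_comm, smul_mul_assoc, smul_smul, pv_mul, mul_assoc]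
    rw [← mul_assoc (K D _), ← mul_assoc (K D _), K_comm D (D.tcor l), E_F_ne' D hil.symm,
      mul_smul_comm, smul_smul, pv_mul, sub_eq_zero, C.form_symm i l]
    congr 1
    exact pv_congr ⟨0, by ring⟩ (by ring)
  serre_E i l hil := by
    refine serre_op i l hil ?_
    refine serre_twist (α := pv 0 (-C.form i i)) (β := pv 0 (-C.form l i)) i l (F_Ktn D _ _)
      (F_Ktn D _ _) ?_ (K_comm D _ _) ((relations D).serre_F i l hil)
    rw [F_Ktn, C.form_symm]
  serre_F i l hil := by
    refine serre_op i l hil ?_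
    refine serre_twist (α := pv 0 (-C.form i i)) (β := pv 0 (-C.form l i)) i l (E_Kt D _ _)
      (E_Kt D _ _) ?_ (K_comm D _ _) ((relations D).serre_E i l hil)
    rw [E_Kt, C.form_symm]

theorem F_JKt (l i : I) : F D i * (J D (D.tcor l) * K D (D.tcor l)) =
    pv 0 (C.form l i) • (J D (D.tcor l) * K D (D.tcor l) * F D i) := by
  rw [← mul_assoc, F_Jt, mul_assoc, F_Kt, mul_smul_comm, mul_assoc]

theorem E_JKtn (l i : I) : E D i * (J D (D.tcor l) * K D (-D.tcor l)) =
    pv 0 (C.form l i) • (J D (D.tcor l) * K D (-D.tcor l) * E D i) := by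
  rw [← mul_assoc, E_Jt, mul_assoc, E_Ktn, mul_smul_comm, mul_assoc]

theorem JK_comm (μ ν μ' ν' : Y) : (J D μ * K D ν) * (J D μ' * K D ν') =
    (J D μ' * K D ν') * (J D μ * K D ν) := by
  have hJJ : Commute (J D μ) (J D μ') := J_comm D _ _
  have hKK : Commute (K D ν) (K D ν') := K_comm D _ _
  have hJK : Commute (J D μ) (K D ν') := (K_J D _ _).symm
  have hKJ : Commute (K D ν) (J D μ') := K_J D _ _
  exact ((hJJ.mul_right hJK).mul_left (hKJ.mul_right hKK)).eq

open MulOpposite in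
theorem tau1bar_rel : Relations D
    (fun i => op (pv (C.d i) (-C.d i) • (F D i * (J D (D.tcor i) * K D (D.tcor i)))))
    (fun i => op (pv (C.d i) (-C.d i) • (E D i * (J D (D.tcor i) * K D (-D.tcor i)))))
    (fun μ => op (K D μ)) (fun μ => op (J D μ)) where
  J_mul μ ν := by rw [← op_mul, (relations D).J_mul, add_comm]
  K_mul μ ν := by rw [← op_mul, (relations D).K_mul, add_comm]
  K_zero := by rw [(relations D).K_zero, op_one]
  J_zero := by rw [(relations D).J_zero, op_one]
  J_sq ν := by rw [← op_mul, (relations D).J_sq, op_one]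
  J_K μ ν := by rw [← op_mul, ← op_mul, K_J]
  J_E μ i := by
    apply unop_injective
    simp only [unop_mul, unop_smul, unop_op]
    have h := JK_comm D (D.tcor i) (D.tcor i) μ 0
    rw [(relations D).K_zero, mul_one] at h
    rw [smul_mul_assoc, mul_assoc, h, ← mul_assoc, F_J, smul_mul_assoc, mul_smul_comm, smul_smul,
      smul_smul, mul_assoc, pv_mul, pv_mul]
    congr 1
    exact pv_congr ⟨0, by ring⟩ (by ring)
  J_F μ i := by
    apply unop_injective
    simp only [unop_mul, unop_smul, unop_op]
    have h := JK_comm D (D.tcor i) (-D.tcor i) μ 0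
    rw [(relations D).K_zero, mul_one] at h
    rw [smul_mul_assoc, mul_assoc, h, ← mul_assoc, E_J, smul_mul_assoc, mul_smul_comm, smul_smul,
      smul_smul, mul_assoc, pv_mul, pv_mul]
    congr 1
    exact pv_congr ⟨D.pairing μ (D.root i), by ring⟩ (by ring)
  K_E μ i := by
    apply unop_injective
    simp only [unop_mul, unop_smul, unop_op]
    have h := JK_comm D (D.tcor i) (D.tcor i) 0 μ
    rw [(relations D).J_zero, one_mul] at h
    rw [smul_mul_assoc, mul_assoc, h, ← mul_assoc, F_K, smul_mul_assoc, mul_smul_comm, smul_smul,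
      smul_smul, mul_assoc, pv_mul, pv_mul]
    congr 1
    exact pv_congr ⟨0, by ring⟩ (by ring)
  K_F μ i := by
    apply unop_injective
    simp only [unop_mul, unop_smul, unop_op]
    have h := JK_comm D (D.tcor i) (-D.tcor i) 0 μ
    rw [(relations D).J_zero, one_mul] at h
    rw [smul_mul_assoc, mul_assoc, h, ← mul_assoc, E_K, smul_mul_assoc, mul_smul_comm, smul_smul,
      smul_smul, mul_assoc, pv_mul, pv_mul]
    congr 1
    exact pv_congr ⟨0, by ring⟩ (by ring)
  E_F i := by
    apply unop_injective
    simp only [unop_mul, unop_smul, unop_op, unop_sub]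
    rw [K_J, pv_p_mul_self, ← E_F' D i]
    have hinv : (J D (D.tcor i) * K D (-D.tcor i)) * (J D (D.tcor i) * K D (D.tcor i)) = 1 := by
      rw [mul_assoc, ← mul_assoc (K D _), K_J, mul_assoc, J_sq', (relations D).K_mul,
        neg_add_cancel, (relations D).K_zero]
    have hinv' : (J D (D.tcor i) * K D (D.tcor i)) * (J D (D.tcor i) * K D (-D.tcor i)) = 1 := by
      rw [JK_comm, hinv]
    have h1 : E D i * (J D (D.tcor i) * K D (-D.tcor i)) *
        (F D i * (J D (D.tcor i) * K D (D.tcor i))) = pv 0 (C.form i i) • (E D i * F D i) := by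
      rw [F_JKt, mul_smul_comm, mul_assoc, ← mul_assoc (J D (D.tcor i) * K D (-D.tcor i)), hinv,
        one_mul]
    have h2 : F D i * (J D (D.tcor i) * K D (D.tcor i)) *
        (E D i * (J D (D.tcor i) * K D (-D.tcor i))) = pv 0 (C.form i i) • (F D i * E D i) := by
      rw [E_JKtn, mul_smul_comm, mul_assoc, ← mul_assoc (J D (D.tcor i) * K D (D.tcor i)), hinv',
        one_mul]
    rw [smul_mul_smul_comm, smul_mul_smul_comm, h1, h2]
    simp only [smul_smul, pv_mul]
    rw [pv_one (by simp) (by rw [C.form_self]; ring), one_smul]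
    congr 2
    exact pv_congr ⟨C.d i, by ring⟩ (by rw [C.form_self]; ring)
  E_F_ne i l hil := by
    apply unop_injective
    simp only [unop_mul, unop_smul, unop_op, unop_sub, unop_zero]
    have h1 : E D l * (J D (D.tcor l) * K D (-D.tcor l)) *
        (F D i * (J D (D.tcor i) * K D (D.tcor i))) = pv 0 (C.form l i) •
          (E D l * F D i * ((J D (D.tcor l) * K D (-D.tcor l)) *
            (J D (D.tcor i) * K D (D.tcor i)))) := by
      have : (J D (D.tcor l) * K D (-D.tcor l)) * F D i =
          pv 0 (C.form l i) • (F D i * (J D (D.tcor l) * K D (-D.tcor l))) := by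
        rw [← mul_assoc (F D i), F_Jt, mul_assoc (J D _) (F D i), F_Ktn, mul_smul_comm, smul_smul,
          pv_mul, pv_one (by simp) (by simp), one_smul, mul_assoc]
      rw [mul_assoc, ← mul_assoc (J D (D.tcor l) * K D (-D.tcor l)), this]
      simp only [smul_mul_assoc, mul_smul_comm, mul_assoc]
    have h2 : F D i * (J D (D.tcor i) * K D (D.tcor i)) *
        (E D l * (J D (D.tcor l) * K D (-D.tcor l))) = pv 0 (C.form i l) •
          (F D i * E D l * ((J D (D.tcor i) * K D (D.tcor i)) *
            (J D (D.tcor l) * K D (-D.tcor l)))) := by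
      have : (J D (D.tcor i) * K D (D.tcor i)) * E D l =
          pv 0 (C.form i l) • (E D l * (J D (D.tcor i) * K D (D.tcor i))) := by
        rw [← mul_assoc (E D l), E_Jt, mul_assoc (J D _) (E D l), E_Kt, mul_smul_comm, smul_smul,
          pv_mul, pv_one (by simp) (by simp), one_smul, mul_assoc]
      rw [mul_assoc, ← mul_assoc (J D (D.tcor i) * K D (D.tcor i)), this]
      simp only [smul_mul_assoc, mul_smul_comm, mul_assoc]
    rw [smul_mul_smul_comm, smul_mul_smul_comm, h1, h2, E_F_ne' D hil.symm,
      JK_comm D (D.tcor i) (D.tcor i)]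
    simp only [smul_smul, smul_mul_assoc, pv_mul]
    rw [sub_eq_zero, C.form_symm i l]
    congr 1
    exact pv_congr ⟨0, by ring⟩ (by ring)
  serre_E i l hil := by
    simp only [F_JKt, smul_smul]
    refine serre_op i l hil ?_
    refine serre_twist (α := pv 0 (C.form i i)) (β := pv 0 (C.form l i)) i l (F_JKt D _ _)
      (F_JKt D _ _) ?_ (JK_comm D _ _ _ _) ((relations D).serre_F i l hil)
    rw [F_JKt, C.form_symm]
  serre_F i l hil := by
    simp only [E_JKtn, smul_smul]
    refine serre_op i l hil ?_
    refine serre_twist (α := pv 0 (C.form i i)) (β := pv 0 (C.form l i)) i l (E_JKtn D _ _)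
      (E_JKtn D _ _) ?_ (JK_comm D _ _ _ _) ((relations D).serre_E i l hil)
    rw [E_JKtn, C.form_symm]

/-- The automorphism `ω` of `U`: `E_i ↦ F_i`, `F_i ↦ π_i J̃_i E_i`, `K_ν ↦ K_{-ν}`, `J_ν ↦ J_ν`. -/
def omegaHom : U D →ₐ[QvPi] U D := lift (omega_rel D)

/-- The inverse of `ω`: `E_i ↦ π_i J̃_i F_i`, `F_i ↦ E_i`, `K_ν ↦ K_{-ν}`, `J_ν ↦ J_ν`. -/
def omegaInvHom : U D →ₐ[QvPi] U D := lift (omegaInv_rel D)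

/-- The automorphism `ω` of `U`, with its inverse. -/
def omega : U D ≃ₐ[QvPi] U D :=
  AlgEquiv.ofAlgHom (omegaHom D) (omegaInvHom D)
    (hom_ext
      (fun i => by
        simp [omegaHom, omegaInvHom, smul_smul, pv_mul, pv_add_self, J_sq'])
      (fun i => by simp [omegaHom, omegaInvHom])
      (fun μ => by simp [omegaHom, omegaInvHom])
      (fun μ => by simp [omegaHom, omegaInvHom]))
    (hom_ext
      (fun i => by simp [omegaHom, omegaInvHom])
      (fun i => by
        simp [omegaHom, omegaInvHom, smul_smul, pv_mul, pv_add_self, J_sq'])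
      (fun μ => by simp [omegaHom, omegaInvHom])
      (fun μ => by simp [omegaHom, omegaInvHom]))

/-- The anti-automorphism `ρ` of `U`: `E_i ↦ π_i J̃_i E_i`, `F_i ↦ F_i`, `K_ν ↦ K_{-ν}`,
`J_ν ↦ J_ν`, as a homomorphism to the opposite algebra. -/
def rhoHom : U D →ₐ[QvPi] (U D)ᵐᵒᵖ := lift (rho_rel D)

/-- The anti-automorphism `τ₁` of `U`: `E_i ↦ v_i⁻¹ K̃_{-i} F_i`, `F_i ↦ v_i⁻¹ K̃_i E_i`,
`K_μ ↦ K_μ`, `J_μ ↦ J_μ`, as a homomorphism to the opposite algebra. -/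
def tau1Hom : U D →ₐ[QvPi] (U D)ᵐᵒᵖ := lift (tau1_rel D)

/-- The anti-automorphism `τ̄₁` of `U`: `E_i ↦ π_i v_i⁻¹ F_i J̃_i K̃_i`,
`F_i ↦ π_i v_i⁻¹ E_i J̃_i K̃_{-i}`, `K_μ ↦ K_μ`, `J_μ ↦ J_μ`, as a homomorphism to the opposite
algebra. -/
def tau1barHom : U D →ₐ[QvPi] (U D)ᵐᵒᵖ := lift (tau1bar_rel D)

/-- The underlying linear map of `ρ`. -/
def rho : U D →ₗ[QvPi] U D :=
  (MulOpposite.opLinearEquiv QvPi).symm.toLinearMap ∘ₗ (rhoHom D).toLinearMap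

/-- The underlying linear map of `τ₁`. -/
def tau1 : U D →ₗ[QvPi] U D :=
  (MulOpposite.opLinearEquiv QvPi).symm.toLinearMap ∘ₗ (tau1Hom D).toLinearMap

/-- The underlying linear map of `τ̄₁`. -/
def tau1bar : U D →ₗ[QvPi] U D :=
  (MulOpposite.opLinearEquiv QvPi).symm.toLinearMap ∘ₗ (tau1barHom D).toLinearMap

theorem rho_mul (x y : U D) : rho D (x * y) = rho D y * rho D x := by simp [rho]
theorem rho_E (i : I) : rho D (E D i) = pv (C.d i) 0 • (J D (D.tcor i) * E D i) := by
  simp [rho, rhoHom]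
theorem rho_F (i : I) : rho D (F D i) = F D i := by simp [rho, rhoHom]
theorem rho_K (μ : Y) : rho D (K D μ) = K D (-μ) := by simp [rho, rhoHom]
theorem rho_J (μ : Y) : rho D (J D μ) = J D μ := by simp [rho, rhoHom]
theorem rho_algebraMap (r : QvPi) : rho D (algebraMap QvPi _ r) = algebraMap QvPi _ r := by
  simp [rho]

theorem tau1_mul (x y : U D) : tau1 D (x * y) = tau1 D y * tau1 D x := by simp [tau1]
theorem tau1_E (i : I) : tau1 D (E D i) =
    pv 0 (-C.d i) • (K D (-D.tcor i) * F D i) := by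
  simp [tau1, tau1Hom]
theorem tau1_F (i : I) : tau1 D (F D i) =
    pv 0 (-C.d i) • (K D (D.tcor i) * E D i) := by
  simp [tau1, tau1Hom]
theorem tau1_K (μ : Y) : tau1 D (K D μ) =
    K D μ := by
  simp [tau1, tau1Hom]
theorem tau1_J (μ : Y) : tau1 D (J D μ) =
    J D μ := by
  simp [tau1, tau1Hom]
theorem tau1bar_mul (x y : U D) : tau1bar D (x * y) = tau1bar D y * tau1bar D x := by simp [tau1bar]
theorem tau1bar_E (i : I) : tau1bar D (E D i) =
    pv (C.d i) (-C.d i) • (F D i * (J D (D.tcor i) * K D (D.tcor i))) := by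
  simp [tau1bar, tau1barHom]
theorem tau1bar_F (i : I) : tau1bar D (F D i) =
    pv (C.d i) (-C.d i) • (E D i * (J D (D.tcor i) * K D (-D.tcor i))) := by
  simp [tau1bar, tau1barHom]
theorem tau1bar_K (μ : Y) : tau1bar D (K D μ) =
    K D μ := by
  simp [tau1bar, tau1barHom]
theorem tau1bar_J (μ : Y) : tau1bar D (J D μ) =
    J D μ := by
  simp [tau1bar, tau1barHom]

end U

/-! ### The modified quantum covering group -/

section Dot

variable (D : RootDatum C Y X)

local notation "ιU" => fun u : U D => FreeAlgebra.ι QvPi (Sum.inl (β := X) u)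
local notation "ιX" => fun l : X => FreeAlgebra.ι QvPi (Sum.inr (α := U D) l)

/-- The relations of `Uhat`. -/
inductive HatRel : FreeAlgebra QvPi (U D ⊕ X) → FreeAlgebra QvPi (U D ⊕ X) → Prop
  | add (u w) : HatRel (ιU (u + w)) (ιU u + ιU w)
  | mul (u w) : HatRel (ιU (u * w)) (ιU u * ιU w)
  | scalar (r) : HatRel (ιU (algebraMap QvPi (U D) r)) (algebraMap QvPi _ r)
  | idem (l) : HatRel (ιX l * ιX l) (ιX l)
  | orth (l m) : l ≠ m → HatRel (ιX l * ιX m) 0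
  | E (i l) : HatRel (ιU (U.E D i) * ιX l) (ιX (l + D.root i) * ιU (U.E D i))
  | F (i l) : HatRel (ιU (U.F D i) * ιX l) (ιX (l - D.root i) * ιU (U.F D i))
  | K (μ l) : HatRel (ιU (U.K D μ) * ιX l) (pv 0 (D.pairing μ l) • ιX l)
  | K' (μ l) : HatRel (ιX l * ιU (U.K D μ)) (pv 0 (D.pairing μ l) • ιX l)
  | J (μ l) : HatRel (ιU (U.J D μ) * ιX l) (pv (D.pairing μ l) 0 • ιX l)
  | J' (μ l) : HatRel (ιX l * ιU (U.J D μ)) (pv (D.pairing μ l) 0 • ιX l)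

/-- The algebra obtained from `U` by adjoining orthogonal idempotents `1_λ`, `λ ∈ X`, such that
`x 1_λ = 1_{λ + |x|} x` for homogeneous `x` in `U` (it is enough to impose this on the
generators), and `K_ν 1_λ = v^⟨ν,λ⟩ 1_λ`, `J_ν 1_λ = π^⟨ν,λ⟩ 1_λ`. It is the direct sum of `U` and
of the modified form, which is the ideal spanned by the elements `x 1_λ`, and the multiplication
by elements of `U` is the `U`-bimodule structure of the modified form. -/
def Uhat : Type _ := RingQuot (HatRel D)

instance : Ring (Uhat D) := inferInstanceAs (Ring (RingQuot (HatRel D)))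
instance : Algebra QvPi (Uhat D) := inferInstanceAs (Algebra QvPi (RingQuot (HatRel D)))

namespace Uhat

def proj : FreeAlgebra QvPi (U D ⊕ X) →ₐ[QvPi] Uhat D := RingQuot.mkAlgHom QvPi (HatRel D)

theorem proj_rel {x y : FreeAlgebra QvPi (U D ⊕ X)} (h : HatRel D x y) : proj D x = proj D y :=
  RingQuot.mkAlgHom_rel QvPi h

/-- The homomorphism from `U` to `Uhat`. -/
def incl : U D →ₐ[QvPi] Uhat D where
  toFun u := proj D (ιU u)
  map_one' := by
    have := proj_rel D (HatRel.scalar 1)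
    simpa using this
  map_mul' u w := by simpa using proj_rel D (HatRel.mul u w)
  map_zero' := by
    have := proj_rel D (HatRel.scalar 0)
    simpa using this
  map_add' u w := by simpa using proj_rel D (HatRel.add u w)
  commutes' r := by simpa using proj_rel D (HatRel.scalar r)

/-- The idempotent `1_λ`. -/
def idem (l : X) : Uhat D := proj D (ιX l)

theorem idem_mul_self (l : X) : idem D l * idem D l = idem D l := by
  simpa [idem, incl] using proj_rel D (HatRel.idem l)

theorem idem_mul_ne {l m : X} (h : l ≠ m) : idem D l * idem D m = 0 := by
  simpa [idem, incl] using proj_rel D (HatRel.orth l m h)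

theorem E_idem (i : I) (l : X) :
    incl D (U.E D i) * idem D l = idem D (l + D.root i) * incl D (U.E D i) := by
  simpa [idem, incl] using proj_rel D (HatRel.E i l)

theorem F_idem (i : I) (l : X) :
    incl D (U.F D i) * idem D l = idem D (l - D.root i) * incl D (U.F D i) := by
  simpa [idem, incl] using proj_rel D (HatRel.F i l)

theorem K_idem (μ : Y) (l : X) :
    incl D (U.K D μ) * idem D l = pv 0 (D.pairing μ l) • idem D l := by
  simpa [idem, incl] using proj_rel D (HatRel.K μ l)

theorem idem_K (μ : Y) (l : X) :
    idem D l * incl D (U.K D μ) = pv 0 (D.pairing μ l) • idem D l := by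
  simpa [idem, incl] using proj_rel D (HatRel.K' μ l)

theorem J_idem (μ : Y) (l : X) :
    incl D (U.J D μ) * idem D l = pv (D.pairing μ l) 0 • idem D l := by
  simpa [idem, incl] using proj_rel D (HatRel.J μ l)

theorem idem_J (μ : Y) (l : X) :
    idem D l * incl D (U.J D μ) = pv (D.pairing μ l) 0 • idem D l := by
  simpa [idem, incl] using proj_rel D (HatRel.J' μ l)

variable {D}

/-- The homomorphism from `Uhat` given by a homomorphism `g` from `U` and elements `e λ` that
satisfy the relations. -/
def lift {A : Type*} [Ring A] [Algebra QvPi A] (g : U D →ₐ[QvPi] A) (e : X → A)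
    (h1 : ∀ l, e l * e l = e l) (h2 : ∀ l m, l ≠ m → e l * e m = 0)
    (h3 : ∀ i l, g (U.E D i) * e l = e (l + D.root i) * g (U.E D i))
    (h4 : ∀ i l, g (U.F D i) * e l = e (l - D.root i) * g (U.F D i))
    (h5 : ∀ μ l, g (U.K D μ) * e l = pv 0 (D.pairing μ l) • e l)
    (h6 : ∀ μ l, e l * g (U.K D μ) = pv 0 (D.pairing μ l) • e l)
    (h7 : ∀ μ l, g (U.J D μ) * e l = pv (D.pairing μ l) 0 • e l)
    (h8 : ∀ μ l, e l * g (U.J D μ) = pv (D.pairing μ l) 0 • e l) : Uhat D →ₐ[QvPi] A :=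
  RingQuot.liftAlgHom QvPi ⟨FreeAlgebra.lift QvPi (Sum.elim g e), by
    intro x y hxy
    cases hxy
    case add u w => simp
    case mul u w => simp
    case scalar r => simp
    case idem l => simpa using h1 l
    case orth l m h => simpa using h2 l m h
    case E i l => simpa using h3 i l
    case F i l => simpa using h4 i l
    case K μ l => simpa using h5 μ l
    case K' μ l => simpa using h6 μ l
    case J μ l => simpa using h7 μ l
    case J' μ l => simpa using h8 μ l⟩

section lift

variable {A : Type*} [Ring A] [Algebra QvPi A] (g : U D →ₐ[QvPi] A) (e : X → A)
  (h1 h2 h3 h4 h5 h6 h7 h8)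

@[simp] theorem lift_incl (u : U D) : lift g e h1 h2 h3 h4 h5 h6 h7 h8 (incl D u) = g u := by
  refine (RingQuot.liftAlgHom_mkAlgHom_apply (S := QvPi) _ _
    (FreeAlgebra.ι QvPi (Sum.inl u))).trans ?_
  rw [FreeAlgebra.lift_ι_apply]
  rfl

@[simp] theorem lift_idem (l : X) : lift g e h1 h2 h3 h4 h5 h6 h7 h8 (idem D l) = e l := by
  refine (RingQuot.liftAlgHom_mkAlgHom_apply (S := QvPi) _ _
    (FreeAlgebra.ι QvPi (Sum.inr l))).trans ?_
  rw [FreeAlgebra.lift_ι_apply]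
  rfl

end lift

variable (D)

theorem hom_ext {A : Type*} [Ring A] [Algebra QvPi A] {g g' : Uhat D →ₐ[QvPi] A}
    (h1 : ∀ u, g (incl D u) = g' (incl D u)) (h2 : ∀ l, g (idem D l) = g' (idem D l)) :
    g = g' := by
  refine RingQuot.ringQuot_ext' (S := QvPi) g g' ?_
  refine FreeAlgebra.hom_ext ?_
  funext x
  cases x with
  | inl u => exact h1 u
  | inr l => exact h2 l

/-- `ω` on `Uhat`: it is `ω` on `U`, and sends `1_λ` to `1_{-λ}`. -/
def omegaHom : Uhat D →ₐ[QvPi] Uhat D :=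
  lift ((incl D).comp (U.omegaHom D)) (fun l => idem D (-l))
    (fun l => idem_mul_self D _)
    (fun l m h => idem_mul_ne D (fun h' => h (neg_injective h')))
    (fun i l => by simp [U.omegaHom, F_idem, sub_eq_add_neg, add_comm])
    (fun i l => by
      simp only [AlgHom.comp_apply, U.omegaHom, U.lift_F, map_smul, map_mul]
      rw [smul_mul_assoc, mul_assoc, E_idem, ← mul_assoc, J_idem, mul_smul_comm, ← mul_assoc,
        idem_J, neg_sub, sub_eq_neg_add])
    (fun μ l => by simp [U.omegaHom, K_idem])
    (fun μ l => by simp [U.omegaHom, idem_K])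
    (fun μ l => by
      simp only [AlgHom.comp_apply, U.omegaHom, U.lift_J, J_idem, map_neg]
      rw [pv_congr ⟨-D.pairing μ l, by ring⟩ rfl])
    (fun μ l => by
      simp only [AlgHom.comp_apply, U.omegaHom, U.lift_J, idem_J, map_neg]
      rw [pv_congr ⟨-D.pairing μ l, by ring⟩ rfl])

/-- `ω⁻¹` on `Uhat`. -/
def omegaInvHom : Uhat D →ₐ[QvPi] Uhat D :=
  lift ((incl D).comp (U.omegaInvHom D)) (fun l => idem D (-l))
    (fun l => idem_mul_self D _)
    (fun l m h => idem_mul_ne D (fun h' => h (neg_injective h')))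
    (fun i l => by
      simp only [AlgHom.comp_apply, U.omegaInvHom, U.lift_E, map_smul, map_mul]
      rw [smul_mul_assoc, mul_assoc, F_idem, ← mul_assoc, J_idem, mul_smul_comm, ← mul_assoc,
        idem_J, neg_add, sub_eq_add_neg])
    (fun i l => by simp [U.omegaInvHom, E_idem, sub_eq_add_neg, add_comm])
    (fun μ l => by simp [U.omegaInvHom, K_idem])
    (fun μ l => by simp [U.omegaInvHom, idem_K])
    (fun μ l => by
      simp only [AlgHom.comp_apply, U.omegaInvHom, U.lift_J, J_idem, map_neg]
      rw [pv_congr ⟨-D.pairing μ l, by ring⟩ rfl])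
    (fun μ l => by
      simp only [AlgHom.comp_apply, U.omegaInvHom, U.lift_J, idem_J, map_neg]
      rw [pv_congr ⟨-D.pairing μ l, by ring⟩ rfl])

/-- `ω` on `Uhat`, with its inverse. -/
def omega : Uhat D ≃ₐ[QvPi] Uhat D :=
  AlgEquiv.ofAlgHom (omegaHom D) (omegaInvHom D)
    (hom_ext D
      (fun u => by
        simp only [omegaHom, omegaInvHom, AlgHom.comp_apply, lift_incl, AlgHom.id_apply]
        exact congrArg (incl D) ((U.omega D).apply_symm_apply u))
      (fun l => by simp [omegaHom, omegaInvHom]))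
    (hom_ext D
      (fun u => by
        simp only [omegaHom, omegaInvHom, AlgHom.comp_apply, lift_incl, AlgHom.id_apply]
        exact congrArg (incl D) ((U.omega D).symm_apply_apply u))
      (fun l => by simp [omegaHom, omegaInvHom]))

open MulOpposite in
/-- The anti-automorphism `ρ` on `Uhat`: it is `ρ` on `U`, and sends `1_λ` to `1_{-λ}`. -/
def rhoHom : Uhat D →ₐ[QvPi] (Uhat D)ᵐᵒᵖ :=
  lift ((AlgHom.op (incl D)).comp (U.rhoHom D)) (fun l => op (idem D (-l)))
    (fun l => by rw [← op_mul, idem_mul_self])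
    (fun l m h => by
      rw [← op_mul, idem_mul_ne D (fun h' => h (neg_injective h').symm), op_zero])
    (fun i l => by
      apply unop_injective
      simp only [AlgHom.comp_apply, U.rhoHom, U.lift_E, AlgHom.op_apply_apply, unop_op, unop_mul,
        map_smul, map_mul]
      rw [smul_mul_assoc, mul_assoc, E_idem, ← mul_assoc, J_idem, mul_smul_comm, ← mul_assoc,
        idem_J]
      simp)
    (fun i l => by
      apply unop_injective
      simp only [AlgHom.comp_apply, U.rhoHom, U.lift_F, AlgHom.op_apply_apply, unop_op, unop_mul]
      rw [F_idem]
      simp)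
    (fun μ l => by
      apply unop_injective
      simp [AlgHom.comp_apply, U.rhoHom, idem_K])
    (fun μ l => by
      apply unop_injective
      simp [AlgHom.comp_apply, U.rhoHom, K_idem])
    (fun μ l => by
      apply unop_injective
      simp only [AlgHom.comp_apply, U.rhoHom, U.lift_J, AlgHom.op_apply_apply, unop_op, unop_mul,
        idem_J, map_neg, unop_smul]
      rw [pv_congr ⟨-D.pairing μ l, by ring⟩ rfl])
    (fun μ l => by
      apply unop_injective
      simp only [AlgHom.comp_apply, U.rhoHom, U.lift_J, AlgHom.op_apply_apply, unop_op, unop_mul,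
        J_idem, map_neg, unop_smul]
      rw [pv_congr ⟨-D.pairing μ l, by ring⟩ rfl])

end Uhat

/-! #### The modified form as an ideal of `Uhat` -/

/-- The span of the elements `x 1_λ`, `x ∈ U`, `λ ∈ X`. -/
def dotSpan : Submodule QvPi (Uhat D) :=
  Submodule.span QvPi (Set.range fun a : U D × X => Uhat.incl D a.1 * Uhat.idem D a.2)

theorem incl_mul_idem_mem (u : U D) (l : X) : Uhat.incl D u * Uhat.idem D l ∈ dotSpan D :=
  Submodule.subset_span ⟨(u, l), rfl⟩

theorem incl_mul_mem (u : U D) {x : Uhat D} (hx : x ∈ dotSpan D) :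
    Uhat.incl D u * x ∈ dotSpan D := by
  induction hx using Submodule.span_induction with
  | mem x hx =>
    obtain ⟨⟨w, l⟩, rfl⟩ := hx
    simp only
    rw [← mul_assoc, ← map_mul]
    exact incl_mul_idem_mem D _ _
  | zero => simp
  | add x y _ _ hx hy => rw [mul_add]; exact add_mem hx hy
  | smul r x _ hx => rw [mul_smul_comm]; exact Submodule.smul_mem _ _ hx

theorem U.induction {P : U D → Prop} (hE : ∀ i, P (U.E D i)) (hF : ∀ i, P (U.F D i))
    (hK : ∀ μ, P (U.K D μ)) (hJ : ∀ μ, P (U.J D μ)) (hs : ∀ r, P (algebraMap QvPi _ r))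
    (ha : ∀ u w, P u → P w → P (u + w)) (hm : ∀ u w, P u → P w → P (u * w)) (u : U D) : P u := by
  obtain ⟨z, rfl⟩ := RingQuot.mkAlgHom_surjective QvPi (URel D) u
  change P (U.proj D z)
  induction z using FreeAlgebra.induction with
  | grade0 r => rw [AlgHom.commutes]; exact hs r
  | grade1 g =>
    cases g with
    | E i => exact hE i
    | F i => exact hF i
    | K μ => exact hK μ
    | J μ => exact hJ μ
  | mul a b ha hb => rw [map_mul]; exact hm _ _ ha hb
  | add a b ha' hb => rw [map_add]; exact ha _ _ ha' hb

theorem idem_mul_incl_mem (u : U D) : ∀ l, Uhat.idem D l * Uhat.incl D u ∈ dotSpan D := by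
  induction u using U.induction with
  | hE i =>
    intro l
    have := Uhat.E_idem D i (l - D.root i)
    rw [sub_add_cancel] at this
    rw [← this]
    exact incl_mul_idem_mem D _ _
  | hF i =>
    intro l
    have := Uhat.F_idem D i (l + D.root i)
    rw [add_sub_cancel_right] at this
    rw [← this]
    exact incl_mul_idem_mem D _ _
  | hK μ =>
    intro l
    rw [Uhat.idem_K, ← Uhat.K_idem]
    exact incl_mul_idem_mem D _ _
  | hJ μ =>
    intro l
    rw [Uhat.idem_J, ← Uhat.J_idem]
    exact incl_mul_idem_mem D _ _
  | hs r =>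
    intro l
    rw [AlgHom.commutes, ← Algebra.commutes, ← AlgHom.commutes (Uhat.incl D)]
    exact incl_mul_idem_mem D _ _
  | ha u w hu hw =>
    intro l
    rw [map_add, mul_add]
    exact add_mem (hu l) (hw l)
  | hm u w hu hw =>
    intro l
    rw [map_mul, ← mul_assoc]
    have h := hu l
    generalize Uhat.idem D l * Uhat.incl D u = t at h
    induction h using Submodule.span_induction with
    | mem x hx =>
      obtain ⟨⟨z, m⟩, rfl⟩ := hx
      simp only
      rw [mul_assoc]
      exact incl_mul_mem D _ (hw m)
    | zero => simp
    | add x y _ _ hx hy => rw [add_mul]; exact add_mem hx hy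
    | smul r x _ hx => rw [smul_mul_assoc]; exact Submodule.smul_mem _ _ hx

theorem mul_incl_mem (u : U D) {x : Uhat D} (hx : x ∈ dotSpan D) :
    x * Uhat.incl D u ∈ dotSpan D := by
  induction hx using Submodule.span_induction with
  | mem x hx =>
    obtain ⟨⟨w, l⟩, rfl⟩ := hx
    simp only
    rw [mul_assoc]
    exact incl_mul_mem D _ (idem_mul_incl_mem D u l)
  | zero => simp
  | add x y _ _ hx hy => rw [add_mul]; exact add_mem hx hy
  | smul r x _ hx => rw [smul_mul_assoc]; exact Submodule.smul_mem _ _ hx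

theorem mul_mem_dotSpan {x y : Uhat D} (hx : x ∈ dotSpan D) (hy : y ∈ dotSpan D) :
    x * y ∈ dotSpan D := by
  induction hy using Submodule.span_induction with
  | mem y hy =>
    obtain ⟨⟨w, l⟩, rfl⟩ := hy
    simp only
    rw [← mul_assoc]
    have h := mul_incl_mem D w hx
    have h1 : Uhat.idem D l = Uhat.incl D 1 * Uhat.idem D l := by rw [map_one, one_mul]
    generalize x * Uhat.incl D w = t at h
    induction h using Submodule.span_induction with
    | mem x hx =>
      obtain ⟨⟨z, m⟩, rfl⟩ := hx
      simp only
      rw [mul_assoc]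
      refine incl_mul_mem D _ ?_
      by_cases hml : m = l
      · rw [hml, Uhat.idem_mul_self, h1]
        exact incl_mul_idem_mem D _ _
      · rw [Uhat.idem_mul_ne D hml]
        exact zero_mem _
    | zero => simp
    | add x y _ _ hx hy => rw [add_mul]; exact add_mem hx hy
    | smul r x _ hx => rw [smul_mul_assoc]; exact Submodule.smul_mem _ _ hx
  | zero => simp
  | add x y _ _ hx hy => rw [mul_add]; exact add_mem hx hy
  | smul r x _ hx => rw [mul_smul_comm]; exact Submodule.smul_mem _ _ hx

/-- The modified quantum covering group, as a non-unital algebra. -/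
def dotU : NonUnitalSubalgebra QvPi (Uhat D) where
  carrier := dotSpan D
  add_mem' := (dotSpan D).add_mem
  zero_mem' := (dotSpan D).zero_mem
  smul_mem' r _ hx := (dotSpan D).smul_mem r hx
  mul_mem' := mul_mem_dotSpan D

theorem mem_dotU {x : Uhat D} : x ∈ dotU D ↔ x ∈ dotSpan D := Iff.rfl

namespace dotU

/-- The left action of `U` on the modified form. -/
def lact (u : U D) (x : dotU D) : dotU D := ⟨Uhat.incl D u * x, (mem_dotU D).2 (incl_mul_mem D u ((mem_dotU D).1 x.2))⟩

/-- The right action of `U` on the modified form. -/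
def ract (x : dotU D) (u : U D) : dotU D := ⟨x * Uhat.incl D u, (mem_dotU D).2 (mul_incl_mem D u ((mem_dotU D).1 x.2))⟩

/-- The idempotent `1_λ`. -/
def one (l : X) : dotU D := ⟨Uhat.idem D l, by
  rw [mem_dotU]
  simpa using incl_mul_idem_mem D 1 l⟩

/-- The elements `x 1_λ` span the modified form. -/
theorem span_eq_top : Submodule.span QvPi
    (Set.range fun a : U D × X => lact D a.1 (one D a.2)) = ⊤ := by
  have key : ∀ x (h : x ∈ dotSpan D), (⟨x, (mem_dotU D).2 h⟩ : dotU D) ∈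
      Submodule.span QvPi (Set.range fun a : U D × X => lact D a.1 (one D a.2)) := by
    intro x h
    induction h using Submodule.span_induction with
    | mem x hx =>
      obtain ⟨⟨w, l⟩, rfl⟩ := hx
      exact Submodule.subset_span ⟨(w, l), rfl⟩
    | zero => exact zero_mem _
    | add x y hx' hy' hx hy => exact add_mem hx hy
    | smul r x hx' hx => exact Submodule.smul_mem _ r hx
  exact eq_top_iff.mpr fun x _ => key x ((mem_dotU D).1 x.2)

end dotU

theorem omega_mem {x : Uhat D} (hx : x ∈ dotSpan D) : Uhat.omega D x ∈ dotSpan D := by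
  induction hx using Submodule.span_induction with
  | mem x hx =>
    obtain ⟨⟨w, l⟩, rfl⟩ := hx
    have : Uhat.omega D (Uhat.incl D w * Uhat.idem D l) =
        Uhat.incl D (U.omega D w) * Uhat.idem D (-l) := by
      change Uhat.omegaHom D _ = _
      rw [map_mul, Uhat.omegaHom, Uhat.lift_incl, Uhat.lift_idem]
      rfl
    simp only
    rw [this]
    exact incl_mul_idem_mem D _ _
  | zero => simp
  | add x y _ _ hx hy => rw [map_add]; exact add_mem hx hy
  | smul r x _ hx => rw [map_smul]; exact Submodule.smul_mem _ _ hx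

theorem omega_symm_mem {x : Uhat D} (hx : x ∈ dotSpan D) :
    (Uhat.omega D).symm x ∈ dotSpan D := by
  induction hx using Submodule.span_induction with
  | mem x hx =>
    obtain ⟨⟨w, l⟩, rfl⟩ := hx
    have : (Uhat.omega D).symm (Uhat.incl D w * Uhat.idem D l) =
        Uhat.incl D ((U.omega D).symm w) * Uhat.idem D (-l) := by
      change Uhat.omegaInvHom D _ = _
      rw [map_mul, Uhat.omegaInvHom, Uhat.lift_incl, Uhat.lift_idem]
      rfl
    simp only
    rw [this]
    exact incl_mul_idem_mem D _ _
  | zero => simp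
  | add x y _ _ hx hy => rw [map_add]; exact add_mem hx hy
  | smul r x _ hx => rw [map_smul]; exact Submodule.smul_mem _ _ hx

/-- `ρ` on `Uhat`, as a linear map. -/
def Uhat.rho : Uhat D →ₗ[QvPi] Uhat D :=
  (MulOpposite.opLinearEquiv QvPi).symm.toLinearMap ∘ₗ (Uhat.rhoHom D).toLinearMap

theorem Uhat.rho_mul (x y : Uhat D) : Uhat.rho D (x * y) = Uhat.rho D y * Uhat.rho D x := by
  simp [Uhat.rho]

theorem Uhat.rho_incl (u : U D) : Uhat.rho D (Uhat.incl D u) = Uhat.incl D (U.rho D u) := by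
  simp [Uhat.rho, Uhat.rhoHom, U.rho]

theorem Uhat.rho_idem (l : X) : Uhat.rho D (Uhat.idem D l) = Uhat.idem D (-l) := by
  simp [Uhat.rho, Uhat.rhoHom]

theorem rho_mem {x : Uhat D} (hx : x ∈ dotSpan D) : Uhat.rho D x ∈ dotSpan D := by
  induction hx using Submodule.span_induction with
  | mem x hx =>
    obtain ⟨⟨w, l⟩, rfl⟩ := hx
    simp only
    rw [Uhat.rho_mul, Uhat.rho_incl, Uhat.rho_idem]
    exact idem_mul_incl_mem D _ _
  | zero => simp
  | add x y _ _ hx hy => rw [map_add]; exact add_mem hx hy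
  | smul r x _ hx => rw [map_smul]; exact Submodule.smul_mem _ _ hx

namespace dotU

/-- The automorphism `ω` of the modified form, with its inverse: `ω (x 1_λ) = ω(x) 1_{-λ}`. -/
def omega : dotU D ≃ₗ[QvPi] dotU D where
  toFun x := ⟨Uhat.omega D x, (mem_dotU D).2 (omega_mem D ((mem_dotU D).1 x.2))⟩
  invFun x := ⟨(Uhat.omega D).symm x, (mem_dotU D).2 (omega_symm_mem D ((mem_dotU D).1 x.2))⟩
  map_add' x y := Subtype.ext (map_add (Uhat.omega D) (x : Uhat D) y)
  map_smul' r x := Subtype.ext (map_smul (Uhat.omega D) r (x : Uhat D))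
  left_inv x := Subtype.ext ((Uhat.omega D).symm_apply_apply x)
  right_inv x := Subtype.ext ((Uhat.omega D).apply_symm_apply x)

/-- The anti-automorphism `ρ` of the modified form: `ρ (x 1_λ) = 1_{-λ} ρ(x)`. -/
def rho : dotU D →ₗ[QvPi] dotU D where
  toFun x := ⟨Uhat.rho D x, (mem_dotU D).2 (rho_mem D ((mem_dotU D).1 x.2))⟩
  map_add' x y := Subtype.ext (map_add (Uhat.rho D) (x : Uhat D) y)
  map_smul' r x := Subtype.ext (map_smul (Uhat.rho D) r (x : Uhat D))

theorem omega_mul (x y : dotU D) : omega D (x * y) = omega D x * omega D y :=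
  Subtype.ext (map_mul (Uhat.omega D) (x : Uhat D) y)

theorem omega_lact_one (u : U D) (l : X) :
    omega D (lact D u (one D l)) = lact D (U.omega D u) (one D (-l)) := by
  refine Subtype.ext ?_
  change Uhat.omegaHom D (Uhat.incl D u * Uhat.idem D l) = _
  rw [map_mul, Uhat.omegaHom, Uhat.lift_incl, Uhat.lift_idem]
  rfl

theorem rho_mul (x y : dotU D) : rho D (x * y) = rho D y * rho D x :=
  Subtype.ext (Uhat.rho_mul D x y)

theorem rho_lact_one (u : U D) (l : X) :
    rho D (lact D u (one D l)) = ract D (one D (-l)) (U.rho D u) := by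
  refine Subtype.ext ?_
  change Uhat.rho D (Uhat.incl D u * Uhat.idem D l) = _
  rw [Uhat.rho_mul, Uhat.rho_incl, Uhat.rho_idem]
  rfl

end dotU

end Dot

/-! ### The bilinear form on the half `f` -/

section Half

variable (C)

/-- The homomorphism from the free algebra on the `θ_i` to upper triangular matrices whose diagonal
is formed by the homomorphism `x ↦ π^{p(x)p(i)} v^{-i·|x|} x` and the identity. -/
def skewMat (i : I) :
    FreeAlgebra QvPi I →ₐ[QvPi] Matrix (Fin 2) (Fin 2) (FreeAlgebra QvPi I) :=
  letI := Classical.decEq I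
  FreeAlgebra.lift QvPi fun j : I =>
    !![pv (C.p i * C.p j) (-C.form i j) • FreeAlgebra.ι QvPi j, if i = j then 1 else 0;
      0, FreeAlgebra.ι QvPi j]

/-- The skew derivation `{}_i r` of the free algebra on the `θ_i`: it is linear, with
`{}_i r (θ_j) = δ_{ij}` and `{}_i r (x y) = {}_i r (x) y + π^{p(x)p(i)} v^{-i·|x|} x {}_i r (y)`.
It is the upper right entry of the matrix above. -/
def skewDer (i : I) : FreeAlgebra QvPi I →ₗ[QvPi] FreeAlgebra QvPi I :=
  Matrix.entryLinearMap QvPi (FreeAlgebra QvPi I) (0 : Fin 2) (1 : Fin 2) ∘ₗ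
    (skewMat C i).toLinearMap

/-- The bilinear form on the free algebra on the `θ_i` with `(1, x)` the constant term of `x` and
`(θ_i y, x) = (1 - π_i v_i²)⁻¹ (y, {}_i r (x))`. The half-quantum covering group `f` is the quotient
of the free algebra by the Serre relations, which lie in the radical, and the bilinear form on `f`
is the induced one. -/
def fForm : FreeAlgebra QvPi I →ₗ[QvPi] FreeAlgebra QvPi I →ₗ[QvPi] QvPi :=
  (LinearMap.compRight QvPi (FreeAlgebra.algebraMapInv (R := QvPi) (X := I)).toLinearMap) ∘ₗ
    (MulOpposite.opLinearEquiv QvPi).symm.toLinearMap ∘ₗ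
    (FreeAlgebra.lift QvPi fun i : I => MulOpposite.op
      ((Ring.inverse (1 - pv (C.d i) (2 * C.d i)) • skewDer C i :
        Module.End QvPi (FreeAlgebra QvPi I)))).toLinearMap

theorem fForm_one (x : FreeAlgebra QvPi I) :
    fForm C 1 x = FreeAlgebra.algebraMapInv x := by
  simp [fForm]

theorem fForm_mul (i : I) (y x : FreeAlgebra QvPi I) :
    fForm C (FreeAlgebra.ι QvPi i * y) x =
      Ring.inverse (1 - pv (C.d i) (2 * C.d i)) * fForm C y (skewDer C i x) := by
  simp [fForm]

theorem skewMat_row (i : I) (x : FreeAlgebra QvPi I) :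
    skewMat C i x 1 0 = 0 ∧ skewMat C i x 1 1 = x := by
  induction x using FreeAlgebra.induction with
  | grade0 r => simp [Matrix.algebraMap_matrix_apply]
  | grade1 j => simp [skewMat]
  | mul a b ha hb => simp [Matrix.mul_apply, Fin.sum_univ_two, ha, hb]
  | add a b ha hb => simp [ha, hb]

theorem skewDer_one (i : I) : skewDer C i 1 = 0 := by
  simp [skewDer]

theorem skewDer_ι_mul (i j : I) [Decidable (i = j)] (x : FreeAlgebra QvPi I) :
    skewDer C i (FreeAlgebra.ι QvPi j * x) = (if i = j then x else 0) +
      pv (C.p i * C.p j) (-C.form i j) • (FreeAlgebra.ι QvPi j * skewDer C i x) := by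
  have h : skewMat C i (FreeAlgebra.ι QvPi j) 0 0 =
      pv (C.p i * C.p j) (-C.form i j) • FreeAlgebra.ι QvPi j ∧
      skewMat C i (FreeAlgebra.ι QvPi j) 0 1 = if i = j then 1 else 0 := by
    simp [skewMat]
  simp only [skewDer, LinearMap.comp_apply, AlgHom.toLinearMap_apply, map_mul,
    Matrix.entryLinearMap_apply, Matrix.mul_apply, Fin.sum_univ_two, h, (skewMat_row C i x).2]
  rw [add_comm]
  split_ifs <;> simp

end Half

/-! ### The bilinear form on the modified form -/

section Form

variable (D : RootDatum C Y X)

/-- The homomorphism `x ↦ x⁻` to `U`, with `θ_i ↦ F_i`. -/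
def minus : FreeAlgebra QvPi I →ₐ[QvPi] U D := FreeAlgebra.lift QvPi (U.F D)

/-- The properties that define the bilinear form on the modified form. -/
structure IsDotForm (B : dotU D →ₗ[QvPi] dotU D →ₗ[QvPi] QvPi) : Prop where
  weight : ∀ (l₁ l₂ l₁' l₂' : X) (x x' : dotU D), ¬ (l₁ = l₁' ∧ l₂ = l₂') →
    B (dotU.one D l₁ * x * dotU.one D l₂) (dotU.one D l₁' * x' * dotU.one D l₂') = 0
  adjoint : ∀ (u : U D) (x y : dotU D),
    B (dotU.lact D u x) y = B x (dotU.lact D (U.tau1 D u) y)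
  half : ∀ (x x' : FreeAlgebra QvPi I) (l : X),
    B (dotU.lact D (minus D x) (dotU.one D l)) (dotU.lact D (minus D x') (dotU.one D l)) =
      fForm C x x'
  symm : ∀ x y : dotU D, B x y = B y x

end Form

end QCov

end

/-!
The form is obtained from one functional `ψ` on the modified form, by `(x, y) = ψ(τ₁(x) y)`. By
adjointness the form is known once the values `(1_λ, z)` are known. As the modified form is spanned
by the `τ₁(x⁻) y⁻ 1_μ` for monomials `x` and `y` (`dotU.mon_induction`), it is enough to know them
for these `z`, where the value has to be `(x, y)` for `λ = μ` and `0` otherwise. This gives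
uniqueness (`eq_dotForm`).

For existence, the functional with `ψ(τ₁(x⁻) y⁻ 1_λ) = (x, y)` has to be shown to be well defined,
that is, linear relations between these elements have to be respected. For this `U` is made to act
on a sum of copies of `f ⊗ f`, one for each weight (`Fock`): `τ₁(F_i) = v_i⁻¹ K̃_i E_i` multiplies
the first factor by `θ_i` from the right, and `F_i` multiplies the second factor by `θ_i` from the
left, with correction terms, skew derivations of the first factor, that are forced by the commutator
of `E_i` and `F_i`. The defining relations are checked in `fock_relations`. In place of the quotient
of the free algebra by the Serre relations, `Half` is the quotient by the radical of the form, which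
contains the Serre elements (`fForm_serre`). The Serre elements in the `F_i` therefore kill the
vectors `1 ⊗ y`; they also commute with the `E_j` up to scalars, as they are killed by the skew
derivations, and hence act by zero (`serre_opF`). The element `τ₁(x⁻) y⁻ 1_λ` sends `1 ⊗ 1` in the
component `λ` to `x ⊗ y`, so that `ψ(z)` is the sum over `λ` of the values of the functional
`φ : x ⊗ y ↦ (x, y)` on the images of these vectors under `z`.

Symmetry of the form is invariance of `ψ` under `τ₁`, which is the symmetry of the form on `f`. The
right adjointness says that `ψ(τ₁(u) z) = ψ(z τ̄₁(u))` (`psi_lact_tau1`). For `u = E_i` this is the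
fact that `φ` intertwines `F_i` with the right multiplication by `θ_i` on the second factor
(`phi_opF`), since left multiplication by `θ_i` is adjoint to `{}_i r`; for `u = F_i` it follows by
applying `τ₁`, which exchanges the two sides. Finally, `(ρ(x), ρ(y))` and `(ω(x), ω⁻¹(y))` satisfy
the properties that characterize the form: adjointness follows from `τ̄₁ ρ = ρ τ₁`, together with
the right adjointness, and from `τ₁ ω = ω⁻¹ τ₁`; on the `x⁻ 1_λ` both reduce to the invariance of
the form on `f` under reversal of monomials.
-/

noncomputable section

namespace QCov

variable {I : Type*}

local notation "θ" => FreeAlgebra.ι QvPi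

/-! ### The free algebra on the `θ_i` -/

section FreeHalf

/-- Induction along multiplication by a generator from the left. -/
theorem free_induction_left {P : FreeAlgebra QvPi I → Prop} (h1 : P 1)
    (hm : ∀ i x, P x → P (θ i * x)) (ha : ∀ x y, P x → P y → P (x + y))
    (hs : ∀ (r : QvPi) x, P x → P (r • x)) (x : FreeAlgebra QvPi I) : P x := by
  have key : ∀ a y : FreeAlgebra QvPi I, P y → P (a * y) := by
    intro a
    induction a using FreeAlgebra.induction with
    | grade0 r => intro y hy; rw [← Algebra.smul_def]; exact hs r y hy
    | grade1 i => exact fun y hy => hm i y hy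
    | mul a b ha' hb => intro y hy; rw [mul_assoc]; exact ha' _ (hb y hy)
    | add a b ha' hb => intro y hy; rw [add_mul]; exact ha _ _ (ha' y hy) (hb y hy)
  simpa using key x 1 h1

/-- Induction along multiplication by a generator from the right. -/
theorem free_induction_right {P : FreeAlgebra QvPi I → Prop} (h1 : P 1)
    (hm : ∀ i x, P x → P (x * θ i)) (ha : ∀ x y, P x → P y → P (x + y))
    (hs : ∀ (r : QvPi) x, P x → P (r • x)) (x : FreeAlgebra QvPi I) : P x := by
  have key : ∀ a y : FreeAlgebra QvPi I, P y → P (y * a) := by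
    intro a
    induction a using FreeAlgebra.induction with
    | grade0 r => intro y hy; rw [← Algebra.commutes, ← Algebra.smul_def]; exact hs r y hy
    | grade1 i => exact fun y hy => hm i y hy
    | mul a b ha' hb => intro y hy; rw [← mul_assoc]; exact hb _ (ha' y hy)
    | add a b ha' hb => intro y hy; rw [mul_add]; exact ha _ _ (ha' y hy) (hb y hy)
  simpa using key x 1 h1

/-- The monomial `θ_{i₁} ⋯ θ_{iₙ}`. -/
def word (l : List I) : FreeAlgebra QvPi I := (l.map (θ)).prod

@[simp] theorem word_nil : word ([] : List I) = 1 := rfl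

@[simp] theorem word_cons (i : I) (l : List I) : word (i :: l) = θ i * word l := by simp [word]

theorem word_append (l m : List I) : word (l ++ m) = word l * word m := by simp [word]

/-- A property of vectors that is stable under linear combinations holds on the free algebra when it
holds on monomials. -/
theorem word_induction {P : FreeAlgebra QvPi I → Prop} (hw : ∀ l, P (word l))
    (ha : ∀ x y, P x → P y → P (x + y))
    (hs : ∀ (r : QvPi) x, P x → P (r • x)) (x : FreeAlgebra QvPi I) : P x := by
  have h : x ∈ Submodule.span QvPi (Set.range (word (I := I))) := by
    induction x using free_induction_left with
    | h1 => exact Submodule.subset_span ⟨[], rfl⟩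
    | hm i x hx =>
      induction hx using Submodule.span_induction with
      | mem x hx =>
        obtain ⟨l, rfl⟩ := hx
        exact Submodule.subset_span ⟨i :: l, word_cons i l⟩
      | zero => simp
      | add x y _ _ hx hy => rw [mul_add]; exact add_mem hx hy
      | smul r x _ hx => rw [mul_smul_comm]; exact Submodule.smul_mem _ _ hx
    | ha x y hx hy => exact add_mem hx hy
    | hs r x hx => exact Submodule.smul_mem _ _ hx
  induction h using Submodule.span_induction with
  | mem x hx =>
    obtain ⟨l, rfl⟩ := hx
    exact hw l
  | zero => simpa using hs 0 _ (hw [])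
  | add x y _ _ hx hy => exact ha _ _ hx hy
  | smul r x _ hx => exact hs _ _ hx

/-- The algebra endomorphism `θ_i ↦ χ_i θ_i`. -/
def scal (χ : I → QvPi) : FreeAlgebra QvPi I →ₐ[QvPi] FreeAlgebra QvPi I :=
  FreeAlgebra.lift QvPi fun i => χ i • θ i

@[simp] theorem scal_ι (χ : I → QvPi) (i : I) : scal χ (θ i) = χ i • θ i := by simp [scal]

/-- The linear anti-automorphism of the free algebra that fixes the generators. -/
def rev : FreeAlgebra QvPi I →ₗ[QvPi] FreeAlgebra QvPi I :=
  (MulOpposite.opLinearEquiv QvPi).symm.toLinearMap ∘ₗ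
    (FreeAlgebra.lift QvPi fun i : I => MulOpposite.op (θ i)).toLinearMap

@[simp] theorem rev_one : rev (1 : FreeAlgebra QvPi I) = 1 := by simp [rev]

@[simp] theorem rev_ι (i : I) : rev (θ i) = θ i := by simp [rev]

@[simp] theorem rev_mul (x y : FreeAlgebra QvPi I) : rev (x * y) = rev y * rev x := by simp [rev]

@[simp] theorem rev_rev (x : FreeAlgebra QvPi I) : rev (rev x) = x := by
  induction x using free_induction_left with
  | h1 => simp
  | hm i x hx => simp [hx]
  | ha x y hx hy => simp [hx, hy]
  | hs r x hx => simp [hx]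

theorem rev_word (l : List I) : rev (word l) = word l.reverse := by
  induction l with
  | nil => simp
  | cons i l ih => simp [ih, word_append]

theorem scal_rev (χ : I → QvPi) (x : FreeAlgebra QvPi I) : scal χ (rev x) = rev (scal χ x) := by
  induction x using free_induction_left with
  | h1 => simp
  | hm i x hx => simp [hx]
  | ha x y hx hy => simp [hx, hy]
  | hs r x hx => simp [hx]

theorem scal_word [DecidableEq I] (r : QvPi) (i : I) (l : List I) :
    scal (fun j => if j = i then r else 1) (word l) = r ^ l.count i • word l := by
  induction l with
  | nil => simp
  | cons j l ih =>
    simp only [word_cons, map_mul, scal_ι, ih, List.count_cons, beq_iff_eq]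
    split_ifs <;> simp [smul_smul, pow_succ]

end FreeHalf

/-! ### The skew derivations and the form on the free algebra -/

section FreeForm

variable (C : CartanDatum I)

/-- The endomorphism `x ↦ π^{p(x)p(i)} v^{-i·|x|} x`. -/
def twistNeg (i : I) : FreeAlgebra QvPi I →ₐ[QvPi] FreeAlgebra QvPi I :=
  scal fun j => pv (C.p i * C.p j) (-C.form i j)

/-- The endomorphism `x ↦ π^{p(x)p(i)} v^{i·|x|} x`. -/
def twistPos (i : I) : FreeAlgebra QvPi I →ₐ[QvPi] FreeAlgebra QvPi I :=
  scal fun j => pv (C.p i * C.p j) (C.form i j)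

@[simp] theorem twistNeg_ι (i j : I) :
    twistNeg C i (θ j) = pv (C.p i * C.p j) (-C.form i j) • θ j := by simp [twistNeg]

@[simp] theorem twistPos_ι (i j : I) :
    twistPos C i (θ j) = pv (C.p i * C.p j) (C.form i j) • θ j := by simp [twistPos]

theorem skewMat_zero_zero (i : I) (x : FreeAlgebra QvPi I) :
    skewMat C i x 0 0 = twistNeg C i x := by
  induction x using FreeAlgebra.induction with
  | grade0 r => simp [Matrix.algebraMap_matrix_apply]
  | grade1 j => simp [skewMat]
  | mul a b ha hb =>
    simp [Matrix.mul_apply, Fin.sum_univ_two, ha, hb, (skewMat_row C i b).1]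
  | add a b ha hb => simp [ha, hb]

theorem skewDer_mul (i : I) (x y : FreeAlgebra QvPi I) :
    skewDer C i (x * y) = skewDer C i x * y + twistNeg C i x * skewDer C i y := by
  simp only [skewDer, LinearMap.comp_apply, AlgHom.toLinearMap_apply, map_mul,
    Matrix.entryLinearMap_apply, Matrix.mul_apply, Fin.sum_univ_two, skewMat_zero_zero,
    (skewMat_row C i y).2]
  rw [add_comm]

theorem skewDer_ι (i j : I) [Decidable (i = j)] : skewDer C i (θ j) = if i = j then 1 else 0 := by
  simpa [skewDer_one] using skewDer_ι_mul C i j 1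

theorem skewDer_mul_ι (i j : I) [Decidable (i = j)] (x : FreeAlgebra QvPi I) :
    skewDer C i (x * θ j) = skewDer C i x * θ j + if i = j then twistNeg C i x else 0 := by
  rw [skewDer_mul, skewDer_ι]
  split_ifs <;> simp

/-- The scalar `(1 - π_i v_i²)⁻¹ = (θ_i, θ_i)`. -/
def normSq (i : I) : QvPi := Ring.inverse (1 - pv (C.d i) (2 * C.d i))

theorem isUnit_one_sub (i : I) : IsUnit (1 - pv (C.d i) (2 * C.d i)) := by
  have h := isUnit_pv_sub (C.d i) (m := 2 * C.d i) (n := 0) (by have := C.d_pos i; omega)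
  rw [pv_zero] at h
  rw [← neg_sub]
  exact h.neg

theorem isUnit_normSq (i : I) : IsUnit (normSq C i) := (isUnit_one_sub C i).ringInverse

theorem fForm_ι_mul (i : I) (x y : FreeAlgebra QvPi I) :
    fForm C (θ i * x) y = normSq C i * fForm C x (skewDer C i y) := fForm_mul C i x y

theorem counit_ι (i : I) : FreeAlgebra.algebraMapInv (θ i : FreeAlgebra QvPi I) = 0 := by
  simp [FreeAlgebra.algebraMapInv]

theorem scal_counit (χ : I → QvPi) (x : FreeAlgebra QvPi I) :
    FreeAlgebra.algebraMapInv (scal χ x) = FreeAlgebra.algebraMapInv x := by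
  have : (FreeAlgebra.algebraMapInv (R := QvPi) (X := I)).comp (scal χ) =
      FreeAlgebra.algebraMapInv := by
    refine FreeAlgebra.hom_ext ?_
    funext i
    simp [counit_ι]
  exact DFunLike.congr_fun this x

theorem skewDer_scal (i : I) (χ : I → QvPi) (x : FreeAlgebra QvPi I) :
    skewDer C i (scal χ x) = χ i • scal χ (skewDer C i x) := by
  classical
  induction x using free_induction_left with
  | h1 => simp [skewDer_one]
  | hm j x hx =>
    simp only [map_mul, scal_ι, smul_mul_assoc, map_smul, skewDer_ι_mul, hx, map_add, smul_add,
      mul_smul_comm, smul_smul]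
    congr 1
    · split_ifs with h
      · rw [h]
      · simp
    · congr 1
      ring
  | ha x y hx hy => simp [hx, hy]
  | hs r x hx => simp only [map_smul, hx, smul_comm r]

theorem fForm_scal (χ : I → QvPi) (x y : FreeAlgebra QvPi I) :
    fForm C (scal χ x) y = fForm C x (scal χ y) := by
  induction x using free_induction_left generalizing y with
  | h1 => rw [map_one, fForm_one, fForm_one, scal_counit]
  | hm i x hx =>
    simp only [map_mul, scal_ι, smul_mul_assoc, map_smul, LinearMap.smul_apply, fForm_ι_mul,
      skewDer_scal, hx, smul_eq_mul]
    ring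
  | ha x z hx hz => simp [hx, hz]
  | hs r x hx => simp [hx]

/-- Monomials with different contents are orthogonal: they have different eigenvalues for one of the
self-adjoint operators `scal χ`. -/
theorem fForm_word_of_not_perm {l m : List I} (h : ¬ l.Perm m) : fForm C (word l) (word m) = 0 := by
  classical
  rw [List.perm_iff_count] at h
  push Not at h
  obtain ⟨i, hi⟩ := h
  have h1 := fForm_scal C (fun j => if j = i then pv 0 1 else 1) (word l) (word m)
  rw [scal_word, scal_word, map_smul, map_smul, LinearMap.smul_apply, smul_eq_mul, smul_eq_mul,
    ← sub_eq_zero, ← sub_mul] at h1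
  have hp : ∀ n : ℕ, pv 0 1 ^ n = pv 0 n := by
    intro n
    induction n with
    | zero => simp [pv_zero]
    | succ n ih => rw [pow_succ, ih, pv_mul]; congr 1
  rw [hp, hp] at h1
  exact (isUnit_pv_sub 0 (by exact_mod_cast hi)).mul_right_eq_zero.mp h1

/-- Also in the second argument of the form, left multiplication by `θ_i` is adjoint to `{}_i r`.
The symmetry of the form follows by comparison with the first argument. -/
theorem fForm_mul_left_right (i : I) (x y : FreeAlgebra QvPi I) :
    fForm C x (θ i * y) = normSq C i * fForm C (skewDer C i x) y := by
  classical
  induction x using free_induction_left generalizing y with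
  | h1 => simp [fForm_one, skewDer_one, counit_ι]
  | hm j x hx =>
    rw [fForm_ι_mul, skewDer_ι_mul, skewDer_ι_mul]
    simp only [map_add, map_smul, LinearMap.add_apply, LinearMap.smul_apply, fForm_ι_mul, hx,
      smul_eq_mul]
    rw [C.form_symm i j]
    by_cases hij : j = i
    · subst hij
      simp
    · simp only [hij, Ne.symm hij, if_false, map_zero, LinearMap.zero_apply, zero_add]
      rw [mul_comm (C.p j : ℤ)]
      ring
  | ha x z hx hz => simp only [map_add, LinearMap.add_apply, hx, hz, mul_add]
  | hs r x hx =>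
    simp only [map_smul, LinearMap.smul_apply, hx, smul_eq_mul]
    ring

theorem fForm_symm (x y : FreeAlgebra QvPi I) : fForm C x y = fForm C y x := by
  induction x using free_induction_left generalizing y with
  | h1 =>
    rw [fForm_one]
    induction y using free_induction_left with
    | h1 => rw [fForm_one]
    | hm i y hy => simp [fForm_ι_mul, skewDer_one, counit_ι]
    | ha x y hx hy => simp [hx, hy]
    | hs r x hx => simp [hx]
  | hm i x hx => rw [fForm_ι_mul, hx, fForm_mul_left_right]
  | ha x z hx hz => simp [hx, hz]
  | hs r x hx => simp [hx]

/-- The right skew derivation `r_i`, with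
`r_i (x y) = x r_i (y) + π^{p(y)p(i)} v^{-i·|y|} r_i (x) y`. -/
def skewDerR (i : I) : FreeAlgebra QvPi I →ₗ[QvPi] FreeAlgebra QvPi I :=
  rev ∘ₗ skewDer C i ∘ₗ rev

theorem skewDerR_one (i : I) : skewDerR C i 1 = 0 := by simp [skewDerR, skewDer_one]

theorem rev_skewDer (i : I) (x : FreeAlgebra QvPi I) :
    rev (skewDer C i x) = skewDerR C i (rev x) := by simp [skewDerR]

theorem skewDerR_mul_ι (i j : I) [Decidable (i = j)] (x : FreeAlgebra QvPi I) :
    skewDerR C i (x * θ j) = (if i = j then x else 0) +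
      pv (C.p i * C.p j) (-C.form i j) • (skewDerR C i x * θ j) := by
  simp only [skewDerR, LinearMap.comp_apply, rev_mul, rev_ι, skewDer_ι_mul, map_add, map_smul]
  split_ifs <;> simp

theorem skewDerR_ι_mul (i j : I) [Decidable (i = j)] (x : FreeAlgebra QvPi I) :
    skewDerR C i (θ j * x) = θ j * skewDerR C i x + if i = j then twistNeg C i x else 0 := by
  simp only [skewDerR, LinearMap.comp_apply, rev_mul, rev_ι, skewDer_mul_ι, map_add, twistNeg,
    scal_rev]
  split_ifs <;> simp

theorem skewDerR_scal (i : I) (χ : I → QvPi) (x : FreeAlgebra QvPi I) :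
    skewDerR C i (scal χ x) = χ i • scal χ (skewDerR C i x) := by
  simp [skewDerR, ← scal_rev, skewDer_scal]

theorem skewDer_skewDerR (i j : I) (x : FreeAlgebra QvPi I) :
    skewDer C j (skewDerR C i x) = skewDerR C i (skewDer C j x) := by
  classical
  induction x using free_induction_right with
  | h1 => simp [skewDer_one, skewDerR_one]
  | hm k x hx =>
    rw [skewDerR_mul_ι, skewDer_mul_ι, map_add, map_add, map_smul, skewDer_mul_ι, skewDerR_mul_ι,
      hx, smul_add, add_assoc]
    congr 1
    · split_ifs <;> simp
    congr 1
    split_ifs with hjk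
    · rw [twistNeg, skewDerR_scal, hjk, C.form_symm i k, mul_comm (C.p i : ℤ)]
    · simp
  | ha x y hx hy => simp [hx, hy]
  | hs r x hx => simp [hx]

theorem counit_skewDerR (i : I) (x : FreeAlgebra QvPi I) :
    FreeAlgebra.algebraMapInv (skewDerR C i x) = FreeAlgebra.algebraMapInv (skewDer C i x) := by
  classical
  induction x using free_induction_left with
  | h1 => simp [skewDer_one, skewDerR_one]
  | hm j x hx =>
    rw [skewDerR_ι_mul, skewDer_ι_mul]
    simp only [map_add, map_mul, map_smul]
    split_ifs
    · simp [twistNeg, scal_counit, counit_ι]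
    · simp [counit_ι]
  | ha x y hx hy => simp [hx, hy]
  | hs r x hx => simp [hx]

/-- Right multiplication by `θ_i` is adjoint to `r_i`, as `r_i` commutes with the `{}_j r`. -/
theorem fForm_mul_ι (i : I) (x y : FreeAlgebra QvPi I) :
    fForm C (x * θ i) y = normSq C i * fForm C x (skewDerR C i y) := by
  induction x using free_induction_left generalizing y with
  | h1 =>
    have h := fForm_ι_mul C i 1 y
    rw [mul_one] at h
    rw [one_mul, h, fForm_one, fForm_one, counit_skewDerR]
  | hm j x hx =>
    rw [mul_assoc, fForm_ι_mul, hx, fForm_ι_mul, skewDer_skewDerR]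
    ring
  | ha x z hx hz => simp only [add_mul, map_add, LinearMap.add_apply, hx, hz, mul_add]
  | hs r x hx =>
    simp only [smul_mul_assoc, map_smul, LinearMap.smul_apply, hx, smul_eq_mul]
    ring

theorem fForm_rev (x y : FreeAlgebra QvPi I) : fForm C (rev x) (rev y) = fForm C x y := by
  induction x using free_induction_left generalizing y with
  | h1 =>
    rw [rev_one, fForm_one, fForm_one]
    induction y using free_induction_left with
    | h1 => simp
    | hm i y hy => simp [counit_ι]
    | ha x y hx hy => simp [hx, hy]
    | hs r x hx => simp [hx]
  | hm i x hx => rw [rev_mul, rev_ι, fForm_mul_ι, ← rev_skewDer, hx, fForm_ι_mul]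
  | ha x z hx hz => simp only [map_add, LinearMap.add_apply, hx, hz]
  | hs r x hx => simp only [map_smul, LinearMap.smul_apply, hx]

end FreeForm

/-! ### The Serre elements lie in the radical -/

section Integers

theorem pv_pow (a b : ℤ) (n : ℕ) : pv a b ^ n = pv (n * a) (n * b) := by
  induction n with
  | zero => simp [pv_zero]
  | succ n ih =>
    rw [pow_succ, ih, pv_mul]
    congr 1 <;> push_cast <;> ring

theorem isUnit_pv (a b : ℤ) : IsUnit (pv a b) := Units.isUnit _

theorem isUnit_qden {d : ℕ} (hd : 0 < d) : IsUnit (pv d d - pv 0 (-d)) :=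
  isUnit_pv_sub d (by omega)

theorem qint_zero (d : ℕ) : qint d 0 = 0 := by simp [qint, pv_zero]

theorem qint_one {d : ℕ} (hd : 0 < d) : qint d 1 = 1 := by
  rw [qint, Nat.cast_one, mul_one, Ring.mul_inverse_cancel _ (isUnit_qden hd)]

theorem qint_add (d a c : ℕ) :
    qint d (a + c) = pv (d * c) (d * c) * qint d a + pv 0 (-(d * a)) * qint d c := by
  simp only [qint]
  rw [← mul_assoc, ← mul_assoc, ← add_mul, mul_sub, mul_sub, pv_mul, pv_mul, pv_mul, pv_mul]
  congr 1
  have e1 : (d : ℤ) * c + d * a = d * ((a + c : ℕ) : ℤ) := by push_cast; ring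
  have e2 : -((d : ℤ) * a) + d * c = d * c + -(d * a) := by ring
  have e3 : -((d : ℤ) * a) + -(d * c) = -(d * ((a + c : ℕ) : ℤ)) := by push_cast; ring
  rw [e1, e2, e3, add_zero, zero_add, add_zero]
  ring

theorem isUnit_qint {d n : ℕ} (hd : 0 < d) (hn : 0 < n) : IsUnit (qint d n) := by
  refine IsUnit.mul (isUnit_pv_sub _ ?_) (isUnit_qden hd).ringInverse
  have : 0 < (d : ℤ) * n := by positivity
  omega

theorem qfact_succ (d n : ℕ) : qfact d (n + 1) = qfact d n * qint d (n + 1) :=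
  Finset.prod_range_succ _ _

theorem qbinom_succ_mul {d n m : ℕ} (hd : 0 < d) (h : m < n) :
    qbinom d n (m + 1) * qint d (m + 1) = qbinom d n m * qint d (n - m) := by
  obtain ⟨r, rfl⟩ : ∃ r, n = m + 1 + r := ⟨n - (m + 1), by omega⟩
  have e1 : m + 1 + r - (m + 1) = r := by omega
  have e2 : m + 1 + r - m = r + 1 := by omega
  rw [qbinom, qbinom, e1, e2, qfact_succ d m, qfact_succ d r]
  simp only [Ring.mul_inverse_rev]
  have h1 := Ring.inverse_mul_cancel _ (isUnit_qint hd m.succ_pos)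
  have h2 := Ring.inverse_mul_cancel _ (isUnit_qint hd r.succ_pos)
  rw [Nat.succ_eq_add_one] at h1 h2
  linear_combination (qfact d (m + 1 + r) * Ring.inverse (qfact d r) *
    Ring.inverse (qfact d m)) * (h1 - h2)

end Integers

section SerreElements

variable (C : CartanDatum I)

/-- The number `b_{ij} = 1 - a_{ij}`. -/
def serreDeg (i l : I) : ℕ := (1 - C.a i l).toNat

/-- The coefficient of `x_i^{b-k} x_l x_i^k` in the Serre relation. -/
def serreCoef (i l : I) (k : ℕ) : QvPi :=
  (-1) ^ k * pv (k.choose 2 * C.p i + k * C.p i * C.p l) 0 * qbinom (C.d i) (serreDeg C i l) k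

theorem serre_eq {A : Type*} [Ring A] [Algebra QvPi A] (i l : I) (x y : A) :
    serre C i l x y = ∑ k ∈ Finset.range (serreDeg C i l + 1),
      serreCoef C i l k • (x ^ (serreDeg C i l - k) * y * x ^ k) := rfl

theorem serre_smul {A : Type*} [Ring A] [Algebra QvPi A] (i l : I) (c c' : QvPi) (x y : A) :
    serre C i l (c • x) (c' • y) = (c ^ serreDeg C i l * c') • serre C i l x y := by
  rw [serre_eq, serre_eq, Finset.smul_sum]
  refine Finset.sum_congr rfl fun k hk => ?_
  obtain ⟨m, hm⟩ : ∃ m, serreDeg C i l = m + k :=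
    ⟨serreDeg C i l - k, by have := Finset.mem_range.mp hk; omega⟩
  have e : serreDeg C i l - k = m := by omega
  rw [e, smul_pow, smul_pow, smul_mul_smul_comm, smul_mul_smul_comm, smul_smul, smul_smul, hm,
    pow_add]
  congr 1
  ring

variable {C}

theorem cast_serreDeg {i l : I} (hil : i ≠ l) : (serreDeg C i l : ℤ) = 1 - C.a i l :=
  Int.toNat_of_nonneg (by have := C.a_nonpos i l hil; omega)

theorem form_eq_serreDeg {i l : I} (hil : i ≠ l) :
    C.form i l = -(C.d i * (serreDeg C i l - 1)) := by
  rw [cast_serreDeg hil, ← C.d_mul_a]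
  ring

theorem serreDeg_pos {i l : I} (hil : i ≠ l) : 0 < serreDeg C i l := by
  have h1 := cast_serreDeg (C := C) hil
  have h2 := C.a_nonpos i l hil
  omega

theorem even_d_mul_serreDeg {i l : I} (hil : i ≠ l) :
    Even ((C.d i : ℤ) * (serreDeg C i l - 1)) := by
  have := C.even_form i l
  rwa [form_eq_serreDeg hil, even_neg] at this

theorem serreCoef_succ_mul (i l : I) {k : ℕ} (hk : k < serreDeg C i l) :
    serreCoef C i l (k + 1) * qint (C.d i) (k + 1) =
      -(pv (k * C.d i + C.p i * C.p l) 0 * serreCoef C i l k *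
        qint (C.d i) (serreDeg C i l - k)) := by
  have h := qbinom_succ_mul (C.d_pos i) hk
  have hp : pv ((k + 1).choose 2 * C.p i + (k + 1 : ℕ) * C.p i * C.p l) 0 =
      pv (k * C.d i + C.p i * C.p l) 0 * pv (k.choose 2 * C.p i + k * C.p i * C.p l) 0 := by
    rw [pv_mul]
    refine pv_congr ?_ rfl
    have e := C.even_d_sub i
    have hpp : (C.p i : ℤ) * C.p i = C.p i := by
      have := C.p_lt_two i
      interval_cases C.p i <;> rfl
    rw [hpp] at e
    obtain ⟨r, hr⟩ := e
    refine ⟨-(k * r), ?_⟩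
    have hr' : (C.d i : ℤ) = C.p i + (r + r) := by linarith
    rw [hr', Nat.choose_succ_succ' k 1]
    push_cast [Nat.choose_one_right]
    ring
  rw [serreCoef, serreCoef, hp, mul_assoc, h, pow_succ]
  ring

theorem twistNeg_pow (j i : I) (n : ℕ) :
    twistNeg C j (θ i ^ n) = pv (n * (C.p j * C.p i)) (-(n * C.form j i)) • θ i ^ n := by
  rw [map_pow, twistNeg_ι, smul_pow, pv_pow, mul_neg]

theorem skewDer_pow_of_ne {j i : I} (h : j ≠ i) (n : ℕ) : skewDer C j (θ i ^ n) = 0 := by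
  classical
  induction n with
  | zero => rw [pow_zero, skewDer_one]
  | succ n ih => rw [pow_succ', skewDer_ι_mul, if_neg h, ih, mul_zero, smul_zero, add_zero]

theorem skewDer_pow_self (i : I) (n : ℕ) : skewDer C i (θ i ^ n) =
    (pv (C.d i * (n - 1)) (-(C.d i * (n - 1))) * qint (C.d i) n) • θ i ^ (n - 1) := by
  classical
  induction n with
  | zero => rw [pow_zero, skewDer_one, qint_zero, mul_zero, zero_smul]
  | succ n ih =>
    have hpow : θ i * ((pv (C.d i * (n - 1)) (-(C.d i * (n - 1))) * qint (C.d i) n) •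
        θ i ^ (n - 1)) =
        (pv (C.d i * (n - 1)) (-(C.d i * (n - 1))) * qint (C.d i) n) •
          (θ i : FreeAlgebra QvPi I) ^ n := by
      rcases n with _ | n
      · simp [qint_zero]
      · rw [mul_smul_comm, ← pow_succ']
        simp
    rw [pow_succ', skewDer_ι_mul, if_pos rfl, ih, hpow, smul_smul, Nat.add_sub_cancel,
      U.pv_p_mul_self, C.form_self]
    nth_rw 1 [← one_smul QvPi (θ i ^ n)]
    rw [← add_smul]
    congr 1
    have h1 : pv (C.d i * n) (-(C.d i * n)) * pv (C.d i * n) (C.d i * n) = 1 := by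
      rw [pv_mul]
      exact U.pv_one ⟨C.d i * n, rfl⟩ (by ring)
    have h2 : pv (C.d i) (-(2 * C.d i)) * pv (C.d i * (n - 1)) (-(C.d i * (n - 1))) =
        pv (C.d i * n) (-(C.d i * n)) * pv 0 (-(C.d i * (1 : ℕ))) := by
      rw [pv_mul, pv_mul]
      refine pv_congr ⟨0, ?_⟩ ?_ <;> push_cast <;> ring
    have h3 : (C.d i : ℤ) * ((1 + n : ℕ) - 1) = C.d i * n := by push_cast; ring
    rw [add_comm n 1, h3, qint_add, qint_one (C.d_pos i), mul_one]
    linear_combination qint (C.d i) n * h2 - h1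

/-- In `{}_i r` of the Serre element, each monomial receives a contribution from two consecutive
terms of the sum, and the two cancel. -/
theorem skewDer_serre_self {i l : I} (hil : i ≠ l) :
    skewDer C i (serre C i l (θ i) (θ l)) = 0 := by
  classical
  set b := serreDeg C i l with hb
  have hbpos : 0 < b := serreDeg_pos hil
  -- `u m` is the coefficient in `{}_i r (θ_i ^ m) = u m • θ_i ^ (m - 1)`.
  set u : ℕ → QvPi := fun m => pv (C.d i * (m - 1)) (-(C.d i * (m - 1))) * qint (C.d i) m with hu
  have hterm : ∀ m ∈ Finset.range (b + 1),
      skewDer C i (serreCoef C i l m • (θ i ^ (b - m) * θ l * θ i ^ m)) =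
      (serreCoef C i l m * u (b - m)) • (θ i ^ (b - m - 1) * θ l * θ i ^ m) +
      (serreCoef C i l m * (pv ((b - m : ℕ) * (C.p i * C.p i)) (-((b - m : ℕ) * C.form i i)) *
        (pv (C.p i * C.p l) (-C.form i l) * u m))) • (θ i ^ (b - m) * θ l * θ i ^ (m - 1)) := by
    intro m _
    rw [map_smul, mul_assoc, skewDer_mul, skewDer_pow_self, twistNeg_pow, skewDer_ι_mul, if_neg hil,
      zero_add, skewDer_pow_self]
    simp only [smul_add, smul_mul_assoc, mul_smul_comm, smul_smul, mul_assoc]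
    congr 2
    simp only [hu]
    ring
  rw [serre_eq, map_sum, Finset.sum_congr rfl hterm, Finset.sum_add_distrib,
    Finset.sum_range_succ, Finset.sum_range_succ']
  have hz : u 0 = 0 := by simp [hu, qint_zero]
  rw [Nat.sub_self, hz]
  simp only [mul_zero, zero_smul, add_zero]
  rw [← Finset.sum_add_distrib]
  refine Finset.sum_eq_zero fun m hm => ?_
  have hm' : m < b := Finset.mem_range.mp hm
  obtain ⟨r, hr⟩ : ∃ r, b = m + 1 + r := ⟨b - (m + 1), by omega⟩
  have e1 : b - m = r + 1 := by omega
  have e2 : b - (m + 1) = r := by omega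
  rw [e1, e2, Nat.add_sub_cancel, Nat.add_sub_cancel, ← add_smul]
  have hc := serreCoef_succ_mul i l hm'
  rw [← hb, e1] at hc
  suffices h : serreCoef C i l m * u (r + 1) + serreCoef C i l (m + 1) *
      (pv (r * (C.p i * C.p i)) (-(r * C.form i i)) *
        (pv (C.p i * C.p l) (-C.form i l) * u (m + 1))) = 0 by
    rw [h, zero_smul]
  have hpv : pv (C.d i * r) (-(C.d i * r)) =
      pv (r * (C.p i * C.p i)) (-(r * C.form i i)) * pv (C.p i * C.p l) (-C.form i l) *
        pv (C.d i * m) (-(C.d i * m)) * pv (m * C.d i + C.p i * C.p l) 0 := by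
    rw [pv_mul, pv_mul, pv_mul]
    obtain ⟨s, hs⟩ := C.even_d_sub i
    refine pv_congr ⟨r * s - C.d i * m - C.p i * C.p l, ?_⟩ ?_
    · linear_combination (r : ℤ) * hs
    · rw [form_eq_serreDeg hil, ← hb, C.form_self, hr]
      push_cast
      ring
  simp only [hu]
  have e3 : (C.d i : ℤ) * ((r + 1 : ℕ) - 1) = C.d i * r := by push_cast; ring
  have e4 : (C.d i : ℤ) * ((m + 1 : ℕ) - 1) = C.d i * m := by push_cast; ring
  rw [e3, e4, hpv]
  linear_combination (pv (r * (C.p i * C.p i)) (-(r * C.form i i)) *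
    pv (C.p i * C.p l) (-C.form i l) * pv (C.d i * m) (-(C.d i * m))) * hc

/-- A case of the `(v,π)`-binomial theorem. It is proved by induction, through a closed form of the
partial sums. -/
theorem sum_serreCoef_mul_eq_zero {i l : I} (hil : i ≠ l) :
    ∑ m ∈ Finset.range (serreDeg C i l + 1), serreCoef C i l m *
      pv (m * (C.p i * C.p l)) (-(C.d i * (serreDeg C i l - 1) * m)) = 0 := by
  set b := serreDeg C i l with hb
  set t : ℕ → QvPi := fun m => serreCoef C i l m *
      pv (m * (C.p i * C.p l)) (-(C.d i * (b - 1) * m)) with ht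
  have hpart : ∀ m ≤ b, qint (C.d i) b * ∑ k ∈ Finset.range (m + 1), t k =
      pv 0 (-(C.d i * m)) * qint (C.d i) (b - m) * t m := by
    intro m
    induction m with
    | zero => intro _; simp [pv_zero]
    | succ m ih =>
      intro hm
      obtain ⟨r, hr⟩ : ∃ r, b = m + 1 + r := ⟨b - (m + 1), by omega⟩
      have e1 : b - m = r + 1 := by omega
      have e2 : b - (m + 1) = r := by omega
      have hc := serreCoef_succ_mul i l (show m < serreDeg C i l by omega)
      rw [← hb, e1] at hc
      rw [Finset.sum_range_succ, mul_add, ih (by omega), e1, e2]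
      have hq : qint (C.d i) b = pv (C.d i * r) (C.d i * r) * qint (C.d i) (m + 1) +
          pv 0 (-(C.d i * (m + 1 : ℕ))) * qint (C.d i) r := by rw [hr, qint_add]
      have hpv : pv (C.d i * r) (C.d i * r) *
            pv ((m + 1 : ℕ) * (C.p i * C.p l)) (-(C.d i * (b - 1) * (m + 1 : ℕ))) *
            pv (m * C.d i + C.p i * C.p l) 0 =
          pv 0 (-(C.d i * m)) * pv (m * (C.p i * C.p l)) (-(C.d i * (b - 1) * m)) := by
        rw [pv_mul, pv_mul, pv_mul]
        obtain ⟨s, hs⟩ := even_d_mul_serreDeg (C := C) hil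
        rw [← hb] at hs
        have hr' : (b : ℤ) = m + 1 + r := by exact_mod_cast hr
        refine pv_congr ⟨s + C.p i * C.p l, ?_⟩ ?_
        · rw [hr'] at hs
          push_cast
          linear_combination hs
        · rw [hr']; push_cast; ring
      simp only [ht]
      rw [hq]
      linear_combination (pv (C.d i * r) (C.d i * r) *
        pv ((m + 1 : ℕ) * (C.p i * C.p l)) (-(C.d i * (b - 1) * (m + 1 : ℕ)))) * hc -
        serreCoef C i l m * qint (C.d i) (r + 1) * hpv
  have h := hpart b le_rfl
  rw [Nat.sub_self, qint_zero, mul_zero, zero_mul] at h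
  exact (isUnit_qint (C.d_pos i) (serreDeg_pos hil)).mul_right_eq_zero.mp h

/-- The Serre elements are killed by all skew derivations. -/
theorem skewDer_serre (k : I) {i l : I} (hil : i ≠ l) :
    skewDer C k (serre C i l (θ i) (θ l)) = 0 := by
  classical
  by_cases hki : k = i
  · subst hki
    exact skewDer_serre_self hil
  rw [serre_eq, map_sum]
  by_cases hkl : k = l
  · subst hkl
    set b := serreDeg C i k with hb
    have hterm : ∀ m ∈ Finset.range (b + 1),
        skewDer C k (serreCoef C i k m • (θ i ^ (b - m) * θ k * θ i ^ m)) =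
        (serreCoef C i k m * pv (m * (C.p i * C.p k)) (-(C.d i * (b - 1) * m))) •
          (pv (b * (C.p i * C.p k)) (C.d i * (b - 1) * b) • θ i ^ b) := by
      intro m hm
      obtain ⟨r, hr⟩ : ∃ r, b = r + m := ⟨b - m, by have := Finset.mem_range.mp hm; omega⟩
      have e : b - m = r := by omega
      rw [map_smul, mul_assoc, skewDer_mul, skewDer_pow_of_ne hki, twistNeg_pow, skewDer_ι_mul,
        if_pos rfl, skewDer_pow_of_ne hki, mul_zero, smul_zero, add_zero, zero_mul, zero_add,
        smul_mul_assoc, ← pow_add, e, ← hr, smul_smul, smul_smul, mul_assoc, pv_mul]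
      congr 2
      have hr' : (b : ℤ) = r + m := by exact_mod_cast hr
      refine pv_congr ⟨-(m * (C.p i * C.p k)), ?_⟩ ?_
      · rw [hr']; ring
      · rw [C.form_symm, form_eq_serreDeg hil, ← hb, hr']; ring
    rw [Finset.sum_congr rfl hterm, ← Finset.sum_smul, sum_serreCoef_mul_eq_zero hil, zero_smul]
  · refine Finset.sum_eq_zero fun m _ => ?_
    rw [map_smul, mul_assoc, skewDer_mul, skewDer_pow_of_ne hki, skewDer_ι_mul, if_neg hkl,
      skewDer_pow_of_ne hki]
    simp

theorem counit_serre (i l : I) :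
    FreeAlgebra.algebraMapInv (serre C i l (θ i) (θ l) : FreeAlgebra QvPi I) = 0 := by
  rw [map_serre, counit_ι, counit_ι, serre_eq]
  simp

/-- The Serre elements lie in the radical of the form. -/
theorem fForm_serre {i l : I} (hil : i ≠ l) (x : FreeAlgebra QvPi I) :
    fForm C x (serre C i l (θ i) (θ l)) = 0 := by
  induction x using free_induction_left with
  | h1 => rw [fForm_one, counit_serre]
  | hm i x hx => rw [fForm_ι_mul, skewDer_serre _ hil, map_zero, mul_zero]
  | ha x y hx hy => rw [map_add, LinearMap.add_apply, hx, hy, add_zero]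
  | hs r x hx => rw [map_smul, LinearMap.smul_apply, hx, smul_zero]

/-- Reversing the order of the factors multiplies a Serre expression by a sign. -/
theorem serre_op_eq {A : Type*} [Ring A] [Algebra QvPi A] {i l : I} (hil : i ≠ l) :
    ∃ u : QvPi, ∀ x y : A,
      serre C i l (MulOpposite.op x) (MulOpposite.op y) = u • MulOpposite.op (serre C i l x y) := by
  set b := serreDeg C i l with hb
  have hbodd : C.p i = 1 → Odd b := by
    intro hp
    obtain ⟨r, hr⟩ := C.anisotropic i l hp
    have h2 := C.a_nonpos i l hil
    have h3 := cast_serreDeg (C := C) hil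
    exact ⟨(-r).toNat, by omega⟩
  refine ⟨(-1) ^ b * pv (b.choose 2 * C.p i + b * C.p i * C.p l) 0, fun x y => ?_⟩
  simp only [serre_eq, ← hb, Finset.op_sum, MulOpposite.op_smul, Finset.smul_sum]
  rw [← Finset.sum_range_reflect]
  refine Finset.sum_congr rfl fun k hk => ?_
  obtain ⟨m, hm⟩ : ∃ m, b = m + k := ⟨b - k, by have := Finset.mem_range.mp hk; omega⟩
  have e1 : b + 1 - 1 - k = m := by omega
  have e2 : b - m = k := by omega
  have e3 : b - k = m := by omega
  rw [e1, e2, e3, ← MulOpposite.op_pow, ← MulOpposite.op_pow, ← MulOpposite.op_mul,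
    ← MulOpposite.op_mul, ← mul_assoc, smul_smul]
  congr 1
  have hq : qbinom (C.d i) b m = qbinom (C.d i) b k := by
    rw [qbinom, qbinom, e2, e3, mul_comm (qfact _ m)]
  have hs : ((-1 : QvPi)) ^ b * (-1) ^ k = (-1) ^ m := by
    rw [hm, pow_add, mul_assoc, ← pow_add, ← two_mul, pow_mul]
    simp
  have hp : pv (b.choose 2 * C.p i + b * C.p i * C.p l) 0 *
      pv (k.choose 2 * C.p i + k * C.p i * C.p l) 0 =
      pv (m.choose 2 * C.p i + m * C.p i * C.p l) 0 := by
    rw [pv_mul]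
    refine pv_congr ?_ rfl
    rw [hm, choose_two_add]
    have h2 := C.p_lt_two i
    rcases Nat.lt_or_ge (C.p i) 1 with h | h
    · have h0 : C.p i = 0 := by omega
      simp [h0]
    · have h1 : C.p i = 1 := by omega
      -- As `m + k` is odd, one of `m` and `k` is even.
      have hmk : Even (m * k) := by
        have h3 := hbodd h1
        rw [hm] at h3
        rcases Nat.even_or_odd k with hk | hk
        · exact hk.mul_left _
        · rcases Nat.even_or_odd m with hm' | hm'
          · exact hm'.mul_right _
          · exact absurd h3 (Nat.not_odd_iff_even.mpr (hm'.add_odd hk))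
      obtain ⟨r, hr⟩ := hmk
      refine ⟨k.choose 2 + r + k * C.p l, ?_⟩
      have hr' : (m : ℤ) * k = r + r := by exact_mod_cast hr
      rw [h1]
      push_cast
      linear_combination hr'
  simp only [serreCoef, ← hb]
  rw [hq, ← hs, ← hp]
  ring

theorem rev_serre {i l : I} (hil : i ≠ l) : ∃ u : QvPi,
    rev (serre C i l (θ i) (θ l)) = u • serre C i l (θ i) (θ l) := by
  obtain ⟨u, hu⟩ := serre_op_eq (C := C) (A := FreeAlgebra QvPi I) hil
  refine ⟨u, ?_⟩
  simp only [rev, LinearMap.comp_apply, AlgHom.toLinearMap_apply, map_serre,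
    FreeAlgebra.lift_ι_apply, hu]
  simp

theorem skewDerR_serre (k : I) {i l : I} (hil : i ≠ l) :
    skewDerR C k (serre C i l (θ i) (θ l)) = 0 := by
  obtain ⟨u, hu⟩ := rev_serre (C := C) hil
  rw [skewDerR, LinearMap.comp_apply, LinearMap.comp_apply, hu, map_smul, skewDer_serre k hil,
    smul_zero, map_zero]

end SerreElements

/-! ### A module for `U` on two copies of the half -/

section Radical

variable (C : CartanDatum I)

/-- The radical of the form on the free algebra. -/
def rad : Submodule QvPi (FreeAlgebra QvPi I) := LinearMap.ker (fForm C)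

variable {C}

theorem mem_rad {x : FreeAlgebra QvPi I} : x ∈ rad C ↔ ∀ y, fForm C x y = 0 := by
  rw [rad, LinearMap.mem_ker]
  exact ⟨fun h y => by rw [h]; rfl, fun h => LinearMap.ext h⟩

theorem ι_mul_mem_rad (i : I) {x : FreeAlgebra QvPi I} (hx : x ∈ rad C) : θ i * x ∈ rad C := by
  rw [mem_rad] at hx ⊢
  intro y
  rw [fForm_ι_mul, hx, mul_zero]

theorem mul_ι_mem_rad (i : I) {x : FreeAlgebra QvPi I} (hx : x ∈ rad C) : x * θ i ∈ rad C := by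
  rw [mem_rad] at hx ⊢
  intro y
  rw [fForm_mul_ι, hx, mul_zero]

theorem mul_mem_rad_left (y : FreeAlgebra QvPi I) {x : FreeAlgebra QvPi I} (hx : x ∈ rad C) :
    y * x ∈ rad C := by
  induction y using free_induction_left with
  | h1 => rwa [one_mul]
  | hm i y hy => rw [mul_assoc]; exact ι_mul_mem_rad i hy
  | ha y z hy hz => rw [add_mul]; exact add_mem hy hz
  | hs r y hy => rw [smul_mul_assoc]; exact Submodule.smul_mem _ _ hy

theorem mul_mem_rad_right (y : FreeAlgebra QvPi I) {x : FreeAlgebra QvPi I} (hx : x ∈ rad C) :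
    x * y ∈ rad C := by
  induction y using free_induction_right with
  | h1 => rwa [mul_one]
  | hm i y hy => rw [← mul_assoc]; exact mul_ι_mem_rad i hy
  | ha y z hy hz => rw [mul_add]; exact add_mem hy hz
  | hs r y hy => rw [mul_smul_comm]; exact Submodule.smul_mem _ _ hy

theorem scal_mem_rad (χ : I → QvPi) {x : FreeAlgebra QvPi I} (hx : x ∈ rad C) :
    scal χ x ∈ rad C := by
  rw [mem_rad] at hx ⊢
  intro y
  rw [fForm_scal, hx]

theorem skewDer_mem_rad (i : I) {x : FreeAlgebra QvPi I} (hx : x ∈ rad C) :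
    skewDer C i x ∈ rad C := by
  rw [mem_rad] at hx ⊢
  intro y
  have h := fForm_mul_left_right C i x y
  rw [hx] at h
  exact (isUnit_normSq C i).mul_right_eq_zero.mp h.symm

theorem skewDerR_mem_rad (i : I) {x : FreeAlgebra QvPi I} (hx : x ∈ rad C) :
    skewDerR C i x ∈ rad C := by
  rw [mem_rad] at hx ⊢
  intro y
  have h := fForm_mul_ι C i y x
  rw [fForm_symm, hx] at h
  rw [fForm_symm]
  exact (isUnit_normSq C i).mul_right_eq_zero.mp h.symm

theorem serre_mem_rad {i l : I} (hil : i ≠ l) : serre C i l (θ i) (θ l) ∈ rad C := by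
  rw [mem_rad]
  intro y
  rw [fForm_symm, fForm_serre hil]

end Radical

section Fock

open TensorProduct

variable (C : CartanDatum I)

/-- The quotient of the free algebra by the radical of the form. It stands in for the quotient `f`
by the Serre relations, which lie in the radical; a comparison of the two is not needed. -/
def Half := FreeAlgebra QvPi I ⧸ rad C

instance : AddCommGroup (Half C) := inferInstanceAs (AddCommGroup (FreeAlgebra QvPi I ⧸ rad C))
instance : Module QvPi (Half C) := inferInstanceAs (Module QvPi (FreeAlgebra QvPi I ⧸ rad C))

/-- The projection of the free algebra onto the half. -/
def toHalf : FreeAlgebra QvPi I →ₗ[QvPi] Half C := (rad C).mkQ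

theorem toHalf_surjective : Function.Surjective (toHalf C) := (rad C).mkQ_surjective

theorem toHalf_eq_zero {C : CartanDatum I} {x : FreeAlgebra QvPi I} (hx : x ∈ rad C) :
    toHalf C x = 0 := (Submodule.Quotient.mk_eq_zero _).2 hx

/-- The linear map from the half induced by a linear map from the free algebra. -/
def halfLift {M : Type*} [AddCommGroup M] [Module QvPi M] (g : FreeAlgebra QvPi I →ₗ[QvPi] M)
    (hg : ∀ x ∈ rad C, g x = 0) : Half C →ₗ[QvPi] M :=
  (rad C).liftQ g fun x hx => LinearMap.mem_ker.mpr (hg x hx)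

theorem halfLift_toHalf {M : Type*} [AddCommGroup M] [Module QvPi M]
    (g : FreeAlgebra QvPi I →ₗ[QvPi] M) (hg : ∀ x ∈ rad C, g x = 0) (x : FreeAlgebra QvPi I) :
    halfLift C g hg (toHalf C x) = g x := rfl

/-- The operator on the half that is induced by an operator on the free algebra. -/
def halfMap (g : FreeAlgebra QvPi I →ₗ[QvPi] FreeAlgebra QvPi I) (hg : ∀ x ∈ rad C, g x ∈ rad C) :
    Half C →ₗ[QvPi] Half C := (rad C).mapQ (rad C) g hg

/-- The sum of copies of the tensor square of the half, indexed by the weights `μ`. -/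
def Fock (X : Type*) := X →₀ (Half C ⊗[QvPi] Half C)

variable {X : Type*}

instance : AddCommGroup (Fock C X) := inferInstanceAs (AddCommGroup (X →₀ (Half C ⊗[QvPi] Half C)))
instance : Module QvPi (Fock C X) := inferInstanceAs (Module QvPi (X →₀ (Half C ⊗[QvPi] Half C)))

/-- The inclusion of the component of weight `μ`. -/
def fockSingle (μ : X) : Half C ⊗[QvPi] Half C →ₗ[QvPi] Fock C X := Finsupp.lsingle μ

/-- The vector `x ⊗ y` of weight `μ`. In the action of the modified form it is
`τ₁(x⁻) y⁻ (1 ⊗ 1)`. -/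
def elt (μ : X) : FreeAlgebra QvPi I →ₗ[QvPi] FreeAlgebra QvPi I →ₗ[QvPi] Fock C X :=
  ((TensorProduct.mk QvPi (Half C) (Half C)).compl₁₂ (toHalf C) (toHalf C)).compr₂
    (fockSingle C μ)

theorem elt_apply (μ : X) (x y : FreeAlgebra QvPi I) :
    elt C μ x y = fockSingle C μ (toHalf C x ⊗ₜ[QvPi] toHalf C y) := rfl

variable {C}

theorem elt_left_eq_zero (μ : X) {x : FreeAlgebra QvPi I} (hx : x ∈ rad C)
    (y : FreeAlgebra QvPi I) : elt C μ x y = 0 := by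
  rw [elt_apply, toHalf_eq_zero hx, TensorProduct.zero_tmul, map_zero]

theorem elt_right_eq_zero (μ : X) {y : FreeAlgebra QvPi I} (hy : y ∈ rad C)
    (x : FreeAlgebra QvPi I) : elt C μ x y = 0 := by
  rw [elt_apply, toHalf_eq_zero hy, TensorProduct.tmul_zero, map_zero]

theorem fock_ext {M : Type*} [AddCommGroup M] [Module QvPi M] {g g' : Fock C X →ₗ[QvPi] M}
    (h : ∀ μ x y, g (elt C μ x y) = g' (elt C μ x y)) : g = g' := by
  refine Finsupp.lhom_ext' fun μ => TensorProduct.ext' fun x y => ?_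
  obtain ⟨x, rfl⟩ := toHalf_surjective C x
  obtain ⟨y, rfl⟩ := toHalf_surjective C y
  exact h μ x y

/-- The linear map on the sum of the components given by linear maps on the components. -/
def fockLift {M : Type*} [AddCommGroup M] [Module QvPi M]
    (g : X → Half C ⊗[QvPi] Half C →ₗ[QvPi] M) : Fock C X →ₗ[QvPi] M := Finsupp.lsum QvPi g

theorem fockLift_elt {M : Type*} [AddCommGroup M] [Module QvPi M]
    (g : X → Half C ⊗[QvPi] Half C →ₗ[QvPi] M) (μ : X) (x y : FreeAlgebra QvPi I) :
    fockLift g (elt C μ x y) = g μ (toHalf C x ⊗ₜ[QvPi] toHalf C y) :=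
  Finsupp.lsum_single _ _ _ _

/-- The operator that acts from the component `μ` to the component `s μ` by `g μ`. -/
def shiftOp (s : X → X) (g : X → Half C ⊗[QvPi] Half C →ₗ[QvPi] Half C ⊗[QvPi] Half C) :
    Module.End QvPi (Fock C X) :=
  fockLift fun μ => fockSingle C (s μ) ∘ₗ g μ

theorem shiftOp_elt (s : X → X) (g : X → Half C ⊗[QvPi] Half C →ₗ[QvPi] Half C ⊗[QvPi] Half C)
    (μ : X) (x y : FreeAlgebra QvPi I) : shiftOp s g (elt C μ x y) =
      fockSingle C (s μ) (g μ (toHalf C x ⊗ₜ[QvPi] toHalf C y)) :=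
  fockLift_elt _ _ _ _

variable {Y : Type*} [AddCommGroup Y] [AddCommGroup X] (D : RootDatum C Y X)

/-- The operator by which `τ₁(F_i) = v_i⁻¹ K̃_i E_i` acts. -/
def opH (i : I) : Module.End QvPi (Fock C X) :=
  shiftOp (fun μ => μ + D.root i) fun _ => TensorProduct.map
    (halfMap C (LinearMap.mulRight QvPi (θ i)) fun _ hx => mul_ι_mem_rad i hx) LinearMap.id

/-- The operator by which `E_i` acts. -/
def opE (i : I) : Module.End QvPi (Fock C X) :=
  shiftOp (fun μ => μ + D.root i) fun μ => pv 0 (-C.d i - D.pairing (D.tcor i) μ) •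
    TensorProduct.map
    (halfMap C (LinearMap.mulRight QvPi (θ i)) fun _ hx => mul_ι_mem_rad i hx) LinearMap.id

/-- The scalar `π_i v_i (π_i v_i - v_i⁻¹)⁻¹`. -/
def commCoef (C : CartanDatum I) (i : I) : QvPi :=
  pv (C.d i) (C.d i) * Ring.inverse (pv (C.d i) (C.d i) - pv 0 (-C.d i))

/-- The operator by which `F_i` acts. The first term is the left multiplication by `θ_i` on the
second factor, twisted as it passes the first factor. The other two are forced by the commutator of
`E_i` and `F_i`: the part with `J̃_i K̃_i` gives the term with `r_i`, which depends on the weight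
`μ`, and the part with `K̃_{-i}` gives the term with `{}_i r`. -/
def opF (i : I) : Module.End QvPi (Fock C X) :=
  shiftOp (fun μ => μ - D.root i) fun μ =>
    TensorProduct.map
      (halfMap C (twistPos C i).toLinearMap fun _ hx => scal_mem_rad _ hx)
      (halfMap C (LinearMap.mulLeft QvPi (θ i)) fun _ hx => ι_mul_mem_rad i hx) +
    commCoef C i • TensorProduct.map
      (halfMap C ((twistPos C i).toLinearMap ∘ₗ skewDer C i)
        fun _ hx => scal_mem_rad _ (skewDer_mem_rad i hx)) LinearMap.id -
    (commCoef C i *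
        pv (D.pairing (D.tcor i) μ) (2 * D.pairing (D.tcor i) μ - 4 * C.d i)) •
      TensorProduct.map
        (halfMap C (skewDerR C i) fun _ hx => skewDerR_mem_rad i hx) LinearMap.id

/-- The operator by which `K_ν` acts. -/
def opK (ν : Y) : Module.End QvPi (Fock C X) :=
  shiftOp id fun μ => pv 0 (D.pairing ν μ) • LinearMap.id

/-- The operator by which `J_ν` acts. -/
def opJ (ν : Y) : Module.End QvPi (Fock C X) :=
  shiftOp id fun μ => pv (D.pairing ν μ) 0 • LinearMap.id

@[simp] theorem opH_elt (i : I) (μ : X) (x y : FreeAlgebra QvPi I) :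
    opH D i (elt C μ x y) = elt C (μ + D.root i) (x * θ i) y := by
  rw [opH, shiftOp_elt]
  rfl

@[simp] theorem opE_elt (i : I) (μ : X) (x y : FreeAlgebra QvPi I) :
    opE D i (elt C μ x y) =
      pv 0 (-C.d i - D.pairing (D.tcor i) μ) • elt C (μ + D.root i) (x * θ i) y := by
  rw [opE, shiftOp_elt, LinearMap.smul_apply, map_smul]
  rfl

@[simp] theorem opF_elt (i : I) (μ : X) (x y : FreeAlgebra QvPi I) :
    opF D i (elt C μ x y) =
      elt C (μ - D.root i) (twistPos C i x) (θ i * y) +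
      commCoef C i • elt C (μ - D.root i) (twistPos C i (skewDer C i x)) y -
      (commCoef C i *
        pv (D.pairing (D.tcor i) μ) (2 * D.pairing (D.tcor i) μ - 4 * C.d i)) •
      elt C (μ - D.root i) (skewDerR C i x) y := by
  rw [opF, shiftOp_elt, LinearMap.sub_apply, LinearMap.add_apply, map_sub, map_add,
    LinearMap.smul_apply, LinearMap.smul_apply, map_smul, map_smul]
  rfl

@[simp] theorem opK_elt (ν : Y) (μ : X) (x y : FreeAlgebra QvPi I) :
    opK D ν (elt C μ x y) = pv 0 (D.pairing ν μ) • elt C μ x y := by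
  rw [opK, shiftOp_elt, LinearMap.smul_apply, map_smul]
  rfl

@[simp] theorem opJ_elt (ν : Y) (μ : X) (x y : FreeAlgebra QvPi I) :
    opJ D ν (elt C μ x y) = pv (D.pairing ν μ) 0 • elt C μ x y := by
  rw [opJ, shiftOp_elt, LinearMap.smul_apply, map_smul]
  rfl

theorem twistPos_twistNeg (i : I) (x : FreeAlgebra QvPi I) :
    twistPos C i (twistNeg C i x) = x := by
  induction x using free_induction_left with
  | h1 => simp
  | hm j x hx =>
    rw [map_mul, map_mul, twistNeg_ι, map_smul, twistPos_ι, hx, smul_smul, pv_mul,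
      U.pv_one (by simp) (by simp), one_smul]
  | ha x y hx hy => simp [hx, hy]
  | hs r x hx => simp [hx]

theorem opE_opF (i l : I) [Decidable (l = i)] (μ : X) (x y : FreeAlgebra QvPi I) :
    opE D i (opF D l (elt C μ x y)) - pv (C.p i * C.p l) 0 • opF D l (opE D i (elt C μ x y)) =
      if l = i then Ring.inverse (pv (C.d i) (C.d i) - pv 0 (-C.d i)) •
        (pv (D.pairing (D.tcor i) μ) (D.pairing (D.tcor i) μ) - pv 0 (-D.pairing (D.tcor i) μ)) •
          elt C μ x y else 0 := by
  set m := D.pairing (D.tcor i) μ with hm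
  set n := D.pairing (D.tcor l) μ with hn
  have hidx : μ + D.root i - D.root l = μ - D.root l + D.root i := by abel
  simp only [opF_elt, opE_elt, map_smul, map_add, map_sub, D.pairing_tcor, ← hm, ← hn, hidx,
    map_mul, twistPos_ι, skewDer_mul_ι, skewDerR_mul_ι, LinearMap.add_apply, LinearMap.smul_apply,
    mul_smul_comm]
  have e1 : pv 0 (-C.d i - (m - C.form i l)) =
      pv (C.p i * C.p l) 0 * pv 0 (-C.d i - m) * pv (C.p l * C.p i) (C.form l i) := by
    rw [pv_mul, pv_mul, C.form_symm i l]
    exact pv_congr ⟨-(C.p i * C.p l), by ring⟩ (by ring)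
  have e2 : pv 0 (-C.d i - (m - C.form i l)) * pv n (2 * n - 4 * C.d l) =
      pv (C.p i * C.p l) 0 * pv 0 (-C.d i - m) * pv (C.p l * C.p i) (-C.form l i) *
        pv (n + C.form l i) (2 * (n + C.form l i) - 4 * C.d l) := by
    rw [pv_mul, pv_mul, pv_mul, pv_mul, C.form_symm i l]
    obtain ⟨r, hr⟩ := C.even_form l i
    exact pv_congr ⟨-(C.p i * C.p l) - r, by rw [hr]; ring⟩ (by ring)
  generalize elt C (μ - D.root l + D.root i) (twistPos C l x * θ i) (θ l * y) = A
  generalize elt C (μ - D.root l + D.root i) (twistPos C l (skewDer C l x) * θ i) y = B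
  generalize elt C (μ - D.root l + D.root i) (skewDerR C l x * θ i) y = E
  split_ifs with h
  · subst h
    have hmn : m = n := by rw [hm, hn]
    rw [twistPos_twistNeg, sub_add_cancel]
    generalize elt C μ x y = Z
    have e3 : pv (C.p l * C.p l) 0 * pv 0 (-C.d l - m) * commCoef C l *
        (pv (n + C.form l l) (2 * (n + C.form l l) - 4 * C.d l) - 1) =
        Ring.inverse (pv (C.d l) (C.d l) - pv 0 (-C.d l)) * (pv m m - pv 0 (-m)) := by
      rw [U.pv_p_mul_self, commCoef]
      have h1 : pv (C.d l) 0 * pv 0 (-C.d l - m) * pv (C.d l) (C.d l) *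
          pv (n + C.form l l) (2 * (n + C.form l l) - 4 * C.d l) = pv m m := by
        rw [pv_mul, pv_mul, pv_mul, ← hmn, C.form_self]
        exact pv_congr ⟨2 * C.d l, by ring⟩ (by ring)
      have h2 : pv (C.d l) 0 * pv 0 (-C.d l - m) * pv (C.d l) (C.d l) = pv 0 (-m) := by
        rw [pv_mul, pv_mul]
        exact pv_congr ⟨C.d l, by ring⟩ (by ring)
      linear_combination Ring.inverse (pv (C.d l) (C.d l) - pv 0 (-C.d l)) * (h1 - h2)
    linear_combination (norm := module) e1 • A + (commCoef C l * e1) • B - (commCoef C l * e2) • E +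
      e3 • Z
  · simp only [map_zero, LinearMap.zero_apply]
    linear_combination (norm := module) e1 • A + (commCoef C l * e1) • B - (commCoef C l * e2) • E

end Fock

/-! ### The defining relations for the operators -/

section Commutation

variable (C : CartanDatum I) {A : Type*} [Ring A] [Algebra QvPi A]

/-- The commutation of `E_j` with a polynomial in the `F_i`, in any algebra with the relations
between `E_j`, the `F_i`, and the Cartan part. -/
theorem commute_lift (j : I) {e kk km : A} {f : I → A} {γ : QvPi}
    (hne : ∀ l, l ≠ j → e * f l = pv (C.p j * C.p l) 0 • (f l * e))
    (hself : e * f j = pv (C.p j * C.p j) 0 • (f j * e) + γ • (kk - km))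
    (hkk : ∀ l, f l * kk = pv 0 (C.form j l) • (kk * f l))
    (hkm : ∀ l, f l * km = pv 0 (-C.form j l) • (km * f l)) (s : FreeAlgebra QvPi I) :
    e * FreeAlgebra.lift QvPi f s =
      FreeAlgebra.lift QvPi f (scal (fun l => pv (C.p j * C.p l) 0) s) * e +
      γ • (kk * FreeAlgebra.lift QvPi f (twistPos C j (skewDerR C j s)) -
        km * FreeAlgebra.lift QvPi f (skewDer C j s)) := by
  classical
  induction s using free_induction_left with
  | h1 => simp [skewDer_one, skewDerR_one]
  | hm l s ih =>
    have h : e * f l = pv (C.p j * C.p l) 0 • (f l * e) +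
        if j = l then γ • (kk - km) else 0 := by
      split_ifs with h
      · rw [← h, hself]
      · rw [hne l (Ne.symm h), add_zero]
    have h1 : ∀ z, f l * (kk * z) = pv 0 (C.form j l) • (kk * (f l * z)) := fun z => by
      rw [← mul_assoc, hkk, smul_mul_assoc, mul_assoc]
    have h2 : ∀ z, f l * (km * z) = pv 0 (-C.form j l) • (km * (f l * z)) := fun z => by
      rw [← mul_assoc, hkm, smul_mul_assoc, mul_assoc]
    have h3 : twistPos C j (if j = l then twistNeg C j s else 0) = if j = l then s else 0 := by
      split_ifs
      · rw [twistPos_twistNeg]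
      · rw [map_zero]
    rw [map_mul, FreeAlgebra.lift_ι_apply, ← mul_assoc, h, add_mul, smul_mul_assoc, mul_assoc, ih,
      skewDer_ι_mul, skewDerR_ι_mul, map_add (twistPos C j), h3]
    have h4 : pv (C.p j * C.p l) (C.form j l) = pv (C.p j * C.p l) 0 * pv 0 (C.form j l) := by
      rw [pv_mul, add_zero, zero_add]
    have h5 : pv (C.p j * C.p l) (-C.form j l) = pv (C.p j * C.p l) 0 * pv 0 (-C.form j l) := by
      rw [pv_mul, add_zero, zero_add]
    simp only [map_mul, map_add, map_smul, scal_ι, twistPos_ι, smul_mul_assoc, mul_smul_comm,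
      FreeAlgebra.lift_ι_apply, mul_add, mul_sub, h1, h2, smul_add, smul_sub, smul_smul, mul_assoc,
      h4, h5]
    split_ifs
    · simp only [sub_mul, smul_mul_assoc]
      module
    · rw [zero_mul, map_zero, mul_zero, mul_zero]
      module
  | ha x y hx hy =>
    simp only [map_add, mul_add, add_mul, hx, hy]
    module
  | hs r x hx =>
    simp only [map_smul, mul_smul_comm, smul_mul_assoc, hx]
    module

end Commutation

section FockRelations

variable {C : CartanDatum I} {X Y : Type*} [AddCommGroup Y] [AddCommGroup X] (D : RootDatum C Y X)

theorem opE_eq (i : I) :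
    opE D i = pv 0 (C.d i) • (opK D (-D.tcor i) * opH D i) := by
  refine fock_ext fun μ x y => ?_
  rw [LinearMap.smul_apply, Module.End.mul_apply, opH_elt, opK_elt, opE_elt, smul_smul, pv_mul]
  congr 2
  rw [map_neg, LinearMap.neg_apply, map_add, D.pairing_tcor, C.form_self]
  ring

theorem opH_opK (i : I) (ν : Y) : opH D i * opK D ν =
    pv 0 (-D.pairing ν (D.root i)) • (opK D ν * opH D i) := by
  refine fock_ext fun μ x y => ?_
  simp only [LinearMap.smul_apply, Module.End.mul_apply, opH_elt, opK_elt, map_smul, smul_smul,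
    pv_mul, map_add]
  congr 2
  ring

theorem opH_pow_elt (i : I) (n : ℕ) (μ : X) (x y : FreeAlgebra QvPi I) :
    (opH D i ^ n) (elt C μ x y) = elt C (μ + n • D.root i) (x * θ i ^ n) y := by
  induction n with
  | zero => simp
  | succ n ih =>
    rw [pow_succ', Module.End.mul_apply, ih, opH_elt, succ_nsmul, pow_succ, add_assoc, mul_assoc]

theorem rev_pow (x : FreeAlgebra QvPi I) (n : ℕ) : rev (x ^ n) = rev x ^ n := by
  induction n with
  | zero => simp
  | succ n ih => rw [pow_succ, rev_mul, ih, ← pow_succ']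

theorem serre_opH {i l : I} (hil : i ≠ l) : serre C i l (opH D i) (opH D l) = 0 := by
  refine fock_ext fun μ x y => ?_
  obtain ⟨u, hu⟩ := rev_serre (C := C) hil
  have h : serre C i l (opH D i) (opH D l) (elt C μ x y) =
      elt C (μ + serreDeg C i l • D.root i + D.root l)
        (x * rev (serre C i l (θ i) (θ l))) y := by
    rw [serre_eq, serre_eq, LinearMap.sum_apply, map_sum, Finset.mul_sum, map_sum,
      LinearMap.sum_apply]
    refine Finset.sum_congr rfl fun k hk => ?_
    obtain ⟨m, hm⟩ : ∃ m, serreDeg C i l = m + k :=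
      ⟨serreDeg C i l - k, by have := Finset.mem_range.mp hk; omega⟩
    have e : serreDeg C i l - k = m := by omega
    rw [e, LinearMap.smul_apply, Module.End.mul_apply, Module.End.mul_apply, opH_pow_elt, opH_elt,
      opH_pow_elt, map_smul, rev_mul, rev_mul, rev_pow, rev_pow, rev_ι, rev_ι, mul_smul_comm,
      map_smul, LinearMap.smul_apply, hm, add_smul]
    congr 3
    · congr 1
      abel
    · simp only [mul_assoc]
  rw [h, hu, LinearMap.zero_apply]
  exact elt_left_eq_zero _ (mul_mem_rad_left _ (Submodule.smul_mem _ _ (serre_mem_rad hil))) _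

theorem opF_elt_one (i : I) (μ : X) (y : FreeAlgebra QvPi I) :
    opF D i (elt C μ 1 y) = elt C (μ - D.root i) 1 (θ i * y) := by
  simp [skewDer_one, skewDerR_one]

theorem opF_pow_elt_one (i : I) (n : ℕ) (μ : X) (y : FreeAlgebra QvPi I) :
    (opF D i ^ n) (elt C μ 1 y) = elt C (μ - n • D.root i) 1 (θ i ^ n * y) := by
  induction n with
  | zero => simp
  | succ n ih =>
    rw [pow_succ', Module.End.mul_apply, ih, opF_elt_one, succ_nsmul, pow_succ', sub_sub, mul_assoc]

/-- On the vectors `1 ⊗ y` the operators `F_i` are left multiplications, with no correction terms.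
-/
theorem serre_opF_elt_one {i l : I} (hil : i ≠ l) (μ : X) (y : FreeAlgebra QvPi I) :
    serre C i l (opF D i) (opF D l) (elt C μ 1 y) = 0 := by
  have h : serre C i l (opF D i) (opF D l) (elt C μ 1 y) =
      elt C (μ - serreDeg C i l • D.root i - D.root l) 1 (serre C i l (θ i) (θ l) * y) := by
    rw [serre_eq, serre_eq, LinearMap.sum_apply, Finset.sum_mul, map_sum]
    refine Finset.sum_congr rfl fun k hk => ?_
    obtain ⟨m, hm⟩ : ∃ m, serreDeg C i l = m + k :=
      ⟨serreDeg C i l - k, by have := Finset.mem_range.mp hk; omega⟩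
    have e : serreDeg C i l - k = m := by omega
    rw [e, LinearMap.smul_apply, Module.End.mul_apply, Module.End.mul_apply, opF_pow_elt_one,
      opF_elt_one, opF_pow_elt_one, smul_mul_assoc, map_smul, hm, add_smul]
    congr 2
    · congr 2
      abel
    · simp only [mul_assoc]
  rw [h]
  exact elt_right_eq_zero _ (mul_mem_rad_right _ (serre_mem_rad hil)) _

theorem opE_opF_self (i : I) : opE D i * opF D i =
    pv (C.p i * C.p i) 0 • (opF D i * opE D i) +
      Ring.inverse (pv (C.d i) (C.d i) - pv 0 (-C.d i)) •
        (opJ D (D.tcor i) * opK D (D.tcor i) - opK D (-D.tcor i)) := by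
  classical
  rw [← sub_eq_iff_eq_add']
  refine fock_ext fun μ x y => ?_
  have h := opE_opF D i i μ x y
  rw [if_pos rfl] at h
  simp only [LinearMap.smul_apply, LinearMap.sub_apply, Module.End.mul_apply, h, opK_elt, opJ_elt,
    map_smul, smul_smul, pv_mul, sub_smul]
  simp

theorem opE_opF_of_ne {i l : I} (h : l ≠ i) : opE D i * opF D l =
    pv (C.p i * C.p l) 0 • (opF D l * opE D i) := by
  classical
  rw [← sub_eq_zero]
  refine fock_ext fun μ x y => ?_
  have h1 := opE_opF D i l μ x y
  rwa [if_neg h] at h1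

theorem opF_opK (i : I) (ν : Y) : opF D i * opK D ν =
    pv 0 (D.pairing ν (D.root i)) • (opK D ν * opF D i) := by
  refine fock_ext fun μ x y => ?_
  simp only [LinearMap.smul_apply, Module.End.mul_apply, opK_elt, opF_elt, map_smul, map_sub,
    map_add, smul_smul, smul_sub, smul_add, ← mul_assoc]
  have e : pv 0 (D.pairing ν μ) =
      pv 0 (D.pairing ν (D.root i)) * pv 0 (D.pairing ν μ - D.pairing ν (D.root i)) := by
    rw [pv_mul]
    congr 1
    ring
  rw [e]
  module

theorem opF_opJ (i : I) (ν : Y) : opF D i * opJ D ν =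
    pv (D.pairing ν (D.root i)) 0 • (opJ D ν * opF D i) := by
  refine fock_ext fun μ x y => ?_
  simp only [LinearMap.smul_apply, Module.End.mul_apply, opJ_elt, opF_elt, map_smul, map_sub,
    map_add, smul_smul, smul_sub, smul_add, ← mul_assoc]
  have e : pv (D.pairing ν μ) 0 =
      pv (D.pairing ν (D.root i)) 0 * pv (D.pairing ν μ - D.pairing ν (D.root i)) 0 := by
    rw [pv_mul]
    exact pv_congr ⟨0, by ring⟩ rfl
  rw [e]
  module

theorem opE_opK (i : I) (ν : Y) : opE D i * opK D ν =
    pv 0 (-D.pairing ν (D.root i)) • (opK D ν * opE D i) := by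
  refine fock_ext fun μ x y => ?_
  simp only [LinearMap.smul_apply, Module.End.mul_apply, opE_elt, opK_elt, map_smul, smul_smul,
    pv_mul, map_add]
  congr 2
  ring

theorem opE_opJ (i : I) (ν : Y) : opE D i * opJ D ν =
    pv (-D.pairing ν (D.root i)) 0 • (opJ D ν * opE D i) := by
  refine fock_ext fun μ x y => ?_
  simp only [LinearMap.smul_apply, Module.End.mul_apply, opE_elt, opJ_elt, map_smul, smul_smul,
    pv_mul, map_add]
  congr 1
  exact pv_congr ⟨0, by ring⟩ (by ring)

/-- By the commutation formula the commutator of `E_j` and a Serre element in the `F_i` is made of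
skew derivatives of the Serre element, which vanish. -/
theorem opE_serre_opF (j : I) {i l : I} (hil : i ≠ l) : ∃ c : QvPi, IsUnit c ∧
    opE D j * serre C i l (opF D i) (opF D l) =
      c • (serre C i l (opF D i) (opF D l) * opE D j) := by
  have h := commute_lift C j (e := opE D j) (f := opF D)
    (kk := opJ D (D.tcor j) * opK D (D.tcor j)) (km := opK D (-D.tcor j))
    (fun l hl => opE_opF_of_ne D hl) (opE_opF_self D j)
    (fun l => by
      rw [← mul_assoc, opF_opJ, smul_mul_assoc, mul_assoc, opF_opK, mul_smul_comm, smul_smul,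
        mul_assoc, D.pairing_tcor, pv_mul]
      congr 1
      exact pv_congr (by simpa using C.even_form j l) (by ring))
    (fun l => by rw [opF_opK, map_neg, LinearMap.neg_apply, D.pairing_tcor])
    (serre C i l (θ i) (θ l))
  rw [skewDer_serre j hil, skewDerR_serre j hil, map_serre, map_serre, scal_ι, scal_ι, serre_smul,
    map_smul, map_serre, FreeAlgebra.lift_ι_apply, FreeAlgebra.lift_ι_apply] at h
  simp only [map_zero, mul_zero, sub_zero, smul_zero, add_zero, smul_mul_assoc] at h
  exact ⟨_, (((isUnit_pv _ _).pow _).mul (isUnit_pv _ _)), h⟩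

/-- The Serre elements in the `F_i` act by zero: they do so on the vectors `1 ⊗ y`, which generate
the module under the `E_j`, and they commute with the `E_j` up to scalars. -/
theorem serre_opF {i l : I} (hil : i ≠ l) : serre C i l (opF D i) (opF D l) = 0 := by
  refine fock_ext fun μ x y => ?_
  rw [LinearMap.zero_apply]
  induction x using free_induction_right generalizing μ with
  | h1 => exact serre_opF_elt_one D hil μ y
  | hm j x hx =>
    obtain ⟨c, hc, h⟩ := opE_serre_opF D j hil
    have h1 := LinearMap.congr_fun h (elt C (μ - D.root j) x y)
    rw [LinearMap.smul_apply, Module.End.mul_apply, Module.End.mul_apply, hx, map_zero, opE_elt,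
      map_smul, smul_smul, sub_add_cancel] at h1
    have h2 := hc.mul (isUnit_pv 0 (-C.d j - D.pairing (D.tcor j) (μ - D.root j)))
    exact (h2.smul_eq_zero).mp h1.symm
  | ha x z hx hz => rw [map_add, LinearMap.add_apply, map_add, hx, hz, add_zero]
  | hs r x hx => rw [map_smul, LinearMap.smul_apply, map_smul, hx, smul_zero]

theorem fock_relations : Relations D (opE D) (opF D) (opK D) (opJ D) where
  J_mul μ ν := fock_ext fun η x y => by
    simp only [Module.End.mul_apply, opJ_elt, map_smul, smul_smul, pv_mul, map_add,
      LinearMap.add_apply]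
    congr 2
    ring
  K_mul μ ν := fock_ext fun η x y => by
    simp only [Module.End.mul_apply, opK_elt, map_smul, smul_smul, pv_mul, map_add,
      LinearMap.add_apply]
    congr 2
    ring
  K_zero := fock_ext fun η x y => by simp [pv_zero]
  J_zero := fock_ext fun η x y => by simp [pv_zero]
  J_sq ν := fock_ext fun η x y => by
    simp only [Module.End.mul_apply, opJ_elt, map_smul, smul_smul, U.pv_add_self, pv_mul, add_zero,
      one_smul, Module.End.one_apply]
  J_K μ ν := fock_ext fun η x y => by
    simp only [Module.End.mul_apply, opJ_elt, opK_elt, map_smul, smul_smul, mul_comm]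
  J_E μ i := by
    rw [opE_opJ, smul_smul, pv_mul, U.pv_one (by simp) (by simp), one_smul]
  J_F μ i := by
    rw [opF_opJ, smul_smul, pv_mul, U.pv_one (by simp) (by simp), one_smul]
  K_E μ i := by
    rw [opE_opK, smul_smul, pv_mul, U.pv_one (by simp) (by simp), one_smul]
  K_F μ i := by
    rw [opF_opK, smul_smul, pv_mul, U.pv_one (by simp) (by simp), one_smul]
  E_F i := by rw [opE_opF_self, add_sub_cancel_left]
  E_F_ne i l h := by rw [opE_opF_of_ne D h.symm, sub_self]
  serre_E i l hil := by
    rw [opE_eq, opE_eq]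
    refine serre_twist (α := pv 0 (C.form i i)) (β := pv 0 (C.form l i)) i l ?_ ?_ ?_ ?_
      (serre_opH D hil)
    · rw [opH_opK, map_neg, LinearMap.neg_apply, D.pairing_tcor, neg_neg]
    · rw [opH_opK, map_neg, LinearMap.neg_apply, D.pairing_tcor, neg_neg]
    · rw [opH_opK, map_neg, LinearMap.neg_apply, D.pairing_tcor, neg_neg, C.form_symm]
    · refine fock_ext fun η x y => ?_
      simp only [Module.End.mul_apply, opK_elt, map_smul, smul_smul, mul_comm]
  serre_F i l hil := serre_opF D hil

end FockRelations

/-! ### The action of the modified form -/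

section Action

variable {C : CartanDatum I} {X Y : Type*} [AddCommGroup Y] [AddCommGroup X] (D : RootDatum C Y X)

open TensorProduct

/-- The projection onto the component of weight `l`. -/
def opIdem (C : CartanDatum I) (l : X) : Module.End QvPi (Fock C X) :=
  letI := Classical.decEq X
  shiftOp id fun μ => if μ = l then LinearMap.id else 0

omit [AddCommGroup X] in
theorem opIdem_elt (l μ : X) [Decidable (μ = l)] (x y : FreeAlgebra QvPi I) :
    opIdem C l (elt C μ x y) = if μ = l then elt C μ x y else 0 := by
  rw [opIdem, shiftOp_elt]
  split_ifs
  · rfl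
  · rw [LinearMap.zero_apply, map_zero]

/-- The action of `Uhat` on the sum of copies of the tensor square of the half. -/
def act : Uhat D →ₐ[QvPi] Module.End QvPi (Fock C X) :=
  Uhat.lift (U.lift (fock_relations D)) (opIdem C)
    (fun l => fock_ext fun μ x y => by
      classical
      rw [Module.End.mul_apply, opIdem_elt]
      split_ifs with h
      · rw [opIdem_elt, if_pos h]
      · rw [map_zero])
    (fun l m h => fock_ext fun μ x y => by
      classical
      rw [Module.End.mul_apply, opIdem_elt]
      split_ifs with h1
      · rw [opIdem_elt, if_neg (fun h2 => h (h2.symm.trans h1)), LinearMap.zero_apply]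
      · rw [map_zero, LinearMap.zero_apply])
    (fun i l => fock_ext fun μ x y => by
      classical
      rw [Module.End.mul_apply, Module.End.mul_apply, U.lift_E, opIdem_elt, opE_elt, map_smul,
        opIdem_elt]
      by_cases h : μ = l
      · rw [if_pos h, if_pos (by rw [h]), opE_elt]
      · rw [if_neg h, if_neg (fun h' => h (add_right_cancel h')), map_zero, smul_zero])
    (fun i l => fock_ext fun μ x y => by
      classical
      rw [Module.End.mul_apply, Module.End.mul_apply, U.lift_F, opIdem_elt, opF_elt, map_sub,
        map_add, map_smul, map_smul]
      simp only [opIdem_elt]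
      by_cases h : μ = l
      · rw [if_pos h, opF_elt, if_pos (by rw [h]), if_pos (by rw [h]), if_pos (by rw [h])]
      · have h' : μ - D.root i ≠ l - D.root i := fun h' => h (sub_left_injective h')
        rw [if_neg h, if_neg h', if_neg h', if_neg h', map_zero, smul_zero, smul_zero, add_zero,
          sub_zero])
    (fun ν l => fock_ext fun μ x y => by
      classical
      rw [Module.End.mul_apply, LinearMap.smul_apply, U.lift_K, opIdem_elt]
      split_ifs with h
      · rw [opK_elt, h]
      · rw [map_zero, smul_zero])
    (fun ν l => fock_ext fun μ x y => by
      classical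
      rw [Module.End.mul_apply, LinearMap.smul_apply, U.lift_K, opK_elt, map_smul, opIdem_elt]
      split_ifs with h
      · rw [h]
      · rw [smul_zero, smul_zero])
    (fun ν l => fock_ext fun μ x y => by
      classical
      rw [Module.End.mul_apply, LinearMap.smul_apply, U.lift_J, opIdem_elt]
      split_ifs with h
      · rw [opJ_elt, h]
      · rw [map_zero, smul_zero])
    (fun ν l => fock_ext fun μ x y => by
      classical
      rw [Module.End.mul_apply, LinearMap.smul_apply, U.lift_J, opJ_elt, map_smul, opIdem_elt]
      split_ifs with h
      · rw [h]
      · rw [smul_zero, smul_zero])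

@[simp] theorem act_E (i : I) : act D (Uhat.incl D (U.E D i)) = opE D i := by simp [act]
@[simp] theorem act_F (i : I) : act D (Uhat.incl D (U.F D i)) = opF D i := by simp [act]
@[simp] theorem act_K (ν : Y) : act D (Uhat.incl D (U.K D ν)) = opK D ν := by simp [act]
@[simp] theorem act_idem (l : X) : act D (Uhat.idem D l) = opIdem C l := by simp [act]

theorem act_tau1_F (i : I) : act D (Uhat.incl D (U.tau1 D (U.F D i))) = opH D i := by
  rw [U.tau1_F, map_smul, map_mul, map_smul, map_mul, act_K, act_E]
  refine fock_ext fun μ x y => ?_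
  rw [LinearMap.smul_apply, Module.End.mul_apply, opE_elt, map_smul, opK_elt, opH_elt, smul_smul,
    smul_smul, pv_mul, pv_mul, map_add, D.pairing_tcor, C.form_self, U.pv_one (by simp) (by ring),
    one_smul]

/-- The form on the half. -/
def halfForm (C : CartanDatum I) : Half C →ₗ[QvPi] Half C →ₗ[QvPi] QvPi :=
  halfLift C (halfLift C (fForm C) fun _ hx => LinearMap.mem_ker.mp hx).flip fun x hx => by
    refine LinearMap.ext fun y => ?_
    obtain ⟨y, rfl⟩ := toHalf_surjective C y
    rw [LinearMap.flip_apply, halfLift_toHalf, fForm_symm]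
    exact mem_rad.mp hx y

theorem halfForm_toHalf (C : CartanDatum I) (x y : FreeAlgebra QvPi I) :
    halfForm C (toHalf C x) (toHalf C y) = fForm C x y := by
  rw [halfForm, halfLift_toHalf, LinearMap.flip_apply, halfLift_toHalf, fForm_symm]

/-- The functional `x ⊗ y ↦ (x, y)`. -/
def phi (C : CartanDatum I) (X : Type*) : Fock C X →ₗ[QvPi] QvPi :=
  fockLift fun _ => TensorProduct.lift (halfForm C)

omit [AddCommGroup X] in
@[simp] theorem phi_elt (μ : X) (x y : FreeAlgebra QvPi I) :
    phi C X (elt C μ x y) = fForm C x y := by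
  rw [phi, fockLift_elt, TensorProduct.lift.tmul, halfForm_toHalf]

theorem normSq_eq_commCoef (i : I) :
    commCoef C i = -(pv (C.d i) (2 * C.d i) * normSq C i) := by
  have h1 := Ring.inverse_mul_cancel _ (isUnit_qden (C.d_pos i))
  have h2 := Ring.inverse_mul_cancel _ (isUnit_one_sub C i)
  have h3 : pv (C.d i) (C.d i) * (1 - pv (C.d i) (2 * C.d i)) =
      -(pv (C.d i) (2 * C.d i) * (pv (C.d i) (C.d i) - pv 0 (-C.d i))) := by
    rw [mul_sub, mul_sub, pv_mul, pv_mul, pv_mul, mul_one]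
    have e : pv (C.d i + 0) (2 * C.d i + -C.d i) = pv (C.d i) (C.d i) :=
      pv_congr ⟨0, by ring⟩ (by ring)
    have e' : pv (C.d i + C.d i) (C.d i + 2 * C.d i) = pv (C.d i + C.d i) (2 * C.d i + C.d i) :=
      pv_congr ⟨0, by ring⟩ (by ring)
    rw [e, e']
    ring
  rw [commCoef, normSq]
  generalize Ring.inverse (pv (C.d i) (C.d i) - pv 0 (-C.d i)) = a at *
  generalize Ring.inverse (1 - pv (C.d i) (2 * C.d i)) = b at *
  linear_combination (a * b) * h3 - pv (C.d i) (C.d i) * a * h2 -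
    pv (C.d i) (2 * C.d i) * b * h1

/-- The functional `phi` intertwines `F_i` with the right multiplication by `θ_i` on the second
factor: in `F_i (x ⊗ y)` the terms with `θ_i y` and with `{}_i r (x)` cancel, as the left
multiplication by `θ_i` is adjoint to `{}_i r`. -/
theorem phi_opF (i : I) (μ : X) (x y : FreeAlgebra QvPi I) :
    phi C X (opF D i (elt C μ x y)) =
      pv (D.pairing (D.tcor i) μ + C.d i) (2 * D.pairing (D.tcor i) μ - 2 * C.d i) *
        fForm C x (y * θ i) := by
  rw [opF_elt, map_sub, map_add, map_smul, map_smul, phi_elt, phi_elt, phi_elt,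
    fForm_mul_left_right, twistPos, skewDer_scal, fForm_symm C x (y * θ i), fForm_mul_ι,
    fForm_symm C y, normSq_eq_commCoef, map_smul, LinearMap.smul_apply, smul_eq_mul, smul_eq_mul,
    smul_eq_mul, U.pv_p_mul_self, C.form_self]
  have e : pv (D.pairing (D.tcor i) μ + C.d i) (2 * D.pairing (D.tcor i) μ - 2 * C.d i) =
      pv (C.d i) (2 * C.d i) *
        pv (D.pairing (D.tcor i) μ) (2 * D.pairing (D.tcor i) μ - 4 * C.d i) := by
    rw [pv_mul]
    exact pv_congr ⟨0, by ring⟩ (by ring)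
  rw [e]
  ring

end Action

/-! ### The anti-automorphism `τ₁` of the modified form -/

section Tau

variable {C : CartanDatum I} {X Y : Type*} [AddCommGroup Y] [AddCommGroup X] (D : RootDatum C Y X)

open MulOpposite in
/-- The anti-automorphism `τ₁` on `Uhat`: it is `τ₁` on `U`, and fixes the `1_λ`. -/
def Uhat.tau1Hom : Uhat D →ₐ[QvPi] (Uhat D)ᵐᵒᵖ :=
  Uhat.lift ((AlgHom.op (Uhat.incl D)).comp (U.tau1Hom D)) (fun l => op (Uhat.idem D l))
    (fun l => by rw [← op_mul, Uhat.idem_mul_self])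
    (fun l m h => by rw [← op_mul, Uhat.idem_mul_ne D h.symm, op_zero])
    (fun i l => by
      apply unop_injective
      simp only [AlgHom.comp_apply, U.tau1Hom, U.lift_E, AlgHom.op_apply_apply, unop_op, unop_mul,
        map_smul, map_mul]
      rw [mul_smul_comm, smul_mul_assoc, mul_assoc, Uhat.F_idem, add_sub_cancel_right, ← mul_assoc,
        ← mul_assoc, Uhat.idem_K, Uhat.K_idem])
    (fun i l => by
      apply unop_injective
      simp only [AlgHom.comp_apply, U.tau1Hom, U.lift_F, AlgHom.op_apply_apply, unop_op, unop_mul,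
        map_smul, map_mul]
      rw [mul_smul_comm, smul_mul_assoc, mul_assoc, Uhat.E_idem, sub_add_cancel, ← mul_assoc,
        ← mul_assoc, Uhat.idem_K, Uhat.K_idem])
    (fun μ l => by
      apply unop_injective
      simp [AlgHom.comp_apply, U.tau1Hom, Uhat.idem_K])
    (fun μ l => by
      apply unop_injective
      simp [AlgHom.comp_apply, U.tau1Hom, Uhat.K_idem])
    (fun μ l => by
      apply unop_injective
      simp [AlgHom.comp_apply, U.tau1Hom, Uhat.idem_J])
    (fun μ l => by
      apply unop_injective
      simp [AlgHom.comp_apply, U.tau1Hom, Uhat.J_idem])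

/-- `τ₁` on `Uhat`, as a linear map. -/
def Uhat.tau1 : Uhat D →ₗ[QvPi] Uhat D :=
  (MulOpposite.opLinearEquiv QvPi).symm.toLinearMap ∘ₗ (Uhat.tau1Hom D).toLinearMap

theorem Uhat.tau1_mul (x y : Uhat D) :
    Uhat.tau1 D (x * y) = Uhat.tau1 D y * Uhat.tau1 D x := by
  simp [Uhat.tau1]

theorem Uhat.tau1_incl (u : U D) : Uhat.tau1 D (Uhat.incl D u) = Uhat.incl D (U.tau1 D u) := by
  simp [Uhat.tau1, Uhat.tau1Hom, U.tau1]

theorem Uhat.tau1_idem (l : X) : Uhat.tau1 D (Uhat.idem D l) = Uhat.idem D l := by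
  simp [Uhat.tau1, Uhat.tau1Hom]

theorem tau1_mem {x : Uhat D} (hx : x ∈ dotSpan D) : Uhat.tau1 D x ∈ dotSpan D := by
  induction hx using Submodule.span_induction with
  | mem x hx =>
    obtain ⟨⟨w, l⟩, rfl⟩ := hx
    simp only
    rw [Uhat.tau1_mul, Uhat.tau1_incl, Uhat.tau1_idem]
    exact idem_mul_incl_mem D _ _
  | zero => simp
  | add x y _ _ hx hy => rw [map_add]; exact add_mem hx hy
  | smul r x _ hx => rw [map_smul]; exact Submodule.smul_mem _ _ hx

theorem U.tau1_algebraMap (r : QvPi) : U.tau1 D (algebraMap QvPi _ r) = algebraMap QvPi _ r := by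
  simp [U.tau1]

theorem U.tau1bar_algebraMap (r : QvPi) :
    U.tau1bar D (algebraMap QvPi _ r) = algebraMap QvPi _ r := by
  simp [U.tau1bar]

theorem U.tau1_tau1 (u : U D) : U.tau1 D (U.tau1 D u) = u := by
  induction u using U.induction with
  | hE i =>
    rw [U.tau1_E, map_smul, U.tau1_mul, U.tau1_F, U.tau1_K, smul_mul_assoc, mul_assoc,
      U.E_Ktn, mul_smul_comm, ← mul_assoc, (U.relations D).K_mul, add_neg_cancel,
      (U.relations D).K_zero, one_mul, smul_smul, smul_smul, pv_mul, pv_mul, C.form_self,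
      U.pv_one (by simp) (by ring), one_smul]
  | hF i =>
    rw [U.tau1_F, map_smul, U.tau1_mul, U.tau1_E, U.tau1_K, smul_mul_assoc, mul_assoc,
      U.F_Kt, mul_smul_comm, ← mul_assoc, (U.relations D).K_mul, neg_add_cancel,
      (U.relations D).K_zero, one_mul, smul_smul, smul_smul, pv_mul, pv_mul, C.form_self,
      U.pv_one (by simp) (by ring), one_smul]
  | hK μ => rw [U.tau1_K, U.tau1_K]
  | hJ μ => rw [U.tau1_J, U.tau1_J]
  | hs r => rw [U.tau1_algebraMap, U.tau1_algebraMap]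
  | ha u w hu hw => rw [map_add, map_add, hu, hw]
  | hm u w hu hw => rw [U.tau1_mul, U.tau1_mul, hu, hw]

theorem Uhat.tau1_tau1 {x : Uhat D} (hx : x ∈ dotSpan D) :
    Uhat.tau1 D (Uhat.tau1 D x) = x := by
  induction hx using Submodule.span_induction with
  | mem x hx =>
    obtain ⟨⟨w, l⟩, rfl⟩ := hx
    simp only
    rw [Uhat.tau1_mul, Uhat.tau1_mul, Uhat.tau1_incl, Uhat.tau1_idem, Uhat.tau1_incl,
      U.tau1_tau1, Uhat.tau1_idem]
  | zero => simp
  | add x y _ _ hx hy => rw [map_add, map_add, hx, hy]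
  | smul r x _ hx => rw [map_smul, map_smul, hx]

namespace dotU

/-- The anti-automorphism `τ₁` of the modified form: `τ₁ (x 1_λ) = 1_λ τ₁(x)`. -/
def tau1 : dotU D →ₗ[QvPi] dotU D where
  toFun x := ⟨Uhat.tau1 D x, (mem_dotU D).2 (tau1_mem D ((mem_dotU D).1 x.2))⟩
  map_add' x y := Subtype.ext (map_add (Uhat.tau1 D) (x : Uhat D) y)
  map_smul' r x := Subtype.ext (map_smul (Uhat.tau1 D) r (x : Uhat D))

theorem tau1_mul (x y : dotU D) : tau1 D (x * y) = tau1 D y * tau1 D x :=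
  Subtype.ext (Uhat.tau1_mul D x y)

theorem tau1_one (l : X) : tau1 D (one D l) = one D l := Subtype.ext (Uhat.tau1_idem D l)

theorem tau1_tau1 (x : dotU D) : tau1 D (tau1 D x) = x :=
  Subtype.ext (Uhat.tau1_tau1 D ((mem_dotU D).1 x.2))

theorem tau1_lact (u : U D) (x : dotU D) :
    tau1 D (lact D u x) = ract D (tau1 D x) (U.tau1 D u) := by
  refine Subtype.ext ?_
  change Uhat.tau1 D (Uhat.incl D u * x) = Uhat.tau1 D x * Uhat.incl D (U.tau1 D u)
  rw [Uhat.tau1_mul, Uhat.tau1_incl]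

theorem tau1_ract (u : U D) (x : dotU D) :
    tau1 D (ract D x u) = lact D (U.tau1 D u) (tau1 D x) := by
  refine Subtype.ext ?_
  change Uhat.tau1 D (x * Uhat.incl D u) = Uhat.incl D (U.tau1 D u) * Uhat.tau1 D x
  rw [Uhat.tau1_mul, Uhat.tau1_incl]

end dotU

end Tau

/-! ### Monomials that span the modified form -/

section Monomials

variable {C : CartanDatum I} {X Y : Type*} [AddCommGroup Y] [AddCommGroup X] (D : RootDatum C Y X)

/-- The weight `∑ i'` of a monomial. -/
def wt (l : List I) : X := (l.map D.root).sum

@[simp] theorem wt_nil : wt D [] = 0 := rfl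

@[simp] theorem wt_cons (i : I) (l : List I) : wt D (i :: l) = D.root i + wt D l := by simp [wt]

variable {D} in
theorem wt_perm {l m : List I} (h : l.Perm m) : wt D l = wt D m := (h.map _).sum_eq

@[simp] theorem minus_ι (i : I) : minus D (θ i) = U.F D i := FreeAlgebra.lift_ι_apply _ _

theorem minus_idem (w : List I) (l : X) : Uhat.incl D (minus D (word w)) * Uhat.idem D l =
    Uhat.idem D (l - wt D w) * Uhat.incl D (minus D (word w)) := by
  induction w with
  | nil => simp
  | cons i w ih =>
    rw [word_cons, map_mul, map_mul, mul_assoc, ih, ← mul_assoc, minus_ι, Uhat.F_idem, wt_cons,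
      mul_assoc]
    congr 2
    abel

theorem tau1_minus_idem (w : List I) (l : X) :
    Uhat.incl D (U.tau1 D (minus D (word w))) * Uhat.idem D l =
      Uhat.idem D (l + wt D w) * Uhat.incl D (U.tau1 D (minus D (word w))) := by
  have h := congrArg (Uhat.tau1 D) (minus_idem D w (l + wt D w))
  rw [add_sub_cancel_right, Uhat.tau1_mul, Uhat.tau1_mul, Uhat.tau1_idem, Uhat.tau1_idem,
    Uhat.tau1_incl] at h
  exact h.symm

/-- The element `τ₁(x⁻) y⁻ 1_λ` of `Uhat`. -/
def hatMon (x y : FreeAlgebra QvPi I) (l : X) : Uhat D :=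
  Uhat.incl D (U.tau1 D (minus D x)) * (Uhat.incl D (minus D y) * Uhat.idem D l)

theorem hatMon_mem (x y : FreeAlgebra QvPi I) (l : X) : hatMon D x y l ∈ dotSpan D :=
  incl_mul_mem D _ (incl_mul_idem_mem D _ _)

theorem hatMon_eq_idem_mul (x y : List I) (l : X) : hatMon D (word x) (word y) l =
    Uhat.idem D (l - wt D y + wt D x) * hatMon D (word x) (word y) l := by
  rw [hatMon, ← mul_assoc (Uhat.idem D _), ← tau1_minus_idem, minus_idem]
  simp only [mul_assoc]
  rw [← mul_assoc (Uhat.idem D _) (Uhat.idem D _), Uhat.idem_mul_self]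

theorem hatMon_mul_idem (x y : FreeAlgebra QvPi I) (l : X) :
    hatMon D x y l * Uhat.idem D l = hatMon D x y l := by
  rw [hatMon, mul_assoc, mul_assoc, Uhat.idem_mul_self]

/-- The span of the elements `τ₁(x⁻) y⁻ 1_λ` for monomials `x` and `y`. -/
def monSpan : Submodule QvPi (Uhat D) :=
  Submodule.span QvPi (Set.range fun a : List I × List I × X =>
    hatMon D (word a.1) (word a.2.1) a.2.2)

theorem hatMon_mem_monSpan (x y : List I) (l : X) :
    hatMon D (word x) (word y) l ∈ monSpan D :=
  Submodule.subset_span ⟨(x, y, l), rfl⟩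

theorem monSpan_induction {u : Uhat D}
    (h : ∀ x y l, u * hatMon D (word x) (word y) l ∈ monSpan D) {z : Uhat D}
    (hz : z ∈ monSpan D) : u * z ∈ monSpan D := by
  induction hz using Submodule.span_induction with
  | mem z hz =>
    obtain ⟨⟨x, y, l⟩, rfl⟩ := hz
    exact h x y l
  | zero => simp
  | add x y _ _ hx hy => rw [mul_add]; exact add_mem hx hy
  | smul r x _ hx => rw [mul_smul_comm]; exact Submodule.smul_mem _ _ hx

theorem K_mul_mem_monSpan (ν : Y) {z : Uhat D} (hz : z ∈ monSpan D) :
    Uhat.incl D (U.K D ν) * z ∈ monSpan D := by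
  refine monSpan_induction D (fun x y l => ?_) hz
  rw [hatMon_eq_idem_mul, ← mul_assoc, Uhat.K_idem, smul_mul_assoc, ← hatMon_eq_idem_mul]
  exact Submodule.smul_mem _ _ (hatMon_mem_monSpan D x y l)

theorem J_mul_mem_monSpan (ν : Y) {z : Uhat D} (hz : z ∈ monSpan D) :
    Uhat.incl D (U.J D ν) * z ∈ monSpan D := by
  refine monSpan_induction D (fun x y l => ?_) hz
  rw [hatMon_eq_idem_mul, ← mul_assoc, Uhat.J_idem, smul_mul_assoc, ← hatMon_eq_idem_mul]
  exact Submodule.smul_mem _ _ (hatMon_mem_monSpan D x y l)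

theorem hatMon_append (i : I) (x y : List I) (l : X) : hatMon D (word (x ++ [i])) (word y) l =
    Uhat.incl D (U.tau1 D (U.F D i)) * hatMon D (word x) (word y) l := by
  rw [hatMon, hatMon, word_append, word_cons, word_nil, mul_one, map_mul, minus_ι, U.tau1_mul,
    map_mul, mul_assoc]

theorem E_eq_tau1_F (i : I) :
    U.E D i = pv 0 (C.d i) • (U.K D (-D.tcor i) * U.tau1 D (U.F D i)) := by
  rw [U.tau1_F, mul_smul_comm, smul_smul, pv_mul, ← mul_assoc, (U.relations D).K_mul,
    neg_add_cancel, (U.relations D).K_zero, one_mul, U.pv_one (by simp) (by ring), one_smul]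

theorem E_mul_mem_monSpan (i : I) {z : Uhat D} (hz : z ∈ monSpan D) :
    Uhat.incl D (U.E D i) * z ∈ monSpan D := by
  rw [E_eq_tau1_F, map_smul, map_mul, smul_mul_assoc, mul_assoc]
  refine Submodule.smul_mem _ _ (K_mul_mem_monSpan D _ (monSpan_induction D (fun x y l => ?_) hz))
  rw [← hatMon_append]
  exact hatMon_mem_monSpan D _ _ _

/-- `F_j` can be moved to the right past the factors `τ₁(F_i) = v_i⁻¹ K̃_i E_i`. -/
theorem F_mul_mem_monSpan (j : I) {z : Uhat D} (hz : z ∈ monSpan D) :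
    Uhat.incl D (U.F D j) * z ∈ monSpan D := by
  refine monSpan_induction D (fun x y l => ?_) hz
  induction x using List.reverseRecOn with
  | nil =>
    have : Uhat.incl D (U.F D j) * hatMon D (word []) (word y) l =
        hatMon D (word []) (word (j :: y)) l := by
      simp [hatMon, mul_assoc, U.tau1]
    rw [this]
    exact hatMon_mem_monSpan D _ _ _
  | append_singleton x i ih =>
    have hm := hatMon_mem_monSpan D x y l
    rw [hatMon_append]
    generalize hatMon D (word x) (word y) l = m at *
    have h1 : Uhat.incl D (U.F D j) * (Uhat.incl D (U.tau1 D (U.F D i)) * m) =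
        (pv 0 (-C.d i) * pv 0 (C.form i j)) • (Uhat.incl D (U.K D (D.tcor i)) *
          (Uhat.incl D (U.F D j * U.E D i) * m)) := by
      simp only [← mul_assoc, ← map_mul]
      rw [U.tau1_F, mul_smul_comm, ← mul_assoc, U.F_Kt, smul_mul_assoc, smul_smul, mul_assoc,
        map_smul, smul_mul_assoc]
    rw [h1]
    refine Submodule.smul_mem _ _ (K_mul_mem_monSpan D _ ?_)
    by_cases hij : i = j
    · subst hij
      have h2 : U.F D i * U.E D i = pv (C.d i) 0 • (U.E D i * U.F D i -
          Ring.inverse (pv (C.d i) (C.d i) - pv 0 (-C.d i)) •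
            (U.J D (D.tcor i) * U.K D (D.tcor i) - U.K D (-D.tcor i))) := by
        rw [← U.E_F', sub_sub_cancel, smul_smul, pv_mul, add_zero, U.pv_add_self, one_smul]
      rw [h2]
      simp only [map_smul, map_sub, map_mul, smul_mul_assoc, sub_mul, mul_assoc]
      refine Submodule.smul_mem _ _ (sub_mem (E_mul_mem_monSpan D _ ih)
        (Submodule.smul_mem _ _ (sub_mem (J_mul_mem_monSpan D _ ?_) ?_)))
      · exact K_mul_mem_monSpan D _ hm
      · exact K_mul_mem_monSpan D _ hm
    · have h2 : U.F D j * U.E D i = pv (C.p i * C.p j) 0 • (U.E D i * U.F D j) := by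
        rw [U.E_F_ne' D hij, smul_smul, pv_mul, add_zero, U.pv_add_self, one_smul]
      rw [h2]
      simp only [map_smul, map_mul, smul_mul_assoc, mul_assoc]
      exact Submodule.smul_mem _ _ (E_mul_mem_monSpan D _ ih)

theorem incl_mul_mem_monSpan (u : U D) {z : Uhat D} (hz : z ∈ monSpan D) :
    Uhat.incl D u * z ∈ monSpan D := by
  induction u using U.induction generalizing z with
  | hE i => exact E_mul_mem_monSpan D i hz
  | hF i => exact F_mul_mem_monSpan D i hz
  | hK μ => exact K_mul_mem_monSpan D μ hz
  | hJ μ => exact J_mul_mem_monSpan D μ hz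
  | hs r =>
    rw [AlgHom.commutes, ← Algebra.smul_def]
    exact Submodule.smul_mem _ _ hz
  | ha u w hu hw => rw [map_add, add_mul]; exact add_mem (hu hz) (hw hz)
  | hm u w hu hw => rw [map_mul, mul_assoc]; exact hu (hw hz)

theorem dotSpan_le_monSpan : dotSpan D ≤ monSpan D := by
  refine Submodule.span_le.mpr ?_
  rintro _ ⟨⟨u, l⟩, rfl⟩
  refine incl_mul_mem_monSpan D u ?_
  have h : Uhat.idem D l = hatMon D (word []) (word []) l := by simp [hatMon, U.tau1]
  simp only
  rw [h]
  exact hatMon_mem_monSpan D _ _ _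

namespace dotU

/-- The element `τ₁(x⁻) y⁻ 1_λ` of the modified form. -/
def mon (x y : FreeAlgebra QvPi I) (l : X) : dotU D :=
  lact D (U.tau1 D (minus D x)) (lact D (minus D y) (one D l))

theorem coe_mon (x y : FreeAlgebra QvPi I) (l : X) : (mon D x y l : Uhat D) = hatMon D x y l := rfl

/-- The elements `τ₁(x⁻) y⁻ 1_λ`, for monomials `x` and `y`, span the modified form. -/
theorem mon_induction {P : dotU D → Prop} (hm : ∀ x y l, P (mon D (word x) (word y) l))
    (ha : ∀ x y, P x → P y → P (x + y)) (hs : ∀ (r : QvPi) x, P x → P (r • x)) (x : dotU D) :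
    P x := by
  have h0 : P 0 := by simpa using hs 0 _ (hm [] [] 0)
  have key : ∀ z ∈ monSpan D, ∀ hz : z ∈ dotU D, P ⟨z, hz⟩ := by
    intro z hz
    have hsub : monSpan D ≤ dotSpan D := by
      refine Submodule.span_le.mpr ?_
      rintro _ ⟨⟨x, y, l⟩, rfl⟩
      exact hatMon_mem D _ _ _
    induction hz using Submodule.span_induction with
    | mem z hz =>
      obtain ⟨⟨x, y, l⟩, rfl⟩ := hz
      intro _
      exact hm x y l
    | zero => exact fun _ => h0
    | add z w hz hw hz' hw' =>
      intro _
      exact ha _ _ (hz' ((mem_dotU D).2 (hsub hz))) (hw' ((mem_dotU D).2 (hsub hw)))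
    | smul r z hz hz' =>
      intro _
      exact hs r _ (hz' ((mem_dotU D).2 (hsub hz)))
  exact key x (dotSpan_le_monSpan D ((mem_dotU D).1 x.2)) x.2

theorem lact_add (u : U D) (x y : dotU D) : lact D u (x + y) = lact D u x + lact D u y :=
  Subtype.ext (mul_add _ _ _)

theorem lact_smul (u : U D) (r : QvPi) (x : dotU D) : lact D u (r • x) = r • lact D u x :=
  Subtype.ext (mul_smul_comm _ _ _)

theorem add_lact (u w : U D) (x : dotU D) : lact D (u + w) x = lact D u x + lact D w x :=
  Subtype.ext (by
    change Uhat.incl D (u + w) * (x : Uhat D) = Uhat.incl D u * x + Uhat.incl D w * x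
    rw [map_add, add_mul])

theorem smul_lact (r : QvPi) (u : U D) (x : dotU D) : lact D (r • u) x = r • lact D u x :=
  Subtype.ext (by
    change Uhat.incl D (r • u) * (x : Uhat D) = r • (Uhat.incl D u * x)
    rw [map_smul, smul_mul_assoc])

theorem mul_lact (u w : U D) (x : dotU D) : lact D (u * w) x = lact D u (lact D w x) :=
  Subtype.ext (by
    change Uhat.incl D (u * w) * (x : Uhat D) = Uhat.incl D u * (Uhat.incl D w * x)
    rw [map_mul, mul_assoc])

theorem add_ract (x y : dotU D) (u : U D) : ract D (x + y) u = ract D x u + ract D y u :=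
  Subtype.ext (add_mul _ _ _)

theorem smul_ract (r : QvPi) (x : dotU D) (u : U D) : ract D (r • x) u = r • ract D x u :=
  Subtype.ext (smul_mul_assoc _ _ _)

theorem ract_add (x : dotU D) (u w : U D) : ract D x (u + w) = ract D x u + ract D x w :=
  Subtype.ext (by
    change (x : Uhat D) * Uhat.incl D (u + w) = x * Uhat.incl D u + x * Uhat.incl D w
    rw [map_add, mul_add])

theorem ract_smul (x : dotU D) (r : QvPi) (u : U D) : ract D x (r • u) = r • ract D x u :=
  Subtype.ext (by
    change (x : Uhat D) * Uhat.incl D (r • u) = r • (x * Uhat.incl D u)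
    rw [map_smul, mul_smul_comm])

theorem ract_mul (x : dotU D) (u w : U D) : ract D x (u * w) = ract D (ract D x u) w :=
  Subtype.ext (by
    change (x : Uhat D) * Uhat.incl D (u * w) = x * Uhat.incl D u * Uhat.incl D w
    rw [map_mul, mul_assoc])

theorem lact_algebraMap (r : QvPi) (x : dotU D) : lact D (algebraMap QvPi _ r) x = r • x :=
  Subtype.ext (by
    change Uhat.incl D (algebraMap QvPi _ r) * (x : Uhat D) = r • (x : Uhat D)
    rw [AlgHom.commutes, Algebra.smul_def])

theorem ract_algebraMap (r : QvPi) (x : dotU D) : ract D x (algebraMap QvPi _ r) = r • x :=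
  Subtype.ext (by
    change (x : Uhat D) * Uhat.incl D (algebraMap QvPi _ r) = r • (x : Uhat D)
    rw [AlgHom.commutes, Algebra.smul_def, Algebra.commutes])

theorem lact_mul (u : U D) (x y : dotU D) : lact D u (x * y) = lact D u x * y :=
  Subtype.ext (mul_assoc _ _ _).symm

theorem mul_ract (x y : dotU D) (u : U D) : ract D (x * y) u = x * ract D y u :=
  Subtype.ext (mul_assoc _ _ _)

theorem ract_mul_eq (x y : dotU D) (u : U D) : ract D x u * y = x * lact D u y :=
  Subtype.ext (mul_assoc _ _ _)

theorem one_mul_one (l : X) : one D l * one D l = one D l := Subtype.ext (Uhat.idem_mul_self D l)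

theorem one_mul_one_of_ne {l m : X} (h : l ≠ m) : one D l * one D m = 0 :=
  Subtype.ext (Uhat.idem_mul_ne D h)

theorem one_mul_mon (x y : List I) (l : X) : one D (l - wt D y + wt D x) *
    mon D (word x) (word y) l = mon D (word x) (word y) l :=
  Subtype.ext (hatMon_eq_idem_mul D x y l).symm

theorem mon_mul_one (x y : FreeAlgebra QvPi I) (l : X) : mon D x y l * one D l = mon D x y l :=
  Subtype.ext (hatMon_mul_idem D x y l)

theorem lact_minus_one (w : List I) (l : X) : lact D (minus D (word w)) (one D l) =
    ract D (one D (l - wt D w)) (minus D (word w)) :=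
  Subtype.ext (minus_idem D w l)

end dotU

end Monomials

/-! ### The functional on the modified form -/

section Functional

variable {C : CartanDatum I} {X Y : Type*} [AddCommGroup Y] [AddCommGroup X] (D : RootDatum C Y X)

theorem act_tau1_minus (w : List I) (μ : X) (x y : FreeAlgebra QvPi I) :
    act D (Uhat.incl D (U.tau1 D (minus D (word w)))) (elt C μ x y) =
      elt C (μ + wt D w) (x * word w) y := by
  induction w generalizing μ x with
  | nil => simp [U.tau1]
  | cons i w ih =>
    rw [word_cons, map_mul, minus_ι, U.tau1_mul, map_mul, map_mul, Module.End.mul_apply,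
      act_tau1_F, opH_elt, ih, wt_cons, mul_assoc, add_assoc]

theorem act_minus (w : List I) (μ : X) (y : FreeAlgebra QvPi I) :
    act D (Uhat.incl D (minus D (word w))) (elt C μ 1 y) =
      elt C (μ - wt D w) 1 (word w * y) := by
  induction w with
  | nil => simp
  | cons i w ih =>
    rw [word_cons, map_mul, minus_ι, map_mul, map_mul, Module.End.mul_apply, ih, act_F,
      opF_elt_one, wt_cons, mul_assoc, sub_sub, add_comm (wt D w)]

theorem act_mon (x y : List I) (l μ : X) [Decidable (μ = l)] :
    act D (dotU.mon D (word x) (word y) l) (elt C μ 1 1) =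
      if μ = l then elt C (l - wt D y + wt D x) (word x) (word y) else 0 := by
  rw [dotU.coe_mon, hatMon, map_mul, map_mul, Module.End.mul_apply, Module.End.mul_apply, act_idem,
    opIdem_elt]
  split_ifs with h
  · rw [h, act_minus, act_tau1_minus, one_mul, mul_one]
  · rw [map_zero, map_zero]

theorem finite_support_act (z : dotU D) :
    (Function.support fun μ => act D (z : Uhat D) (elt C μ 1 1)).Finite := by
  classical
  induction z using dotU.mon_induction with
  | hm x y l =>
    refine (Set.finite_singleton l).subset fun μ hμ => ?_
    by_contra h
    exact hμ (by simp only [act_mon]; exact if_neg h)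
  | ha x y hx hy =>
    refine (hx.union hy).subset fun μ hμ => ?_
    by_contra h
    rw [Set.mem_union, not_or, Function.notMem_support, Function.notMem_support] at h
    refine hμ ?_
    simp only [NonUnitalSubalgebra.coe_add, map_add, LinearMap.add_apply, h.1, h.2, add_zero]
  | hs r x hx =>
    refine hx.subset fun μ hμ h => hμ ?_
    simp only [NonUnitalSubalgebra.coe_smul, map_smul, LinearMap.smul_apply, h, smul_zero]

/-- The functional `z ↦ ∑_λ φ(z · (1 ⊗ 1)_λ)` on the modified form, where `φ(x ⊗ y) = (x, y)`. Only
finitely many terms of the sum are nonzero. -/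
def psi : dotU D →ₗ[QvPi] QvPi where
  toFun z := ∑ᶠ μ, phi C X (act D (z : Uhat D) (elt C μ 1 1))
  map_add' z w := by
    rw [← finsum_add_distrib]
    · simp only [NonUnitalSubalgebra.coe_add, map_add, LinearMap.add_apply]
    · exact (finite_support_act D z).subset fun μ hμ h => hμ (by simp only [h, map_zero])
    · exact (finite_support_act D w).subset fun μ hμ h => hμ (by simp only [h, map_zero])
  map_smul' r z := by
    rw [RingHom.id_apply, smul_finsum']
    · simp only [NonUnitalSubalgebra.coe_smul, map_smul, LinearMap.smul_apply]
    · exact (finite_support_act D z).subset fun μ hμ h => hμ (by simp only [h, map_zero])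

theorem psi_mul_one (z : dotU D) (l : X) :
    psi D (z * dotU.one D l) = phi C X (act D (z : Uhat D) (elt C l 1 1)) := by
  classical
  have h : ∀ μ, act D ((z * dotU.one D l : dotU D) : Uhat D) (elt C μ 1 1) =
      if μ = l then act D (z : Uhat D) (elt C l 1 1) else 0 := fun μ => by
    change act D ((z : Uhat D) * Uhat.idem D l) _ = _
    rw [map_mul, Module.End.mul_apply, act_idem, opIdem_elt]
    split_ifs with h
    · rw [h]
    · rw [map_zero]
  change ∑ᶠ μ, phi C X (act D ((z * dotU.one D l : dotU D) : Uhat D) (elt C μ 1 1)) = _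
  rw [finsum_eq_single _ l fun μ hμ => by rw [h, if_neg hμ, map_zero], h, if_pos rfl]

theorem psi_mon (x y : List I) (l : X) :
    psi D (dotU.mon D (word x) (word y) l) = fForm C (word x) (word y) := by
  classical
  rw [← dotU.mon_mul_one, psi_mul_one, act_mon, if_pos rfl, phi_elt]

/-- The monomials `x` and `y` have to agree up to order for `(x, y)` to be nonzero. -/
theorem fForm_word_of_wt_ne {x y : List I} (h : wt D x ≠ wt D y) :
    fForm C (word x) (word y) = 0 :=
  fForm_word_of_not_perm C fun h' => h (wt_perm h')

theorem psi_one_mul_mul_one {l m : X} (h : l ≠ m) (z : dotU D) :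
    psi D (dotU.one D l * z * dotU.one D m) = 0 := by
  induction z using dotU.mon_induction with
  | hm x y k =>
    by_cases h1 : l = k - wt D y + wt D x
    · by_cases h2 : k = m
      · rw [h1, dotU.one_mul_mon, ← h2, dotU.mon_mul_one, psi_mon, fForm_word_of_wt_ne D]
        intro h3
        exact h (by rw [h1, h3, h2]; abel)
      · rw [← dotU.mon_mul_one, mul_assoc, mul_assoc, dotU.one_mul_one_of_ne D h2, mul_zero,
          mul_zero, map_zero]
    · rw [← dotU.one_mul_mon, ← mul_assoc, dotU.one_mul_one_of_ne D h1, zero_mul, zero_mul,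
        map_zero]
  | ha x y hx hy => rw [mul_add, add_mul, map_add, hx, hy, add_zero]
  | hs r x hx => rw [mul_smul_comm, smul_mul_assoc, map_smul, hx, smul_zero]

theorem tau1_mon (x y : List I) (l : X) : dotU.tau1 D (dotU.mon D (word x) (word y) l) =
    dotU.mon D (word y) (word x) (l - wt D y + wt D x) := by
  refine Subtype.ext ?_
  change Uhat.tau1 D (hatMon D _ _ _) = hatMon D _ _ _
  rw [hatMon, hatMon, Uhat.tau1_mul, Uhat.tau1_mul, Uhat.tau1_incl, Uhat.tau1_incl, Uhat.tau1_idem,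
    U.tau1_tau1, minus_idem, add_sub_cancel_right, ← mul_assoc, tau1_minus_idem, sub_add_cancel]

theorem psi_tau1 (z : dotU D) : psi D (dotU.tau1 D z) = psi D z := by
  induction z using dotU.mon_induction with
  | hm x y l => rw [tau1_mon, psi_mon, psi_mon, fForm_symm]
  | ha x y hx hy => rw [map_add, map_add, map_add, hx, hy]
  | hs r x hx => rw [map_smul, map_smul, map_smul, hx]

end Functional

/-! ### The bilinear form on the modified form: existence and uniqueness -/

section Form

variable {C : CartanDatum I} {X Y : Type*} [AddCommGroup Y] [AddCommGroup X] (D : RootDatum C Y X)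

open dotU

/-- The bilinear form `(x, y) = ψ(τ₁(x) y)`. -/
def dotForm : dotU D →ₗ[QvPi] dotU D →ₗ[QvPi] QvPi :=
  ((LinearMap.mul QvPi (dotU D)).comp (dotU.tau1 D)).compr₂ (psi D)

theorem dotForm_apply (x y : dotU D) : dotForm D x y = psi D (dotU.tau1 D x * y) := rfl

theorem dotForm_symm (x y : dotU D) : dotForm D x y = dotForm D y x := by
  rw [dotForm_apply, ← psi_tau1, tau1_mul, tau1_tau1, dotForm_apply]

theorem dotForm_lact (u : U D) (x y : dotU D) :
    dotForm D (lact D u x) y = dotForm D x (lact D (U.tau1 D u) y) := by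
  rw [dotForm_apply, tau1_lact, ract_mul_eq, dotForm_apply]

theorem dotForm_mul_one {l m : X} (h : l ≠ m) (x y : dotU D) :
    dotForm D (x * one D l) (y * one D m) = 0 := by
  rw [dotForm_apply, tau1_mul, tau1_one, mul_assoc, ← mul_assoc (dotU.tau1 D x), ← mul_assoc]
  exact psi_one_mul_mul_one D h _

theorem dotForm_weight (l₁ l₂ l₁' l₂' : X) (x x' : dotU D) (h : ¬ (l₁ = l₁' ∧ l₂ = l₂')) :
    dotForm D (one D l₁ * x * one D l₂) (one D l₁' * x' * one D l₂') = 0 := by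
  by_cases h2 : l₂ = l₂'
  · have h1 : l₁ ≠ l₁' := fun h1 => h ⟨h1, h2⟩
    have e : ∀ a b c d e f : dotU D, a * (b * c) * (d * e * f) = a * b * (c * d) * e * f := by
      intros
      simp only [mul_assoc]
    rw [dotForm_apply, tau1_mul, tau1_mul, tau1_one, tau1_one, e, one_mul_one_of_ne D h1, mul_zero,
      zero_mul, zero_mul, map_zero]
  · exact dotForm_mul_one D h2 _ _

theorem dotForm_one_mon (x y : List I) (l m : X) [Decidable (l = m)] :
    dotForm D (one D l) (mon D (word x) (word y) m) =
      if l = m then fForm C (word x) (word y) else 0 := by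
  split_ifs with h
  · rw [dotForm_apply, tau1_one, h]
    by_cases h' : wt D x = wt D y
    · have := one_mul_mon D x y m
      rw [h', sub_add_cancel] at this
      rw [this, psi_mon]
    · have h1 : m ≠ m - wt D y + wt D x := fun h1 => h' <| by
        have : m = m + (wt D x - wt D y) := h1.trans (by abel)
        exact sub_eq_zero.mp (left_eq_add.mp this)
      rw [← one_mul_mon, ← mul_assoc, one_mul_one_of_ne D h1, zero_mul, map_zero,
        fForm_word_of_wt_ne D h']
  · rw [← one_mul_one D l, ← mon_mul_one, dotForm_mul_one D h]

theorem dotForm_half (x y : FreeAlgebra QvPi I) (l : X) :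
    dotForm D (lact D (minus D x) (one D l)) (lact D (minus D y) (one D l)) = fForm C x y := by
  classical
  induction x using word_induction with
  | hw x =>
    induction y using word_induction with
    | hw y =>
      rw [dotForm_lact]
      exact (dotForm_one_mon D x y l l).trans (if_pos rfl)
    | ha x y hx hy => rw [map_add, map_add, add_lact, map_add, hx, hy]
    | hs r x hx => rw [map_smul, map_smul, smul_lact, map_smul, hx]
  | ha x y hx hy =>
    rw [map_add, map_add, add_lact, map_add, LinearMap.add_apply, hx, hy, LinearMap.add_apply]
  | hs r x hx =>
    rw [map_smul, map_smul, smul_lact, map_smul, LinearMap.smul_apply, hx, LinearMap.smul_apply]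

theorem isDotForm_dotForm : IsDotForm D (dotForm D) where
  weight := dotForm_weight D
  adjoint := dotForm_lact D
  half := dotForm_half D
  symm := dotForm_symm D

theorem lact_minus_one_eq (w : List I) (l : X) : lact D (minus D (word w)) (one D l) =
    one D (l - wt D w) * lact D (minus D (word w)) (one D l) * one D l := by
  rw [mul_assoc, ← lact_mul, one_mul_one, lact_minus_one, ← mul_ract, one_mul_one]

/-- A form is determined by adjointness and its values on pairs `x⁻ 1_λ`, `y⁻ 1_μ`: adjointness
turns the value on `1_λ` and `τ₁(x⁻) y⁻ 1_μ` into the value on such a pair. -/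
theorem eq_dotForm {B : dotU D →ₗ[QvPi] dotU D →ₗ[QvPi] QvPi}
    (hweight : ∀ (x y : List I) (l m : X), l ≠ m →
      B (lact D (minus D (word x)) (one D l)) (lact D (minus D (word y)) (one D m)) = 0)
    (hadjoint : ∀ (u : U D) (x y : dotU D), B (lact D u x) y = B x (lact D (U.tau1 D u) y))
    (hhalf : ∀ (x y : List I) (l : X),
      B (lact D (minus D (word x)) (one D l)) (lact D (minus D (word y)) (one D l)) =
        fForm C (word x) (word y)) : B = dotForm D := by
  classical
  have key : ∀ l z, B (one D l) z = dotForm D (one D l) z := by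
    intro l z
    induction z using mon_induction with
    | hm x y m =>
      rw [dotForm_one_mon, mon, ← hadjoint]
      split_ifs with h
      · rw [h, hhalf]
      · exact hweight x y l m h
    | ha x y hx hy => rw [map_add, map_add, hx, hy]
    | hs r x hx => rw [map_smul, map_smul, hx]
  refine LinearMap.ext_on_range (span_eq_top D) ?_
  rintro ⟨u, l⟩
  refine LinearMap.ext fun z => ?_
  rw [hadjoint, key, dotForm_lact]

theorem IsDotForm.eq_dotForm {B : dotU D →ₗ[QvPi] dotU D →ₗ[QvPi] QvPi} (h : IsDotForm D B) :
    B = dotForm D :=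
  QCov.eq_dotForm D
    (fun x y l m hlm => by
      rw [lact_minus_one_eq, lact_minus_one_eq D y]
      exact h.weight _ _ _ _ _ _ fun h' => hlm h'.2)
    h.adjoint fun _ _ _ => h.half _ _ _

end Form

/-! ### Adjointness for the right action -/

section RightAdjoint

variable {C : CartanDatum I} {X Y : Type*} [AddCommGroup Y] [AddCommGroup X] (D : RootDatum C Y X)

open dotU

namespace dotU

theorem lact_ract (u w : U D) (x : dotU D) :
    lact D u (ract D x w) = ract D (lact D u x) w :=
  Subtype.ext (mul_assoc _ _ _).symm

theorem lact_K_one (ν : Y) (l : X) :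
    lact D (U.K D ν) (one D l) = pv 0 (D.pairing ν l) • one D l :=
  Subtype.ext (Uhat.K_idem D ν l)

theorem lact_J_one (ν : Y) (l : X) :
    lact D (U.J D ν) (one D l) = pv (D.pairing ν l) 0 • one D l :=
  Subtype.ext (Uhat.J_idem D ν l)

theorem ract_one_K (ν : Y) (l : X) :
    ract D (one D l) (U.K D ν) = pv 0 (D.pairing ν l) • one D l :=
  Subtype.ext (Uhat.idem_K D ν l)

theorem ract_one_J (ν : Y) (l : X) :
    ract D (one D l) (U.J D ν) = pv (D.pairing ν l) 0 • one D l :=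
  Subtype.ext (Uhat.idem_J D ν l)

theorem lact_F_one (i : I) (l : X) :
    lact D (U.F D i) (one D l) = ract D (one D (l - D.root i)) (U.F D i) :=
  Subtype.ext (Uhat.F_idem D i l)

theorem ract_one_F (i : I) (l : X) :
    ract D (one D l) (U.F D i) = lact D (U.F D i) (one D (l + D.root i)) := by
  rw [lact_F_one, add_sub_cancel_right]

theorem lact_K_mon (ν : Y) (x y : List I) (l : X) :
    lact D (U.K D ν) (mon D (word x) (word y) l) =
      pv 0 (D.pairing ν (l - wt D y + wt D x)) • mon D (word x) (word y) l := by
  rw [← one_mul_mon, lact_mul, lact_K_one, smul_mul_assoc]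

theorem lact_J_mon (ν : Y) (x y : List I) (l : X) :
    lact D (U.J D ν) (mon D (word x) (word y) l) =
      pv (D.pairing ν (l - wt D y + wt D x)) 0 • mon D (word x) (word y) l := by
  rw [← one_mul_mon, lact_mul, lact_J_one, smul_mul_assoc]

theorem ract_mon_K (ν : Y) (x y : FreeAlgebra QvPi I) (l : X) :
    ract D (mon D x y l) (U.K D ν) = pv 0 (D.pairing ν l) • mon D x y l := by
  rw [← mon_mul_one, mul_ract, ract_one_K, mul_smul_comm]

theorem ract_mon_J (ν : Y) (x y : FreeAlgebra QvPi I) (l : X) :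
    ract D (mon D x y l) (U.J D ν) = pv (D.pairing ν l) 0 • mon D x y l := by
  rw [← mon_mul_one, mul_ract, ract_one_J, mul_smul_comm]

theorem ract_mon_F (i : I) (x y : FreeAlgebra QvPi I) (l : X) :
    ract D (mon D x y l) (U.F D i) = mon D x (y * θ i) (l + D.root i) := by
  rw [mon, ← lact_ract, ← lact_ract, ract_one_F, ← mul_lact D (minus D y),
    ← minus_ι D, ← map_mul, mon]

end dotU

theorem psi_lact_mon (u : U D) (x y : List I) (l : X) :
    psi D (lact D u (mon D (word x) (word y) l)) =
      phi C X (act D (Uhat.incl D u) (elt C (l - wt D y + wt D x) (word x) (word y))) := by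
  classical
  rw [← mon_mul_one, lact_mul, psi_mul_one]
  change phi C X (act D (Uhat.incl D u * (mon D (word x) (word y) l : Uhat D)) _) = _
  rw [map_mul, Module.End.mul_apply, act_mon, if_pos rfl]

theorem U.tau1bar_tau1bar (u : U D) : U.tau1bar D (U.tau1bar D u) = u := by
  induction u using U.induction with
  | hE i =>
    rw [U.tau1bar_E, map_smul, U.tau1bar_mul, U.tau1bar_mul, U.tau1bar_F, U.tau1bar_K, U.tau1bar_J,
      mul_smul_comm, U.E_JKtn, mul_smul_comm, smul_smul, smul_smul, ← mul_assoc,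
      mul_assoc (U.K D _), U.J_sq', (U.relations D).K_mul, add_neg_cancel,
      (U.relations D).K_zero, one_mul, pv_mul, pv_mul, C.form_self,
      U.pv_one (by simp) (by ring), one_smul]
  | hF i =>
    rw [U.tau1bar_F, map_smul, U.tau1bar_mul, U.tau1bar_mul, U.tau1bar_E, U.tau1bar_K, U.tau1bar_J,
      mul_smul_comm, U.F_JKt, mul_smul_comm, smul_smul, smul_smul, ← mul_assoc,
      mul_assoc (U.K D _), U.J_sq', (U.relations D).K_mul, neg_add_cancel,
      (U.relations D).K_zero, one_mul, pv_mul, pv_mul, C.form_self,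
      U.pv_one (by simp) (by ring), one_smul]
  | hK μ => rw [U.tau1bar_K, U.tau1bar_K]
  | hJ μ => rw [U.tau1bar_J, U.tau1bar_J]
  | hs r => rw [U.tau1bar_algebraMap, U.tau1bar_algebraMap]
  | ha u w hu hw => rw [map_add, map_add, hu, hw]
  | hm u w hu hw => rw [U.tau1bar_mul, U.tau1bar_mul, hu, hw]

theorem psi_tau1_K (ν : Y) (z : dotU D) :
    psi D (lact D (U.tau1 D (U.K D ν)) z) = psi D (ract D z (U.tau1bar D (U.K D ν))) := by
  rw [U.tau1_K, U.tau1bar_K]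
  induction z using mon_induction with
  | hm x y l =>
    rw [lact_K_mon, ract_mon_K, map_smul, map_smul, psi_mon]
    by_cases h : wt D x = wt D y
    · rw [h, sub_add_cancel]
    · rw [fForm_word_of_wt_ne D h, smul_zero, smul_zero]
  | ha x y hx hy => rw [lact_add, add_ract, map_add, map_add, hx, hy]
  | hs r x hx => rw [lact_smul, smul_ract, map_smul, map_smul, hx]

theorem psi_tau1_J (ν : Y) (z : dotU D) :
    psi D (lact D (U.tau1 D (U.J D ν)) z) = psi D (ract D z (U.tau1bar D (U.J D ν))) := by
  rw [U.tau1_J, U.tau1bar_J]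
  induction z using mon_induction with
  | hm x y l =>
    rw [lact_J_mon, ract_mon_J, map_smul, map_smul, psi_mon]
    by_cases h : wt D x = wt D y
    · rw [h, sub_add_cancel]
    · rw [fForm_word_of_wt_ne D h, smul_zero, smul_zero]
  | ha x y hx hy => rw [lact_add, add_ract, map_add, map_add, hx, hy]
  | hs r x hx => rw [lact_smul, smul_ract, map_smul, map_smul, hx]

/-- On `τ₁(x⁻) y⁻ 1_λ` both sides are multiples of `(x, y θ_i)`. The scalars agree when `x` and `y
θ_i` have the same weight, and otherwise the form vanishes. -/
theorem psi_tau1_E (i : I) (z : dotU D) :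
    psi D (lact D (U.tau1 D (U.E D i)) z) = psi D (ract D z (U.tau1bar D (U.E D i))) := by
  induction z using mon_induction with
  | hm x y l =>
    have h1 : U.tau1 D (U.E D i) = pv 0 (C.d i) • (U.F D i * U.K D (-D.tcor i)) := by
      rw [U.tau1_E, U.F_Ktn, smul_smul, pv_mul, C.form_self]
      congr 2
      ring
    rw [psi_lact_mon, h1, map_smul, map_smul, map_mul, map_mul, LinearMap.smul_apply,
      Module.End.mul_apply, act_K, act_F, opK_elt, map_smul, map_smul, map_smul, phi_opF,
      U.tau1bar_E, ract_smul, ract_mul, ract_mul, ract_mon_F, ract_mon_J, smul_ract, ract_mon_K,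
      map_smul, map_smul, map_smul]
    have h2 : word y * θ i = word (y ++ [i]) := by simp [word_append]
    rw [h2, psi_mon]
    by_cases h : wt D x = wt D (y ++ [i])
    · have e : D.pairing (D.tcor i) (l - wt D y + wt D x) =
          D.pairing (D.tcor i) (l + D.root i) := by
        rw [h, wt_perm (List.perm_append_singleton i y), wt_cons]
        congr 1
        abel
      rw [map_neg, LinearMap.neg_apply, e]
      simp only [smul_eq_mul, ← mul_assoc, pv_mul]
      congr 1
      exact pv_congr ⟨0, by ring⟩ (by ring)
    · rw [fForm_word_of_wt_ne D h, mul_zero, smul_zero, smul_zero, smul_zero, smul_zero, smul_zero]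
  | ha x y hx hy => rw [lact_add, add_ract, map_add, map_add, hx, hy]
  | hs r x hx => rw [lact_smul, smul_ract, map_smul, map_smul, hx]

theorem psi_tau1_mul {u w : U D}
    (hu : ∀ z, psi D (lact D (U.tau1 D u) z) = psi D (ract D z (U.tau1bar D u)))
    (hw : ∀ z, psi D (lact D (U.tau1 D w) z) = psi D (ract D z (U.tau1bar D w))) (z : dotU D) :
    psi D (lact D (U.tau1 D (u * w)) z) = psi D (ract D z (U.tau1bar D (u * w))) := by
  rw [U.tau1_mul, mul_lact, hw, ← lact_ract, hu, ← ract_mul, U.tau1bar_mul]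

/-- The relation that holds for `u = τ̄₁(F_i)`, a product of `E_i` and elements of the torus, gives
the one for `F_i`, as `ψ` is invariant under `τ₁`. -/
theorem psi_tau1_F (i : I) (z : dotU D) :
    psi D (lact D (U.tau1 D (U.F D i)) z) = psi D (ract D z (U.tau1bar D (U.F D i))) := by
  have h : ∀ z, psi D (lact D (U.tau1 D (U.tau1bar D (U.F D i))) z) =
      psi D (ract D z (U.tau1bar D (U.tau1bar D (U.F D i)))) := by
    intro z
    rw [U.tau1bar_F, map_smul, map_smul, smul_lact, ract_smul, map_smul, map_smul,
      psi_tau1_mul D (psi_tau1_E D i) (psi_tau1_mul D (psi_tau1_J D _) (psi_tau1_K D _))]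
  rw [← psi_tau1, tau1_lact, U.tau1_tau1, ← psi_tau1 D (ract D z _), tau1_ract, h,
    U.tau1bar_tau1bar]

/-- The functional `ψ` turns the left action through `τ₁` into the right action through `τ̄₁`. -/
theorem psi_lact_tau1 (u : U D) (z : dotU D) :
    psi D (lact D (U.tau1 D u) z) = psi D (ract D z (U.tau1bar D u)) := by
  induction u using U.induction generalizing z with
  | hE i => exact psi_tau1_E D i z
  | hF i => exact psi_tau1_F D i z
  | hK μ => exact psi_tau1_K D μ z
  | hJ μ => exact psi_tau1_J D μ z
  | hs r => rw [U.tau1_algebraMap, U.tau1bar_algebraMap, lact_algebraMap, ract_algebraMap]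
  | ha u w hu hw => rw [map_add, map_add, add_lact, ract_add, map_add, map_add, hu, hw]
  | hm u w hu hw => exact psi_tau1_mul D hu hw z

theorem dotForm_ract (x y : dotU D) (u : U D) :
    dotForm D (ract D x u) y = dotForm D x (ract D y (U.tau1bar D u)) := by
  rw [dotForm_apply, tau1_ract, ← lact_mul, psi_lact_tau1, mul_ract, dotForm_apply]

end RightAdjoint

/-! ### Invariance under `ρ` -/

section Rho

variable {C : CartanDatum I} {X Y : Type*} [AddCommGroup Y] [AddCommGroup X] (D : RootDatum C Y X)

open dotU

theorem U.tau1bar_rho (u : U D) : U.tau1bar D (U.rho D u) = U.rho D (U.tau1 D u) := by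
  induction u using U.induction with
  | hE i =>
    rw [U.rho_E, U.tau1_E, map_smul, map_smul, U.tau1bar_mul, U.tau1bar_E, U.tau1bar_J, U.rho_mul,
      U.rho_F, U.rho_K, neg_neg, smul_mul_assoc, smul_smul, pv_mul, mul_assoc, mul_assoc, U.K_J,
      U.J_sq']
    congr 1
    exact pv_congr ⟨C.d i, by ring⟩ (by ring)
  | hF i =>
    rw [U.rho_F, U.tau1_F, map_smul, U.tau1bar_F, U.rho_mul, U.rho_E, U.rho_K,
      smul_mul_assoc, smul_smul, pv_mul, ← U.E_Jt, mul_assoc]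
    congr 1
    exact pv_congr ⟨0, by ring⟩ (by ring)
  | hK μ => rw [U.rho_K, U.tau1_K, U.tau1bar_K, U.rho_K]
  | hJ μ => rw [U.rho_J, U.tau1_J, U.tau1bar_J, U.rho_J]
  | hs r => rw [U.rho_algebraMap, U.tau1_algebraMap, U.tau1bar_algebraMap, U.rho_algebraMap]
  | ha u w hu hw => simp only [map_add, hu, hw]
  | hm u w hu hw => rw [U.rho_mul, U.tau1_mul, U.tau1bar_mul, U.rho_mul, hu, hw]

theorem rho_minus (x : FreeAlgebra QvPi I) : U.rho D (minus D x) = minus D (rev x) := by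
  induction x using free_induction_left with
  | h1 =>
    have h := U.rho_algebraMap D 1
    rw [map_one (algebraMap QvPi (U D)), ← map_one (minus D)] at h
    rw [rev_one, h]
  | hm i x hx => rw [map_mul, minus_ι, U.rho_mul, hx, U.rho_F, rev_mul, map_mul, rev_ι, minus_ι]
  | ha x y hx hy => simp only [map_add, hx, hy]
  | hs r x hx => simp only [map_smul, hx]

theorem dotU.rho_lact (u : U D) (x : dotU D) :
    rho D (lact D u x) = ract D (rho D x) (U.rho D u) := by
  refine Subtype.ext ?_
  change Uhat.rho D (Uhat.incl D u * x) = Uhat.rho D x * Uhat.incl D (U.rho D u)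
  rw [Uhat.rho_mul, Uhat.rho_incl]

theorem rho_lact_minus_one (w : List I) (l : X) : rho D (lact D (minus D (word w)) (one D l)) =
    lact D (minus D (word w.reverse)) (one D (-l + wt D w)) := by
  rw [rho_lact_one, rho_minus, rev_word, lact_minus_one, wt_perm w.reverse_perm,
    add_sub_cancel_right]

theorem dotForm_one_mul {l m : X} (h : l ≠ m) (x y : dotU D) :
    dotForm D (one D l * x) (one D m * y) = 0 := by
  rw [dotForm_apply, tau1_mul, tau1_one, mul_assoc, ← mul_assoc (one D l),
    one_mul_one_of_ne D h, zero_mul, mul_zero, map_zero]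

theorem dotForm_lact_one {l m : X} (h : l ≠ m) (u w : U D) :
    dotForm D (lact D u (one D l)) (lact D w (one D m)) = 0 := by
  rw [← one_mul_one D l, ← one_mul_one D m, lact_mul, lact_mul, dotForm_mul_one D h]

theorem dotForm_ract_one {l m : X} (h : l ≠ m) (u w : U D) :
    dotForm D (ract D (one D l) u) (ract D (one D m) w) = 0 := by
  rw [← one_mul_one D l, ← one_mul_one D m, mul_ract, mul_ract, dotForm_one_mul D h]

theorem dotForm_rho (x y : dotU D) : dotForm D (rho D x) (rho D y) = dotForm D x y := by
  have h : (dotForm D).compl₁₂ (rho D) (rho D) = dotForm D := by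
    refine eq_dotForm D ?_ ?_ ?_
    · intro x y l m hlm
      rw [LinearMap.compl₁₂_apply, rho_lact_one, rho_lact_one,
        dotForm_ract_one D (fun h => hlm (neg_injective h))]
    · intro u x y
      rw [LinearMap.compl₁₂_apply, LinearMap.compl₁₂_apply, rho_lact, rho_lact, dotForm_ract,
        U.tau1bar_rho]
    · intro x y l
      rw [LinearMap.compl₁₂_apply, rho_lact_minus_one, rho_lact_minus_one]
      by_cases h : wt D x = wt D y
      · rw [h, dotForm_half, ← rev_word, ← rev_word, fForm_rev]
      · rw [dotForm_lact_one D (fun h' => h (add_left_cancel h')), fForm_word_of_wt_ne D h]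
  exact LinearMap.congr_fun₂ h x y

end Rho

/-! ### Invariance under `ω` -/

section Omega

variable {C : CartanDatum I} {X Y : Type*} [AddCommGroup Y] [AddCommGroup X] (D : RootDatum C Y X)

open dotU

namespace U

theorem omega_E (i : I) : omega D (E D i) = F D i := lift_E _ _

theorem omega_F (i : I) : omega D (F D i) = pv (C.d i) 0 • (J D (D.tcor i) * E D i) := lift_F _ _

theorem omega_K (ν : Y) : omega D (K D ν) = K D (-ν) := lift_K _ _

theorem omega_J (ν : Y) : omega D (J D ν) = J D ν := lift_J _ _

theorem omega_symm_E (i : I) :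
    (omega D).symm (E D i) = pv (C.d i) 0 • (J D (D.tcor i) * F D i) := lift_E _ _

theorem omega_symm_F (i : I) : (omega D).symm (F D i) = E D i := lift_F _ _

theorem omega_symm_K (ν : Y) : (omega D).symm (K D ν) = K D (-ν) := lift_K _ _

theorem omega_symm_J (ν : Y) : (omega D).symm (J D ν) = J D ν := lift_J _ _

theorem tau1_omega (u : U D) : tau1 D (omega D u) = (omega D).symm (tau1 D u) := by
  induction u using U.induction with
  | hE i =>
    rw [omega_E, tau1_F, tau1_E, map_smul, map_mul, omega_symm_F, omega_symm_K, neg_neg]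
  | hF i =>
    rw [omega_F, tau1_F, map_smul, map_smul, tau1_mul, tau1_E, tau1_J, map_mul, omega_symm_E,
      omega_symm_K, smul_mul_assoc, mul_smul_comm, smul_smul, smul_smul, mul_assoc, F_Jt,
      mul_comm (pv (C.d i) 0)]
  | hK μ => rw [omega_K, tau1_K, tau1_K, omega_symm_K]
  | hJ μ => rw [omega_J, tau1_J, omega_symm_J]
  | hs r => rw [AlgEquiv.commutes, tau1_algebraMap, AlgEquiv.commutes]
  | ha u w hu hw => simp only [map_add, hu, hw]
  | hm u w hu hw => rw [map_mul, tau1_mul, tau1_mul, map_mul, hu, hw]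

end U

namespace dotU

theorem one_lact (x : dotU D) : lact D 1 x = x := by
  have h := lact_algebraMap D 1 x
  rwa [map_one, one_smul] at h

theorem omega_lact (u : U D) (x : dotU D) :
    omega D (lact D u x) = lact D (U.omega D u) (omega D x) := by
  refine Subtype.ext ?_
  change Uhat.omegaHom D (Uhat.incl D u * x) = Uhat.incl D (U.omega D u) * Uhat.omegaHom D x
  rw [map_mul]
  congr 1
  rw [Uhat.omegaHom, Uhat.lift_incl]
  rfl

theorem omega_ract (x : dotU D) (u : U D) :
    omega D (ract D x u) = ract D (omega D x) (U.omega D u) := by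
  refine Subtype.ext ?_
  change Uhat.omegaHom D (x * Uhat.incl D u) = Uhat.omegaHom D x * Uhat.incl D (U.omega D u)
  rw [map_mul]
  congr 1
  rw [Uhat.omegaHom, Uhat.lift_incl]
  rfl

theorem omega_one (l : X) : omega D (one D l) = one D (-l) := by
  refine Subtype.ext ?_
  change Uhat.omegaHom D (Uhat.idem D l) = Uhat.idem D (-l)
  rw [Uhat.omegaHom, Uhat.lift_idem]

theorem omega_symm_one (l : X) : (omega D).symm (one D l) = one D (-l) := by
  rw [LinearEquiv.symm_apply_eq, omega_one, neg_neg]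

theorem omega_symm_lact (u : U D) (x : dotU D) :
    (omega D).symm (lact D u x) = lact D ((U.omega D).symm u) ((omega D).symm x) := by
  rw [LinearEquiv.symm_apply_eq, omega_lact, AlgEquiv.apply_symm_apply,
    LinearEquiv.apply_symm_apply]

theorem omega_symm_ract (x : dotU D) (u : U D) :
    (omega D).symm (ract D x u) = ract D ((omega D).symm x) ((U.omega D).symm u) := by
  rw [LinearEquiv.symm_apply_eq, omega_ract, AlgEquiv.apply_symm_apply,
    LinearEquiv.apply_symm_apply]

end dotU

/-- The exponent `∑_k (⟨d_{i_k} i_k, ν - i_1' - ⋯ - i_{k-1}'⟩ - d_{i_k})` of a monomial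
`θ_{i_1} ⋯ θ_{i_n}` and a weight `ν`. -/
def wtExp : List I → X → ℤ
  | [], _ => 0
  | i :: w, ν => D.pairing (D.tcor i) ν - C.d i + wtExp w (ν - D.root i)

variable {D} in
/-- Exchanging two neighbours `i` and `j` does not change the exponent, as `i · j = j · i`. -/
theorem wtExp_perm {x y : List I} (h : x.Perm y) (ν : X) : wtExp D x ν = wtExp D y ν := by
  induction h generalizing ν with
  | nil => rfl
  | cons i h ih => rw [wtExp, wtExp, ih]
  | swap i j w =>
    simp only [wtExp, map_sub, D.pairing_tcor, C.form_symm i j]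
    rw [sub_right_comm ν]
    ring
  | trans h h' ih ih' => rw [ih, ih']

/-- On the left of `1_ν`, the element `τ₁(ω(x⁻))` is a multiple of `y⁻`, where `y` is the reversal
of the monomial `x`. -/
theorem lact_tau1_omega_minus (w : List I) (ν : X) :
    lact D (U.tau1 D (U.omega D (minus D (word w)))) (one D ν) =
      pv (wtExp D w ν) (-wtExp D w ν) • lact D (minus D (word w.reverse)) (one D ν) := by
  induction w generalizing ν with
  | nil =>
    have h := U.tau1_algebraMap D 1
    rw [map_one] at h
    rw [word_nil, List.reverse_nil, word_nil, map_one, map_one, h, wtExp, neg_zero, pv_zero,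
      one_smul]
  | cons i w ih =>
    have h1 : lact D (U.tau1 D (U.omega D (U.F D i))) (one D ν) =
        pv (D.pairing (D.tcor i) ν - C.d i) (-(D.pairing (D.tcor i) ν - C.d i)) •
          ract D (one D (ν - D.root i)) (U.F D i) := by
      rw [U.tau1_omega, U.tau1_F, map_smul, map_mul, U.omega_symm_E, U.omega_symm_K,
        mul_smul_comm, smul_smul, pv_mul, smul_lact, mul_lact, mul_lact, lact_F_one, lact_ract,
        lact_J_one, smul_ract, lact_smul, lact_ract, lact_K_one, smul_ract, smul_smul, smul_smul,
        pv_mul, pv_mul, map_neg, LinearMap.neg_apply, map_sub, D.pairing_tcor, C.form_self]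
      congr 1
      exact pv_congr ⟨0, by ring⟩ (by ring)
    rw [word_cons, map_mul, map_mul, U.tau1_mul, mul_lact, minus_ι, h1, lact_smul, lact_ract, ih,
      smul_ract, ← lact_ract, ← lact_F_one, ← mul_lact, ← minus_ι D, ← map_mul, smul_smul, pv_mul,
      List.reverse_cons, word_append, word_cons, word_nil, mul_one, wtExp, neg_add]

/-- On the left of `1_l`, the element `τ₁(τ̄₁(ω⁻¹(x⁻)))` is a multiple of `τ₁(y⁻)`, where `y` is the
reversal of the monomial `x`. -/
theorem lact_tau1_tau1bar_minus (w : List I) (l : X) :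
    lact D (U.tau1 D (U.tau1bar D ((U.omega D).symm (minus D (word w))))) (one D l) =
      pv (wtExp D w (l + wt D w)) (wtExp D w (l + wt D w)) •
        lact D (U.tau1 D (minus D (word w.reverse))) (one D l) := by
  induction w with
  | nil =>
    have h := U.tau1_algebraMap D 1
    have h' := U.tau1bar_algebraMap D 1
    rw [map_one] at h h'
    rw [word_nil, List.reverse_nil, word_nil, map_one, map_one, h', h, wtExp, pv_zero, one_smul]
  | cons i w ih =>
    have h1 : U.tau1 D (U.tau1bar D ((U.omega D).symm (U.F D i))) = pv (C.d i) (-C.d i) •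
        (U.J D (D.tcor i) * (U.K D (D.tcor i) * U.tau1 D (U.F D i))) := by
      rw [U.omega_symm_F, U.tau1bar_E, map_smul, U.tau1_mul, U.tau1_mul, U.tau1_J, U.tau1_K,
        U.K_J, mul_assoc]
    have h2 : lact D (U.tau1 D (U.F D i))
        (lact D (U.tau1 D (minus D (word w.reverse))) (one D l)) =
        lact D (U.tau1 D (minus D (word (i :: w).reverse))) (one D l) := by
      rw [← mul_lact, ← U.tau1_mul, ← minus_ι D, ← map_mul, List.reverse_cons, word_append,
        word_cons, word_nil, mul_one]
    have h3 : lact D (U.tau1 D (minus D (word (i :: w).reverse))) (one D l) =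
        one D (l + wt D (i :: w)) *
          lact D (U.tau1 D (minus D (word (i :: w).reverse))) (one D l) := by
      have := one_mul_mon D (i :: w).reverse [] l
      rw [wt_nil, sub_zero, wt_perm (List.reverse_perm _)] at this
      simpa [mon, one_lact] using this.symm
    rw [word_cons, map_mul, map_mul, U.tau1bar_mul, U.tau1_mul, mul_lact, ih, lact_smul, minus_ι,
      h1, smul_lact, mul_lact, mul_lact, h2, h3, lact_mul, lact_K_one, smul_mul_assoc, lact_smul,
      lact_mul, lact_J_one, smul_mul_assoc, smul_smul, smul_smul, smul_smul, pv_mul, pv_mul,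
      pv_mul, wtExp]
    have e : l + wt D (i :: w) - D.root i = l + wt D w := by rw [wt_cons]; abel
    rw [e]
    congr 1
    exact pv_congr ⟨C.d i, by ring⟩ (by ring)

theorem omega_lact_minus_one (w : List I) (l : X) : omega D (lact D (minus D (word w)) (one D l)) =
    ract D (one D (-l + wt D w)) (U.omega D (minus D (word w))) := by
  rw [lact_minus_one, omega_ract, omega_one, neg_sub', sub_neg_eq_add]

theorem omega_symm_lact_minus_one (w : List I) (l : X) :
    (omega D).symm (lact D (minus D (word w)) (one D l)) =
      ract D (one D (-l + wt D w)) ((U.omega D).symm (minus D (word w))) := by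
  rw [lact_minus_one, omega_symm_ract, omega_symm_one, neg_sub', sub_neg_eq_add]

/-- The right adjointness moves `ω⁻¹(y⁻)` to the left as `τ₁(τ̄₁(ω⁻¹(y⁻)))`. The two scalars `π^a
v^{-a}` and `π^b v^b` that arise have `a = b` when `x` and `y` agree up to order, and what remains
is the form of the reversals of `x` and `y`. -/
theorem dotForm_omega_minus (x y : List I) (l : X) :
    dotForm D (omega D (lact D (minus D (word x)) (one D l)))
      ((omega D).symm (lact D (minus D (word y)) (one D l))) = fForm C (word x) (word y) := by
  rw [omega_lact_minus_one, omega_symm_lact_minus_one]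
  by_cases h : wt D x = wt D y
  · have h1 : lact D (minus D (word x.reverse)) (one D (-l + wt D y)) =
        ract D (one D (-l)) (minus D (word x.reverse)) := by
      rw [lact_minus_one, wt_perm x.reverse_perm, h, add_sub_cancel_right]
    have h2 := psi_mon D y.reverse x.reverse (-l + wt D y)
    rw [mon, ← rev_word, ← rev_word, fForm_rev, rev_word, rev_word, fForm_symm] at h2
    rw [dotForm_apply, h, tau1_ract, tau1_one, ← mul_ract, ← lact_mul, one_mul_one,
      ← U.tau1bar_tau1bar D ((U.omega D).symm (minus D (word y))), ← psi_lact_tau1,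
      lact_tau1_omega_minus, lact_smul, h1, lact_ract, lact_tau1_tau1bar_minus, smul_ract,
      ← lact_ract, ← h1, map_smul, map_smul, h2, smul_smul, pv_mul]
    by_cases hxy : x.Perm y
    · rw [wtExp_perm hxy, U.pv_one ⟨_, rfl⟩ (neg_add_cancel _), one_smul]
    · rw [fForm_word_of_not_perm C hxy, smul_zero]
  · rw [dotForm_ract_one D (fun h' => h (add_left_cancel h')), fForm_word_of_wt_ne D h]

theorem dotForm_omega (x y : dotU D) :
    dotForm D (omega D x) ((omega D).symm y) = dotForm D x y := by
  have h : (dotForm D).compl₁₂ (omega D).toLinearMap (omega D).symm.toLinearMap = dotForm D := by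
    refine eq_dotForm D ?_ ?_ ?_
    · intro x y l m hlm
      rw [LinearMap.compl₁₂_apply, LinearEquiv.coe_coe, LinearEquiv.coe_coe, omega_lact,
        omega_symm_lact, omega_one, omega_symm_one,
        dotForm_lact_one D (fun h => hlm (neg_injective h))]
    · intro u x y
      rw [LinearMap.compl₁₂_apply, LinearMap.compl₁₂_apply, LinearEquiv.coe_coe,
        LinearEquiv.coe_coe, omega_lact, omega_symm_lact, dotForm_lact, U.tau1_omega]
    · intro x y l
      exact dotForm_omega_minus D x y l
  exact LinearMap.congr_fun₂ h x y

end Omega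

end QCov

end

theorem mainTheorem8 {I Y X : Type*} [Finite I] [AddCommGroup Y] [AddCommGroup X]
    [Module.Free ℤ Y] [Module.Finite ℤ Y] [Module.Free ℤ X] [Module.Finite ℤ X]
    (C : QCov.CartanDatum I) (D : QCov.RootDatum C Y X) :
    ∃ B : QCov.dotU D →ₗ[QCov.QvPi] QCov.dotU D →ₗ[QCov.QvPi] QCov.QvPi,
      QCov.IsDotForm D B ∧ (∀ B', QCov.IsDotForm D B' → B' = B) ∧
      (∀ (x y : QCov.dotU D) (u : QCov.U D),
        B (QCov.dotU.ract D x u) y = B x (QCov.dotU.ract D y (QCov.U.tau1bar D u))) ∧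
      (∀ x y : QCov.dotU D, B (QCov.dotU.rho D x) (QCov.dotU.rho D y) = B x y) ∧
      (∀ x y : QCov.dotU D,
        B (QCov.dotU.omega D x) ((QCov.dotU.omega D).symm y) = B x y) := by
  exact ⟨QCov.dotForm D, QCov.isDotForm_dotForm D, fun _ h => h.eq_dotForm D, QCov.dotForm_ract D,
    QCov.dotForm_rho D, QCov.dotForm_omega D⟩
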